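/- Let $k$ be a field with $\operatorname{char} k\neq 2$, let $Q$ be the quiver with vertices $1,2$ and arrows $\alpha_1:1\to 2$, $\alpha_2:2\to 1$, let $R_Q$ be the ideal of the path algebra $kQ$ generated by the arrows, and let $A=kQ/R_Q^2$, with $k$-basis $e_1,e_2,\alpha_1,\alpha_2$ (indices modulo $2$; $e_i\alpha_i=\alpha_i=\alpha_ie_{i+1}$). $A$ is a Frobenius algebra with form $\langle a,b\rangle=\operatorname{tr}(ab)$, where $\operatorname{tr}(e_i)=0$ and $\operatorname{tr}(\alpha_i)=1$. Take the dual bases $(u_1,\dots,u_4)=(e_1,e_2,\alpha_1,\alpha_2)$, $(v_1,\dots,v_4)=(\alpha_2,\alpha_1,e_1,e_2)$, so $\langle v_i,u_j\rangle=\delta_{ij}$, and the Nakayama automorphism $\nu(x)=\sum_i\langle x,v_i\rangle u_i$. Put $\overline A=A/k1$. The complete Hochschild complex $(\mathcal D^\bullet,\widehat d)$ of $A$ has $\mathcal D^r=C^r=\operatorname{Hom}_k(\overline A^{\otimes r},A)$ for $r\ge 0$ and $\mathcal D^{-p-1}=C_p=A\otimes\overline A^{\otimes p}$ for $p\ge 0$.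 Its differential is * for $f\in C^r$: $(\delta f)(a_1,\dots,a_{r+1})=a_1f(a_2,\dots,a_{r+1})+\sum_{j=1}^{r}(-1)^jf(\dots,a_ja_{j+1},\dots)+(-1)^{r+1}f(a_1,\dots,a_r)a_{r+1}$; * in degree $-1$: $\mu:C_0=A\to A=C^0$, $\mu(m)=\sum_i u_imv_i$; * for $p\ge 1$: $\partial:C_p\to C_{p-1}$, $\partial(a_0\otimes\overline a_1\otimes\cdots\otimes\overline a_p)=a_0\nu^{-1}(a_1)\otimes\overline a_2\otimes\cdots\otimes\overline a_p+\sum_{j=1}^{p-1}(-1)^ja_0\otimes\cdots\otimes\overline{a_ja_{j+1}}\otimes\cdots\otimes\overline a_p+(-1)^pa_pa_0\otimes\overline a_1\otimes\cdots\otimes\overline a_{p-1}$. The complete cohomology groups are $\widehat{\mathrm{HH}}^n(A)=H^n(\mathcal D^\bullet)$, $n\in\mathbb Z$. The $\star$-product $\mathcal D^m\times\mathcal D^n\to\mathcal D^{m+n}$ is given, for $f\in C^m$, $g\in C^n$, $x=a_0\otimes\overline a_1\otimes\cdots\otimes\overline a_p\in C_p$, $y=b_0\otimes\overline b_1\otimes\cdots\otimes\overline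 b_q\in C_q$, by * $(f\star g)(a_1,\dots,a_{m+n})=f(a_1,\dots,a_m)\,g(a_{m+1},\dots,a_{m+n})$; * if $p\ge m$: $x\star f=a_0\nu^{-1}(f(a_1,\dots,a_m))\otimes\overline a_{m+1}\otimes\cdots\otimes\overline a_p$ and $f\star x=f(a_{p-m+1},\dots,a_p)a_0\otimes\overline a_1\otimes\cdots\otimes\overline a_{p-m}$; * if $p<m$, with $s=m-p-1$: $(f\star x)(b_1,\dots,b_s)=\sum_if(b_1,\dots,b_s,u_i\nu(a_0),a_1,\dots,a_p)v_i$ and $(x\star f)(b_1,\dots,b_s)=\sum_iu_i\nu(a_0)f(a_1,\dots,a_p,v_i,b_1,\dots,b_s)$; * $x\star y=\sum_iv_ib_0\otimes\overline b_1\otimes\cdots\otimes\overline b_q\otimes\overline{u_i\nu(a_0)}\otimes\overline a_1\otimes\cdots\otimes\overline a_p$. Then $\dim_k\widehat{\mathrm{HH}}^n(A)=1$ for every $n\in\mathbb Z$. The $\star$-product induces well-defined bilinear products $\widehat{\mathrm{HH}}^m(A)\times\widehat{\mathrm{HH}}^n(A)\to\widehat{\mathrm{HH}}^{m+n}(A)$,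 and $\widehat{\mathrm{HH}}^\bullet(A)=\bigoplus_{n\in\mathbb Z}\widehat{\mathrm{HH}}^n(A)$ with this product is isomorphic, as a $\mathbb Z$-graded $k$-algebra with unit the class of $1\in A=C^0$, to $$k[\alpha,\beta,\gamma]/\langle\alpha\gamma-1,\ \beta^2\rangle,\qquad |\alpha|=2,\quad|\beta|=1,\quad|\gamma|=-2 .$$ The isomorphism can be chosen so that $\alpha$ corresponds to the class of the cochain in $C^2$ with $(\alpha_i,\alpha_{i+1})\mapsto e_i$ for $i=1,2$ and zero on all other pairs from the basis $e_1,e_2,\alpha_1,\alpha_2$; $\beta$ corresponds to the class of the cochain in $C^1$ with $\alpha_1\mapsto\alpha_1$ and $\alpha_2,e_1,e_2\mapsto 0$; and $\gamma$ corresponds to the class of the chain $e_1\otimes\overline\alpha_2+e_2\otimes\overline\alpha_1\in C_1=\mathcal D^{-2}$. -/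

import Mathlib

namespace CompleteHochschild

section PathAlgebra

/-- The set of all paths (of all lengths, including the trivial ones) of a quiver. -/
abbrev QuiverPaths (Q : Type*) [Quiver Q] := Σ a b : Q, Quiver.Path a b

/-- The path algebra `kQ`: the `k`-vector space with basis the set of paths of `Q`. -/
def PathAlgebra (k Q : Type*) [Field k] [Quiver Q] := QuiverPaths Q →₀ k

namespace PathAlgebra

variable {k Q : Type*} [Field k] [Quiver Q]

noncomputable instance : AddCommGroup (PathAlgebra k Q) :=
  inferInstanceAs (AddCommGroup (QuiverPaths Q →₀ k))

noncomputable instance : Module k (PathAlgebra k Q) :=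
  inferInstanceAs (Module k (QuiverPaths Q →₀ k))

/-- The basis element of `kQ` given by a path. -/
noncomputable def ofPath (k : Type*) {Q : Type*} [Field k] [Quiver Q] (p : QuiverPaths Q) :
    PathAlgebra k Q :=
  Finsupp.single p 1

/-- The linear map out of `kQ` with prescribed values on paths. -/
noncomputable def linearLift {M : Type*} [AddCommGroup M] [Module k M] (f : QuiverPaths Q → M) :
    PathAlgebra k Q →ₗ[k] M :=
  Finsupp.linearCombination k f

@[simp] theorem linearLift_ofPath {M : Type*} [AddCommGroup M] [Module k M]
    (f : QuiverPaths Q → M) (p : QuiverPaths Q) : linearLift f (ofPath k p) = f p :=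
  (Finsupp.linearCombination_single k 1 p).trans (one_smul k _)

theorem hom_ext {M : Type*} [AddCommGroup M] [Module k M] {f g : PathAlgebra k Q →ₗ[k] M}
    (h : ∀ p, f (ofPath k p) = g (ofPath k p)) : f = g :=
  Finsupp.lhom_ext' fun p => LinearMap.ext_ring (h p)

open Classical in
/-- The product of two paths: first `p`, then `q`, if the end of `p` is the start of `q`,
and zero otherwise. -/
noncomputable def mulPath (k : Type*) {Q : Type*} [Field k] [Quiver Q] (p q : QuiverPaths Q) :
    PathAlgebra k Q :=
  if h : p.2.1 = q.1 then ofPath k ⟨p.1, q.2.1, p.2.2.comp (q.2.2.cast h.symm rfl)⟩ else 0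

/-- The multiplication of `kQ`, extended bilinearly from paths. -/
noncomputable def mulLinear : PathAlgebra k Q →ₗ[k] PathAlgebra k Q →ₗ[k] PathAlgebra k Q :=
  linearLift fun p => linearLift fun q => mulPath k p q

noncomputable instance : Mul (PathAlgebra k Q) := ⟨fun x y => mulLinear x y⟩

theorem mul_def (x y : PathAlgebra k Q) : x * y = mulLinear x y := rfl

theorem ofPath_mul_ofPath (p q : QuiverPaths Q) : ofPath k p * ofPath k q = mulPath k p q := by
  simp [mul_def, mulLinear]

theorem zero_mul_aux (x : PathAlgebra k Q) : 0 * x = 0 := LinearMap.map_zero₂ mulLinear x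

theorem mul_zero_aux (x : PathAlgebra k Q) : x * 0 = 0 := map_zero (mulLinear x)

theorem mulPath_comp {a b c : Q} (p : Quiver.Path a b) (q : Quiver.Path b c) :
    mulPath k ⟨a, b, p⟩ ⟨b, c, q⟩ = ofPath k ⟨a, c, p.comp q⟩ := by
  simp [mulPath]

theorem mulPath_ne {a b c d : Q} (p : Quiver.Path a b) (q : Quiver.Path c d) (h : b ≠ c) :
    mulPath k ⟨a, b, p⟩ ⟨c, d, q⟩ = 0 := by
  simp [mulPath, h]

theorem mulLinear_assoc (x y z : PathAlgebra k Q) :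
    mulLinear (mulLinear x y) z = mulLinear x (mulLinear y z) := by
  have H : mulLinear.compr₂ mulLinear =
      (LinearMap.llcomp k (PathAlgebra k Q) (PathAlgebra k Q) (PathAlgebra k Q)).compl₂ mulLinear
        ∘ₗ (mulLinear (k := k) (Q := Q)) := by
    refine hom_ext fun p => hom_ext fun q => hom_ext fun r => ?_
    obtain ⟨a, b, p⟩ := p
    obtain ⟨c, d, q⟩ := q
    obtain ⟨e, f, r⟩ := r
    simp only [LinearMap.compr₂_apply, LinearMap.comp_apply, LinearMap.compl₂_apply,
      LinearMap.llcomp_apply, ← mul_def, ofPath_mul_ofPath]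
    by_cases h : b = c
    · subst h
      by_cases h' : d = e
      · subst h'
        simp [mulPath_comp, ofPath_mul_ofPath]
      · simp [mulPath_comp, mulPath_ne _ _ h']
        simp [ofPath_mul_ofPath, mulPath_ne _ _ h', mul_zero_aux]
    · by_cases h' : d = e
      · subst h'
        simp [mulPath_comp, mulPath_ne _ _ h]
        simp [ofPath_mul_ofPath, mulPath_ne _ _ h, zero_mul_aux]
      · simp [mulPath_ne _ _ h', mulPath_ne _ _ h, mul_zero_aux, zero_mul_aux]
  exact LinearMap.congr_fun (LinearMap.congr_fun (LinearMap.congr_fun H x) y) z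

/-- The span of the paths of length at least `n`. -/
noncomputable def lengthGE (k Q : Type*) [Field k] [Quiver Q] (n : ℕ) : Submodule k (PathAlgebra k Q) :=
  Submodule.span k {x | ∃ p : QuiverPaths Q, n ≤ p.2.2.length ∧ x = ofPath k p}

theorem mem_lengthGE_zero (x : PathAlgebra k Q) : x ∈ lengthGE k Q 0 := by
  have H : (lengthGE k Q 0).mkQ = 0 := hom_ext fun p => by
    rw [LinearMap.zero_apply, Submodule.mkQ_apply, Submodule.Quotient.mk_eq_zero]
    exact Submodule.subset_span ⟨p, Nat.zero_le _, rfl⟩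
  rw [← Submodule.Quotient.mk_eq_zero, ← Submodule.mkQ_apply, H, LinearMap.zero_apply]

variable [Fintype Q]

/-- The unit of `kQ` is the sum of the trivial paths. -/
noncomputable instance : One (PathAlgebra k Q) := ⟨∑ a : Q, ofPath k ⟨a, a, Quiver.Path.nil⟩⟩

theorem one_def : (1 : PathAlgebra k Q) = ∑ a : Q, ofPath k ⟨a, a, Quiver.Path.nil⟩ := rfl

theorem mulLinear_one_left (x : PathAlgebra k Q) : mulLinear 1 x = x := by
  classical
  have H : mulLinear (1 : PathAlgebra k Q) = LinearMap.id := by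
    refine hom_ext fun p => ?_
    obtain ⟨a, b, p⟩ := p
    rw [one_def, map_sum, LinearMap.sum_apply, Finset.sum_eq_single a]
    · simp [← mul_def, ofPath_mul_ofPath, mulPath_comp]
    · intro c _ hc
      simp [← mul_def, ofPath_mul_ofPath, mulPath_ne _ _ hc]
    · simp
  rw [H, LinearMap.id_apply]

theorem mulLinear_one_right (x : PathAlgebra k Q) : mulLinear x 1 = x := by
  classical
  have H : mulLinear.flip (1 : PathAlgebra k Q) = LinearMap.id := by
    refine hom_ext fun p => ?_
    obtain ⟨a, b, p⟩ := p
    rw [LinearMap.flip_apply, one_def, map_sum, Finset.sum_eq_single b]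
    · simp [← mul_def, ofPath_mul_ofPath, mulPath_comp]
    · intro c _ hc
      simp [← mul_def, ofPath_mul_ofPath, mulPath_ne _ _ hc.symm]
    · simp
  exact LinearMap.congr_fun H x

noncomputable instance : Ring (PathAlgebra k Q) :=
  { (inferInstance : AddCommGroup (PathAlgebra k Q)) with
    mul := (· * ·)
    one := 1
    left_distrib := fun x y z => map_add (mulLinear x) y z
    right_distrib := fun x y z => LinearMap.map_add₂ mulLinear x y z
    zero_mul := fun x => LinearMap.map_zero₂ mulLinear x
    mul_zero := fun x => map_zero (mulLinear x)
    mul_assoc := mulLinear_assoc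
    one_mul := mulLinear_one_left
    mul_one := mulLinear_one_right }

noncomputable instance : Algebra k (PathAlgebra k Q) :=
  Algebra.ofModule (fun r x y => LinearMap.map_smul₂ mulLinear r x y)
    (fun r x y => map_smul (mulLinear x) r y)

/-- The arrow ideal `R_Q` of `kQ`: the two-sided ideal generated by all arrows. -/
noncomputable def arrowIdeal (k Q : Type*) [Field k] [Quiver Q] [Fintype Q] :
    Ideal (PathAlgebra k Q) :=
  TwoSidedIdeal.asIdeal
    (TwoSidedIdeal.span {x | ∃ (a b : Q) (f : a ⟶ b), x = ofPath k ⟨a, b, f.toPath⟩})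

instance : (arrowIdeal k Q).IsTwoSided := by
  unfold arrowIdeal; infer_instance

theorem mul_mem_lengthGE {m n : ℕ} {x y : PathAlgebra k Q} (hx : x ∈ lengthGE k Q m)
    (hy : y ∈ lengthGE k Q n) : x * y ∈ lengthGE k Q (m + n) := by
  induction hx using Submodule.span_induction with
  | zero => simp
  | add a b _ _ ha hb => rw [add_mul]; exact add_mem ha hb
  | smul c a _ ha => rw [smul_mul_assoc]; exact Submodule.smul_mem _ _ ha
  | mem a ha =>
    induction hy using Submodule.span_induction with
    | zero => simp
    | add a b _ _ ha hb => rw [mul_add]; exact add_mem ha hb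
    | smul c a _ ha => rw [mul_smul_comm]; exact Submodule.smul_mem _ _ ha
    | mem b hb =>
      obtain ⟨⟨a, b, p⟩, hp, rfl⟩ := ha
      obtain ⟨⟨c, d, q⟩, hq, rfl⟩ := hb
      rw [ofPath_mul_ofPath]
      by_cases h : b = c
      · subst h
        rw [mulPath_comp]
        exact Submodule.subset_span ⟨_, by simpa using add_le_add hp hq, rfl⟩
      · rw [mulPath_ne _ _ h]
        exact zero_mem _

theorem mem_lengthGE_one {x : PathAlgebra k Q} (hx : x ∈ arrowIdeal k Q) :
    x ∈ lengthGE k Q 1 := by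
  let I : TwoSidedIdeal (PathAlgebra k Q) := TwoSidedIdeal.mk' (lengthGE k Q 1)
    (zero_mem _) (fun h h' => add_mem h h') (fun h => neg_mem h)
    (fun {x y} h => by simpa using mul_mem_lengthGE (mem_lengthGE_zero x) h)
    (fun {x y} h => by simpa using mul_mem_lengthGE h (mem_lengthGE_zero y))
  have hI : TwoSidedIdeal.span {x | ∃ (a b : Q) (f : a ⟶ b), x = ofPath k ⟨a, b, f.toPath⟩} ≤ I := by
    rw [TwoSidedIdeal.span_le]
    rintro _ ⟨a, b, f, rfl⟩
    simp only [I, SetLike.mem_coe, TwoSidedIdeal.mem_mk']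
    exact Submodule.subset_span ⟨_, le_rfl, rfl⟩
  have := hI (show x ∈ TwoSidedIdeal.span _ from hx)
  simpa [I, TwoSidedIdeal.mem_mk'] using this

theorem mem_lengthGE_two {x : PathAlgebra k Q} (hx : x ∈ arrowIdeal k Q ^ 2) :
    x ∈ lengthGE k Q 2 := by
  rw [Submodule.pow_succ, Submodule.pow_one] at hx
  induction hx using Submodule.mul_induction_on' with
  | mem_mul_mem a ha b hb =>
    have h : a * b ∈ lengthGE k Q (1 + 1) :=
      mul_mem_lengthGE (mem_lengthGE_one ha) (mem_lengthGE_one hb)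
    exact h
  | add a _ b _ ha hb => exact add_mem ha hb

theorem ofPath_mem_of_two_le (p : QuiverPaths Q) (hp : 2 ≤ p.2.2.length) :
    ofPath k p ∈ arrowIdeal k Q ^ 2 := by
  have arrow : ∀ {a b : Q} (f : a ⟶ b), ofPath k ⟨a, b, f.toPath⟩ ∈ arrowIdeal k Q :=
    fun f => TwoSidedIdeal.subset_span ⟨_, _, f, rfl⟩
  obtain ⟨a, b, p⟩ := p
  cases p with
  | nil => simp at hp
  | cons p f =>
    cases p with
    | nil => simp at hp
    | cons p g =>
      have : ofPath k ⟨a, b, (p.cons g).cons f⟩ =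
          ofPath k ⟨_, _, p⟩ * (ofPath k ⟨_, _, g.toPath⟩ * ofPath k ⟨_, _, f.toPath⟩) := by
        rw [ofPath_mul_ofPath, mulPath_comp, ofPath_mul_ofPath, mulPath_comp]
        rfl
      rw [this, Submodule.pow_succ, Submodule.pow_one]
      exact Ideal.mul_mem_left _ _ (Ideal.mul_mem_mul (arrow g) (arrow f))

end PathAlgebra

end PathAlgebra

section Frobenius

/-- Data exhibiting `A` as a Frobenius algebra over `k`: an associative bilinear form together with
dual bases `u`, `v`, i.e. `⟨v i, u j⟩ = δ i j` (so that the form is non-degenerate). -/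
structure FrobeniusData (k A ι : Type*) [Field k] [Ring A] [Algebra k A] [Fintype ι]
    [DecidableEq ι] where
  /-- the bilinear form -/
  form : A →ₗ[k] A →ₗ[k] k
  assoc : ∀ a b c, form (a * b) c = form a (b * c)
  /-- the first of the dual bases -/
  u : Module.Basis ι k A
  /-- the second of the dual bases -/
  v : Module.Basis ι k A
  dual : ∀ i j, form (v i) (u j) = if i = j then 1 else 0

namespace FrobeniusData

variable {k A ι : Type*} [Field k] [Ring A] [Algebra k A] [Fintype ι] [DecidableEq ι]
  (F : FrobeniusData k A ι)

/-- The Nakayama automorphism `ν(x) = ∑ i, ⟨x, v i⟩ u i`. -/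
noncomputable def nakayama : A →ₗ[k] A :=
  ∑ i, (F.form.flip (F.v i)).smulRight (F.u i)

/-- The inverse of the Nakayama automorphism, `ν⁻¹(x) = ∑ i, ⟨u i, x⟩ v i`. -/
noncomputable def nakayamaInv : A →ₗ[k] A :=
  ∑ i, (F.form (F.u i)).smulRight (F.v i)

theorem nakayama_apply (x : A) : F.nakayama x = ∑ i, F.form x (F.v i) • F.u i := by
  simp [nakayama]

theorem nakayamaInv_apply (x : A) : F.nakayamaInv x = ∑ i, F.form (F.u i) x • F.v i := by
  simp [nakayamaInv]

theorem sum_form_u_smul_v (x : A) : ∑ i, F.form x (F.u i) • F.v i = x := by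
  have H : ∑ i, (F.form.flip (F.u i)).smulRight (F.v i) = LinearMap.id := by
    refine F.v.ext fun j => ?_
    simp [F.dual]
  simpa using LinearMap.congr_fun H x

theorem form_one_comm (x : A) : F.form x 1 = F.form 1 x := by
  have := F.assoc 1 x 1
  simpa using this

theorem nakayamaInv_one : F.nakayamaInv 1 = 1 := by
  rw [nakayamaInv_apply]
  simp only [form_one_comm]
  exact F.sum_form_u_smul_v 1

end FrobeniusData

end Frobenius

section TwoCycle

/-- The vertices of the two-cycle quiver `1 ⇄ 2`; the vertex `1` is `0 : ZMod 2`
and the vertex `2` is `1 : ZMod 2`. -/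
def TwoCycle := ZMod 2

namespace TwoCycle

instance : DecidableEq TwoCycle := inferInstanceAs (DecidableEq (ZMod 2))
instance : Fintype TwoCycle := inferInstanceAs (Fintype (ZMod 2))
instance : CommRing TwoCycle := inferInstanceAs (CommRing (ZMod 2))

/-- There is exactly one arrow from each vertex `i` to `i + 1`, and no other arrow. -/
instance : Quiver TwoCycle := ⟨fun a b => PLift (b = a + 1)⟩

/-- The arrow `α i : i ⟶ i + 1`. -/
def arrow (i : TwoCycle) : i ⟶ i + 1 := PLift.up rfl

theorem exhaust (i : TwoCycle) : i = 0 ∨ i = 1 := by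
  revert i; decide

end TwoCycle

/-- The algebra `A = kQ / R_Q ^ 2` where `Q` is the two-cycle. -/
abbrev TwoCycleAlgebra (k : Type*) [Field k] :=
  PathAlgebra k TwoCycle ⧸ (PathAlgebra.arrowIdeal k TwoCycle ^ 2)

namespace TwoCycleAlgebra

variable (k : Type*) [Field k]

/-- The class in `A` of a path. -/
noncomputable def ofPath (p : QuiverPaths TwoCycle) : TwoCycleAlgebra k :=
  Ideal.Quotient.mk _ (PathAlgebra.ofPath k p)

/-- The primitive idempotent `e i` of `A`. -/
noncomputable def e (i : TwoCycle) : TwoCycleAlgebra k := ofPath k ⟨i, i, Quiver.Path.nil⟩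

/-- The element `α i` of `A` given by the arrow `i ⟶ i + 1`. -/
noncomputable def α (i : TwoCycle) : TwoCycleAlgebra k := ofPath k ⟨i, i + 1, (TwoCycle.arrow i).toPath⟩

theorem ofPath_mul_comp {a b c : TwoCycle} (p : Quiver.Path a b) (q : Quiver.Path b c) :
    ofPath k ⟨a, b, p⟩ * ofPath k ⟨b, c, q⟩ = ofPath k ⟨a, c, p.comp q⟩ := by
  rw [ofPath, ofPath, ← map_mul, PathAlgebra.ofPath_mul_ofPath, PathAlgebra.mulPath_comp]; rfl

theorem ofPath_mul_ne {a b c d : TwoCycle} (p : Quiver.Path a b) (q : Quiver.Path c d)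
    (h : b ≠ c) : ofPath k ⟨a, b, p⟩ * ofPath k ⟨c, d, q⟩ = 0 := by
  rw [ofPath, ofPath, ← map_mul, PathAlgebra.ofPath_mul_ofPath, PathAlgebra.mulPath_ne _ _ h,
    map_zero]

theorem ofPath_eq_zero (p : QuiverPaths TwoCycle) (hp : 2 ≤ p.2.2.length) : ofPath k p = 0 :=
  Ideal.Quotient.eq_zero_iff_mem.2 (PathAlgebra.ofPath_mem_of_two_le p hp)

theorem e_mul_e (i j : TwoCycle) : e k i * e k j = if i = j then e k i else 0 := by
  split_ifs with h
  · subst h; exact ofPath_mul_comp k _ _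
  · exact ofPath_mul_ne k _ _ h

theorem e_mul_α (i j : TwoCycle) : e k i * α k j = if i = j then α k j else 0 := by
  split_ifs with h
  · subst h; exact (ofPath_mul_comp k _ _).trans (by simp; rfl)
  · exact ofPath_mul_ne k _ _ h

theorem α_mul_e (i j : TwoCycle) : α k i * e k j = if i + 1 = j then α k i else 0 := by
  split_ifs with h
  · subst h; exact (ofPath_mul_comp k _ _).trans (by simp; rfl)
  · exact ofPath_mul_ne k _ _ h

theorem α_mul_α (i j : TwoCycle) : α k i * α k j = 0 := by
  by_cases h : i + 1 = j
  · subst h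
    refine (ofPath_mul_comp k _ _).trans (ofPath_eq_zero k _ ?_)
    simp
  · exact ofPath_mul_ne k _ _ h

theorem one_eq : (1 : TwoCycleAlgebra k) = ∑ i, e k i := by
  rw [← map_one (Ideal.Quotient.mk _), PathAlgebra.one_def, map_sum]; rfl

/-- The coordinates of an element of `kQ` on the paths of length zero and one. -/
noncomputable def preCoord : PathAlgebra k TwoCycle →ₗ[k] (TwoCycle ⊕ TwoCycle → k) :=
  PathAlgebra.linearLift fun p =>
    if p.2.2.length = 0 then Pi.single (Sum.inl p.1) 1
    else if p.2.2.length = 1 then Pi.single (Sum.inr p.1) 1 else 0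

theorem preCoord_eq_zero {x : PathAlgebra k TwoCycle}
    (hx : x ∈ PathAlgebra.arrowIdeal k TwoCycle ^ 2) : preCoord k x = 0 := by
  have hx' := PathAlgebra.mem_lengthGE_two hx
  have : PathAlgebra.lengthGE k TwoCycle 2 ≤ LinearMap.ker (preCoord k) := by
    rw [PathAlgebra.lengthGE, Submodule.span_le]
    rintro _ ⟨p, hp, rfl⟩
    have h0 : p.2.2.length ≠ 0 := by omega
    have h1 : p.2.2.length ≠ 1 := by omega
    simp only [SetLike.mem_coe, LinearMap.mem_ker, preCoord, PathAlgebra.linearLift_ofPath,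
      if_neg h0, if_neg h1]
  exact this hx'

/-- The coordinates of an element of `A` on the `e i` and the `α i`. -/
noncomputable def coord : TwoCycleAlgebra k →ₗ[k] (TwoCycle ⊕ TwoCycle → k) :=
  (((PathAlgebra.arrowIdeal k TwoCycle ^ 2).restrictScalars k).liftQ (preCoord k)
    fun _ hx => preCoord_eq_zero k ((Submodule.restrictScalars_mem k _ _).1 hx)) ∘ₗ
    (Submodule.Quotient.restrictScalarsEquiv k
      (PathAlgebra.arrowIdeal k TwoCycle ^ 2)).symm.toLinearMap

theorem coord_ofPath (p : QuiverPaths TwoCycle) :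
    coord k (ofPath k p) = preCoord k (PathAlgebra.ofPath k p) := rfl

theorem coord_e (i : TwoCycle) : coord k (e k i) = Pi.single (Sum.inl i) 1 := by
  rw [e, coord_ofPath, preCoord, PathAlgebra.linearLift_ofPath]; simp

theorem coord_α (i : TwoCycle) : coord k (α k i) = Pi.single (Sum.inr i) 1 := by
  rw [α, coord_ofPath, preCoord, PathAlgebra.linearLift_ofPath]; simp

theorem linearIndependent_of_coord {b : TwoCycle ⊕ TwoCycle → TwoCycleAlgebra k}
    (σ : TwoCycle ⊕ TwoCycle ≃ TwoCycle ⊕ TwoCycle)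
    (h : ∀ s, coord k (b s) = Pi.single (σ s) 1) : LinearIndependent k b := by
  refine LinearIndependent.of_comp (coord k) ?_
  have : coord k ∘ b = (Pi.basisFun k (TwoCycle ⊕ TwoCycle)) ∘ σ := by
    funext s
    simp [h]
  rw [this]
  exact (Pi.basisFun k _).linearIndependent.comp _ σ.injective

theorem span_top : (⊤ : Submodule k (TwoCycleAlgebra k)) ≤
    Submodule.span k (Set.range (e k) ∪ Set.range (α k)) := by
  intro x _
  obtain ⟨y, rfl⟩ := Ideal.Quotient.mk_surjective x
  set S := Submodule.span k (Set.range (e k) ∪ Set.range (α k))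
  have H : S.mkQ ∘ₗ (Ideal.Quotient.mkₐ k (PathAlgebra.arrowIdeal k TwoCycle ^ 2)).toLinearMap
      = 0 := PathAlgebra.hom_ext fun p => by
    rw [LinearMap.zero_apply, LinearMap.comp_apply, Submodule.mkQ_apply,
      Submodule.Quotient.mk_eq_zero]
    change ofPath k p ∈ S
    obtain ⟨a, b, p⟩ := p
    cases p with
    | nil => exact Submodule.subset_span (Or.inl ⟨a, rfl⟩)
    | cons p f =>
      cases p with
      | nil =>
        obtain ⟨rfl⟩ := f
        exact Submodule.subset_span (Or.inr ⟨a, rfl⟩)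
      | cons p g =>
        rw [ofPath_eq_zero k _ (by simp)]
        exact zero_mem _
  have := LinearMap.congr_fun H y
  rwa [LinearMap.zero_apply, LinearMap.comp_apply, Submodule.mkQ_apply,
    Submodule.Quotient.mk_eq_zero] at this

/-- The basis `(e₁, e₂, α₁, α₂)` of `A`. -/
noncomputable def basisU : Module.Basis (TwoCycle ⊕ TwoCycle) k (TwoCycleAlgebra k) :=
  Module.Basis.mk (v := Sum.elim (e k) (α k))
    (linearIndependent_of_coord k (Equiv.refl _) (by rintro (i | i) <;> simp [coord_e, coord_α]))
    (by rw [Set.Sum.elim_range]; exact span_top k)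

/-- The basis `(α₂, α₁, e₁, e₂)` of `A`. -/
noncomputable def basisV : Module.Basis (TwoCycle ⊕ TwoCycle) k (TwoCycleAlgebra k) :=
  Module.Basis.mk (v := Sum.elim (fun i => α k (i + 1)) (e k))
    (linearIndependent_of_coord k ((Equiv.sumComm _ _).trans
      (Equiv.sumCongr (Equiv.refl _) (Equiv.addRight 1)))
      (by rintro (i | i) <;> simp [coord_e, coord_α]))
    (by
      rw [Set.Sum.elim_range, Set.union_comm]
      have : Set.range (fun i => α k (i + 1)) = Set.range (α k) :=
        (Equiv.addRight (1 : TwoCycle)).surjective.range_comp (α k)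
      rw [this]
      exact span_top k)

/-- The linear form on `A` with `tr (α i) = 1` and `tr (e i) = 0`. -/
noncomputable def tr : TwoCycleAlgebra k →ₗ[k] k :=
  (∑ i : TwoCycle, LinearMap.proj (Sum.inr i)) ∘ₗ coord k

theorem tr_e (i : TwoCycle) : tr k (e k i) = 0 := by simp [tr, coord_e]

theorem tr_α (i : TwoCycle) : tr k (α k i) = 1 := by
  simp [tr, coord_α, Pi.single_apply]

theorem tr_dual (s t : TwoCycle ⊕ TwoCycle) :
    tr k (basisV k s * basisU k t) = if s = t then 1 else 0 := by
  rcases s with i | i <;> rcases t with j | j <;>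
    simp only [basisU, basisV, Module.Basis.mk_apply, Sum.elim_inl, Sum.elim_inr, e_mul_e, e_mul_α,
      α_mul_e, α_mul_α, map_zero, reduceCtorEq, if_false, Sum.inl.injEq, Sum.inr.injEq]
  · have : i + 1 + 1 = i := by revert i; decide
    rw [this]
    split_ifs <;> simp [tr_α]
  · split_ifs <;> simp [tr_e]
  · split_ifs <;> simp [tr_α]

/-- The Frobenius algebra structure on `A` given by `⟨a, b⟩ = tr (a b)`, with the dual bases
`(e₁, e₂, α₁, α₂)` and `(α₂, α₁, e₁, e₂)`. -/
noncomputable def frobenius : FrobeniusData k (TwoCycleAlgebra k) (TwoCycle ⊕ TwoCycle) where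
  form := (LinearMap.mul k (TwoCycleAlgebra k)).compr₂ (tr k)
  assoc a b c := by simp [mul_assoc]
  u := basisU k
  v := basisV k
  dual := tr_dual k

end TwoCycleAlgebra

end TwoCycle

section Multilinear

/-- A map of tuples which is, in each variable, a linear change of a single entry. -/
def TupleLinear (k : Type*) {A : Type*} [Field k] [Ring A] [Algebra k A] {n N : ℕ}
    (T : (Fin n → A) → (Fin N → A)) : Prop :=
  ∀ a i, ∃ (j : Fin N) (L : A →ₗ[k] A), ∀ x, T (Function.update a i x) = Function.update (T a) j (L x)

variable {k A : Type*} [Field k] [Ring A] [Algebra k A] {n N : ℕ}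

/-- A map which is linear in each variable, as a multilinear map. -/
def mkMultilinear {M : Type*} [AddCommGroup M] [Module k M] (f : (Fin n → A) → M)
    (hadd : ∀ a i x y, f (Function.update a i (x + y)) =
      f (Function.update a i x) + f (Function.update a i y))
    (hsmul : ∀ a i (c : k) x, f (Function.update a i (c • x)) = c • f (Function.update a i x)) :
    MultilinearMap k (fun _ : Fin n => A) M where
  toFun := f
  map_update_add' := by
    intro inst a i x y
    obtain rfl : inst = instDecidableEqFin n := Subsingleton.elim _ _
    exact hadd a i x y
  map_update_smul' := by
    intro inst a i c x
    obtain rfl : inst = instDecidableEqFin n := Subsingleton.elim _ _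
    exact hsmul a i c x

@[simp] theorem mkMultilinear_apply {M : Type*} [AddCommGroup M] [Module k M]
    (f : (Fin n → A) → M) (h h') (a : Fin n → A) : mkMultilinear (k := k) f h h' a = f a := rfl

/-- The multilinear map `a ↦ f (T a)`. -/
def pull {M : Type*} [AddCommGroup M] [Module k M]
    (f : MultilinearMap k (fun _ : Fin N => A) M) (T : (Fin n → A) → (Fin N → A))
    (hT : TupleLinear k T) : MultilinearMap k (fun _ : Fin n => A) M :=
  mkMultilinear (fun a => f (T a))
    (fun a i x y => by
      obtain ⟨j, L, h⟩ := hT a i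
      simp only [h, map_add, MultilinearMap.map_update_add])
    (fun a i c x => by
      obtain ⟨j, L, h⟩ := hT a i
      simp only [h, map_smul, MultilinearMap.map_update_smul])

@[simp] theorem pull_apply {M : Type*} [AddCommGroup M] [Module k M]
    (f : MultilinearMap k (fun _ : Fin N => A) M) (T : (Fin n → A) → (Fin N → A))
    (hT : TupleLinear k T) (a : Fin n → A) : pull f T hT a = f (T a) := rfl

theorem TupleLinear.of_entries (T : (Fin n → A) → (Fin N → A)) (τ : Fin n → Fin N)
    (hτ : Function.Injective τ) (L : Fin n → A →ₗ[k] A) (h : ∀ a i, T a (τ i) = L i (a i))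
    (h' : ∀ a b j, (∀ i, τ i ≠ j) → T a j = T b j) : TupleLinear k T := by
  intro a i
  refine ⟨τ i, L i, fun x => funext fun j => ?_⟩
  by_cases hj : ∃ i', τ i' = j
  · obtain ⟨i', rfl⟩ := hj
    rw [h]
    by_cases hi : i' = i
    · subst hi; simp
    · rw [Function.update_of_ne hi, Function.update_of_ne (fun e => hi (hτ e)), h]
  · have hj' : ∀ i', τ i' ≠ j := fun i' e => hj ⟨i', e⟩
    rw [Function.update_of_ne (fun e => hj' i e.symm)]
    exact h' _ _ _ hj'

/-- Contracting two adjacent entries by a bilinear operation. -/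
theorem TupleLinear.contract (op : A →ₗ[k] A →ₗ[k] A) (j : Fin n) :
    TupleLinear k (Fin.contractNth (n := n) j.castSucc (fun x y => op x y)) := by
  intro a i
  by_cases h : (i : ℕ) < j
  · refine ⟨⟨i, by omega⟩, LinearMap.id, fun x => funext fun l => ?_⟩
    simp only [Fin.contractNth, Function.update_apply, Fin.ext_iff, Fin.val_castSucc, Fin.val_succ,
      LinearMap.id_apply]
    split_ifs <;> first | rfl | omega
  by_cases h1 : (i : ℕ) = j
  · refine ⟨j, op.flip (a j.succ), fun x => funext fun l => ?_⟩
    simp only [Fin.contractNth, Function.update_apply, Fin.ext_iff, Fin.val_castSucc, Fin.val_succ,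
      LinearMap.flip_apply]
    split_ifs <;> first | rfl | omega | skip
    obtain rfl : l = j := Fin.ext (by omega)
    rfl
  by_cases h2 : (i : ℕ) = j + 1
  · refine ⟨j, op (a j.castSucc), fun x => funext fun l => ?_⟩
    simp only [Fin.contractNth, Function.update_apply, Fin.ext_iff, Fin.val_castSucc, Fin.val_succ]
    split_ifs <;> first | rfl | omega | skip
    obtain rfl : l = j := Fin.ext (by omega)
    rfl
  · refine ⟨⟨i - 1, by omega⟩, LinearMap.id, fun x => funext fun l => ?_⟩
    simp only [Fin.contractNth, Function.update_apply, Fin.ext_iff, Fin.val_castSucc, Fin.val_succ,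
      LinearMap.id_apply]
    split_ifs <;> first | rfl | omega

theorem TupleLinear.contractMul (j : Fin n) :
    TupleLinear k (Fin.contractNth (α := A) (n := n) j.castSucc (· * ·)) :=
  TupleLinear.contract (LinearMap.mul k A) j

theorem contractNth_eq_succAbove {B : Type*} (a : Fin (n + 1) → B) (j : Fin (n + 1)) (op : B → B → B)
    (h : ∀ l : Fin n, l.castSucc = j → op (a l.castSucc) (a l.succ) = a l.succ) :
    Fin.contractNth j op a = a ∘ j.succAbove := by
  funext l
  simp only [Fin.contractNth, Function.comp_apply, Fin.succAbove, Fin.lt_def, Fin.val_castSucc]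
  split_ifs with h1 h2
  · rfl
  · exact h l (Fin.ext h2)
  · rfl

theorem contractNth_eq_succAbove_succ {B : Type*} (a : Fin (n + 1) → B) (j : Fin n) (op : B → B → B)
    (h : op (a j.castSucc) (a j.succ) = a j.castSucc) :
    Fin.contractNth j.castSucc op a = a ∘ j.succ.succAbove := by
  funext l
  simp only [Fin.contractNth, Function.comp_apply, Fin.succAbove, Fin.lt_def, Fin.val_castSucc,
    Fin.val_succ]
  by_cases h1 : (l : ℕ) < j
  · rw [if_pos h1, if_pos (by omega)]
  · by_cases h2 : (l : ℕ) = j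
    · obtain rfl : l = j := Fin.ext h2
      simp [h]
    · rw [if_neg h1, if_neg h2, if_neg (by omega)]

theorem contractNth_entry {B : Type*} (a : Fin (n + 1) → B) (j : Fin (n + 1)) (op : B → B → B)
    (i : Fin (n + 1)) (h : i ≠ j) (h' : (i : ℕ) ≠ j + 1) :
    ∃ l : Fin n, ((i : ℕ) ≠ 0 → (l : ℕ) ≠ 0) ∧ Fin.contractNth j op a l = a i := by
  have h0 : (i : ℕ) ≠ j := fun e => h (Fin.ext e)
  by_cases h1 : (i : ℕ) < j
  · refine ⟨⟨i, by omega⟩, fun h => h, ?_⟩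
    rw [Fin.contractNth_apply_of_lt _ _ _ _ h1]; rfl
  · refine ⟨⟨i - 1, by omega⟩, fun h => by simp only; omega, ?_⟩
    rw [Fin.contractNth_apply_of_gt _ _ _ _ (by simp only; omega)]
    congr 1
    exact Fin.ext (by simp; omega)

theorem alternating_sum_eq_zero {M : Type*} [AddCommGroup M] [Module k M] (g : Fin (n + 1) → M)
    (i : Fin n) (h : g i.castSucc = g i.succ)
    (h0 : ∀ l, l ≠ i.castSucc → l ≠ i.succ → g l = 0) :
    ∑ l : Fin (n + 1), (-1 : k) ^ (l : ℕ) • g l = 0 := by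
  rw [Finset.sum_eq_add i.castSucc i.succ (by simp [Fin.ext_iff])
    (fun l _ hl => by rw [h0 l hl.1 hl.2, smul_zero]) (by simp) (by simp), h]
  simp [pow_succ]

end Multilinear

section Complex

universe u

/-- The normalized Hochschild cochains `C^r(A, A) = Hom_k(Ā^{⊗ r}, A)` with `Ā = A / k 1`:
the `r`-multilinear maps `A^r → A` which vanish as soon as one argument is `1`. -/
def cochainSubmodule (k A : Type*) [Field k] [Ring A] [Algebra k A] (r : ℕ) :
    Submodule k (MultilinearMap k (fun _ : Fin r => A) A) where
  carrier := {f | ∀ a i, a i = 1 → f a = 0}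
  zero_mem' := fun _ _ _ => rfl
  add_mem' := fun {f g} hf hg a i h => by simp [hf a i h, hg a i h]
  smul_mem' := fun c f hf a i h => by simp [hf a i h]

/-- The space `C^r(A, A)` of normalized Hochschild cochains. -/
abbrev Cochain (k A : Type*) [Field k] [Ring A] [Algebra k A] (r : ℕ) : Type _ :=
  cochainSubmodule k A r

/-- The span of the tensors `a₀ ⊗ a₁ ⊗ ⋯ ⊗ a_p` such that `a_i = 1` for some `i ≥ 1`. -/
def degenerate (k A : Type*) [Field k] [Ring A] [Algebra k A] (p : ℕ) :
    Submodule k (PiTensorProduct k fun _ : Fin (p + 1) => A) :=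
  Submodule.span k {x | ∃ (a : Fin (p + 1) → A) (i : Fin (p + 1)), i ≠ 0 ∧ a i = 1 ∧
    x = PiTensorProduct.tprod k a}

/-- The underlying space `A ⊗ Ā^{⊗ p}` of the normalized Hochschild chains `C_p(A, A_{ν⁻¹})`,
as a quotient of `A^{⊗ (p + 1)}`. -/
abbrev Chain (k A : Type*) [Field k] [Ring A] [Algebra k A] (p : ℕ) : Type _ :=
  (PiTensorProduct k fun _ : Fin (p + 1) => A) ⧸ degenerate k A p

variable {k A : Type*} [Field k] [Ring A] [Algebra k A]

/-- The chain `a₀ ⊗ ā₁ ⊗ ⋯ ⊗ ā_p`, as a multilinear map in `a`. -/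
def chainMk (k A : Type*) [Field k] [Ring A] [Algebra k A] (p : ℕ) :
    MultilinearMap k (fun _ : Fin (p + 1) => A) (Chain k A p) :=
  (degenerate k A p).mkQ.compMultilinearMap (PiTensorProduct.tprod k)

theorem chainMk_eq_zero {p : ℕ} (a : Fin (p + 1) → A) (i : Fin (p + 1)) (hi : i ≠ 0)
    (ha : a i = 1) : chainMk k A p a = 0 := by
  rw [chainMk, LinearMap.compMultilinearMap_apply, Submodule.mkQ_apply,
    Submodule.Quotient.mk_eq_zero]
  exact Submodule.subset_span ⟨a, i, hi, ha, rfl⟩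

/-- The linear map on chains with prescribed values on the `a₀ ⊗ ā₁ ⊗ ⋯ ⊗ ā_p`. -/
def chainLift {M : Type*} [AddCommGroup M] [Module k M] {p : ℕ}
    (f : MultilinearMap k (fun _ : Fin (p + 1) => A) M)
    (hf : ∀ a (i : Fin (p + 1)), i ≠ 0 → a i = 1 → f a = 0) : Chain k A p →ₗ[k] M :=
  (degenerate k A p).liftQ (PiTensorProduct.lift f) (by
    rw [degenerate, Submodule.span_le]
    rintro _ ⟨a, i, hi, ha, rfl⟩
    simpa using hf a i hi ha)

@[simp] theorem chainLift_chainMk {M : Type*} [AddCommGroup M] [Module k M] {p : ℕ}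
    (f : MultilinearMap k (fun _ : Fin (p + 1) => A) M) (hf) (a : Fin (p + 1) → A) :
    chainLift f hf (chainMk k A p a) = f a := by
  simp [chainLift, chainMk]

theorem chain_hom_ext {M : Type*} [AddCommGroup M] [Module k M] {p : ℕ}
    {f g : Chain k A p →ₗ[k] M} (h : ∀ a, f (chainMk k A p a) = g (chainMk k A p a)) : f = g := by
  refine Submodule.linearMap_qext _ (PiTensorProduct.ext (MultilinearMap.ext fun a => ?_))
  exact h a

/-- The multilinear map `(a₁, …, a_{r+1}) ↦ a₁ f(a₂, …, a_{r+1})`. -/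
def leftMul {r : ℕ} (f : MultilinearMap k (fun _ : Fin r => A) A) :
    MultilinearMap k (fun _ : Fin (r + 1) => A) A :=
  mkMultilinear (fun a => a 0 * f (Fin.tail a))
    (fun a i x y => by
      revert a
      refine Fin.cases (fun a => ?_) (fun i a => ?_) i
      · simp [add_mul]
      · simp [mul_add, Function.update_of_ne (Fin.succ_ne_zero i).symm])
    (fun a i c x => by
      revert a
      refine Fin.cases (fun a => ?_) (fun i a => ?_) i
      · simp
      · simp [Function.update_of_ne (Fin.succ_ne_zero i).symm])

/-- The multilinear map `(a₁, …, a_{r+1}) ↦ f(a₁, …, a_r) a_{r+1}`. -/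
def rightMul {r : ℕ} (f : MultilinearMap k (fun _ : Fin r => A) A) :
    MultilinearMap k (fun _ : Fin (r + 1) => A) A :=
  mkMultilinear (fun a => f (Fin.init a) * a (Fin.last r))
    (fun a i x y => by
      revert a
      refine Fin.lastCases (fun a => ?_) (fun i a => ?_) i
      · simp [mul_add]
      · simp [add_mul, Function.update_of_ne (Fin.castSucc_ne_last i).symm])
    (fun a i c x => by
      revert a
      refine Fin.lastCases (fun a => ?_) (fun i a => ?_) i
      · simp
      · simp [Function.update_of_ne (Fin.castSucc_ne_last i).symm])

/-- The Hochschild coboundary,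
`δ f (a₁, …, a_{r+1}) = a₁ f(a₂, …, a_{r+1}) + ∑ j, (-1)^j f(a₁, …, a_j a_{j+1}, …, a_{r+1})
  + (-1)^{r+1} f(a₁, …, a_r) a_{r+1}`. -/
def deltaMultilinear {r : ℕ} (f : MultilinearMap k (fun _ : Fin r => A) A) :
    MultilinearMap k (fun _ : Fin (r + 1) => A) A :=
  leftMul f
    + ∑ j : Fin r, (-1 : k) ^ ((j : ℕ) + 1) • pull f (Fin.contractNth j.castSucc (· * ·))
        (TupleLinear.contractMul j)
    + (-1 : k) ^ (r + 1) • rightMul f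

theorem deltaMultilinear_mem {r : ℕ} (f : Cochain k A r) :
    deltaMultilinear f.1 ∈ cochainSubmodule k A (r + 1) := by
  intro a i hi
  let g : Fin (r + 2) → A := Fin.cons (a 0 * f.1 (Fin.tail a))
    (Fin.snoc (fun j : Fin r => f.1 (Fin.contractNth j.castSucc (· * ·) a))
      (f.1 (Fin.init a) * a (Fin.last r)))
  have hg : deltaMultilinear f.1 a = ∑ l : Fin (r + 2), (-1 : k) ^ (l : ℕ) • g l := by
    rw [Fin.sum_univ_succ, Fin.sum_univ_castSucc]
    simp [g, deltaMultilinear, leftMul, rightMul, add_assoc]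
  have last : Fin.contractNth (Fin.last r) (· * ·) a = Fin.init a := by
    funext l
    rw [Fin.contractNth_apply_of_lt _ _ _ _ (by simp)]; rfl
  -- the terms which do not involve a multiplication by the unit
  have hv : ∀ j : Fin (r + 1), i ≠ j → (i : ℕ) ≠ j + 1 →
      f.1 (Fin.contractNth j (· * ·) a) = 0 := fun j h h' => by
    obtain ⟨l, -, hl⟩ := contractNth_entry a j (· * ·) i h h'
    exact f.2 _ l (hl.trans hi)
  have gs : ∀ j : Fin (r + 1), g j.succ =
      f.1 (Fin.contractNth j (· * ·) a) * (if j = Fin.last r then a (Fin.last r) else 1) := by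
    intro j
    refine Fin.lastCases ?_ (fun j => ?_) j
    · simp [g, last]
    · simp [g, Fin.castSucc_ne_last]
  have key : f.1 (a ∘ i.succAbove) = g i.succ := by
    rw [gs, contractNth_eq_succAbove a i (· * ·) (fun l hl => by rw [hl, hi]; simp)]
    split_ifs with h
    · rw [← h, hi, mul_one]
    · rw [mul_one]
  rw [hg]
  refine alternating_sum_eq_zero g i ?_ ?_
  · rw [← key]
    revert hi
    refine Fin.cases (fun hi => ?_) (fun i hi => ?_) i
    · simp only [Fin.castSucc_zero, g, Fin.cons_zero]
      rw [hi, one_mul]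
      congr 1
    · rw [← Fin.succ_castSucc, gs, if_neg (Fin.castSucc_ne_last i), mul_one,
        contractNth_eq_succAbove_succ a i (· * ·) (by rw [hi]; simp)]
  · intro l
    refine Fin.cases (fun h _ => ?_) (fun l h h' => ?_) l
    · have : i ≠ 0 := fun e => h (by simp [e])
      obtain ⟨j, rfl⟩ := Fin.exists_succ_eq.2 this
      simp only [g, Fin.cons_zero]
      rw [f.2 _ j hi, mul_zero]
    · rw [gs, hv l (fun e => h' (by rw [e])) (fun e => h (Fin.ext (by simp [e]))), zero_mul]

/-- The differential `δ^r : C^r(A, A) → C^{r+1}(A, A)`. -/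
def delta (k A : Type*) [Field k] [Ring A] [Algebra k A] (r : ℕ) :
    Cochain k A r →ₗ[k] Cochain k A (r + 1) where
  toFun f := ⟨deltaMultilinear f.1, deltaMultilinear_mem f⟩
  map_add' f g := by
    refine Subtype.ext (MultilinearMap.ext fun a => ?_)
    simp [deltaMultilinear, leftMul, rightMul, mul_add, add_mul, Finset.sum_add_distrib]
    abel
  map_smul' c f := by
    refine Subtype.ext (MultilinearMap.ext fun a => ?_)
    simp [deltaMultilinear, leftMul, rightMul, Finset.smul_sum, smul_comm c]

variable {ι : Type*} [Fintype ι] [DecidableEq ι] (F : FrobeniusData k A ι)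

/-- The faces of `a₀ ⊗ ⋯ ⊗ a_{p+1}` in the Hochschild complex of `A_{ν⁻¹}`:
`a₀ ν⁻¹(a₁) ⊗ a₂ ⊗ ⋯`, then `a₀ ⊗ ⋯ ⊗ a_l a_{l+1} ⊗ ⋯` for `1 ≤ l ≤ p`, and finally
`a_{p+1} a₀ ⊗ a₁ ⊗ ⋯ ⊗ a_p`. -/
noncomputable def chainFace {p : ℕ} (l : Fin (p + 2)) (a : Fin (p + 2) → A) : Fin (p + 1) → A :=
  if l = 0 then Fin.contractNth 0 (fun x y => x * F.nakayamaInv y) a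
  else if l = Fin.last (p + 1) then
    Function.update (Fin.init a) 0 (a (Fin.last (p + 1)) * a 0)
  else Fin.contractNth l (· * ·) a

theorem tupleLinear_chainFace {p : ℕ} (l : Fin (p + 2)) : TupleLinear k (chainFace F l) := by
  unfold chainFace
  by_cases h0 : l = 0
  · subst h0
    simp only [if_true]
    exact TupleLinear.contract ((LinearMap.mul k A).compl₂ F.nakayamaInv) 0
  by_cases h1 : l = Fin.last (p + 1)
  · subst h1
    simp only [if_neg h0, if_true]
    intro a i
    revert a
    refine Fin.lastCases (fun a => ?_) (fun i a => ?_) i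
    · refine ⟨0, LinearMap.mulRight k (a 0), fun x => ?_⟩
      simp [Fin.init_update_last]
    · by_cases hi : i = 0
      · subst hi
        refine ⟨0, LinearMap.mulLeft k (a (Fin.last _)), fun x => ?_⟩
        have h' : Function.update a (0 : Fin (p + 1)).castSucc x (Fin.last (p + 1)) =
            a (Fin.last (p + 1)) := Function.update_of_ne (Fin.castSucc_ne_last _).symm _ _
        beta_reduce
        rw [Fin.init_update_castSucc, h', Fin.castSucc_zero, Function.update_self,
          Function.update_idem, Function.update_idem, LinearMap.mulLeft_apply]
      · refine ⟨i, LinearMap.id, fun x => ?_⟩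
        have h' : (0 : Fin (p + 2)) ≠ i.castSucc := fun e => hi (by
          rw [← Fin.castSucc_zero] at e; exact (Fin.castSucc_injective _ e).symm)
        beta_reduce
        rw [Fin.init_update_castSucc, Function.update_of_ne (Fin.castSucc_ne_last i).symm,
          Function.update_of_ne h', LinearMap.id_apply, Function.update_comm hi]
  · simp only [if_neg h0, if_neg h1]
    obtain ⟨j, rfl⟩ := Fin.exists_castSucc_eq.2 h1
    exact TupleLinear.contractMul j

/-- The Hochschild differential `∂_{p+1} : C_{p+1}(A, A_{ν⁻¹}) → C_p(A, A_{ν⁻¹})`, the alternating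
sum of the faces. -/
noncomputable def boundary (p : ℕ) : Chain k A (p + 1) →ₗ[k] Chain k A p :=
  chainLift (∑ l : Fin (p + 2), (-1 : k) ^ (l : ℕ) •
      pull (chainMk k A p) (chainFace F l) (tupleLinear_chainFace F l)) (by
    intro a i hi ha
    obtain ⟨i, rfl⟩ := Fin.exists_succ_eq.2 hi
    simp only [sum_apply, smul_apply, pull_apply]
    have key : chainFace F i.castSucc a = a ∘ i.succ.succAbove := by
      have h1 : i.castSucc ≠ Fin.last (p + 1) := Fin.castSucc_ne_last i
      unfold chainFace
      split_ifs with h0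
      · rw [← h0]
        refine contractNth_eq_succAbove_succ a i _ ?_
        rw [ha, F.nakayamaInv_one, mul_one]
      · exact contractNth_eq_succAbove_succ a i _ (by rw [ha, mul_one])
    have key' : chainFace F i.succ a = a ∘ i.succ.succAbove := by
      unfold chainFace
      rw [if_neg hi]
      split_ifs with h1
      · rw [← h1, ha, one_mul, h1]
        funext l
        simp only [Function.comp_apply, Fin.succAbove_last]
        refine Fin.cases ?_ (fun l => ?_) l
        · simp
        · simp [Fin.init]
      · exact contractNth_eq_succAbove a _ _ (fun l hl => by rw [hl, ha, one_mul])
    refine alternating_sum_eq_zero _ i (by rw [key, key']) fun l h h' => ?_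
    have hne : ((i.succ : Fin (p + 2)) : ℕ) ≠ l + 1 := fun e => h (Fin.ext (by simpa using e.symm))
    unfold chainFace
    split_ifs with h0 h1
    · obtain ⟨m, hm, hm'⟩ := contractNth_entry a 0 (fun x y => x * F.nakayamaInv y) i.succ hi
        (by rw [h0] at hne; exact hne)
      exact chainMk_eq_zero _ m (fun e => hm (by simp) (by simp [e])) (hm'.trans ha)
    · have hlast : i.succ ≠ Fin.last (p + 1) := fun e => h' (h1.trans e.symm)
      obtain ⟨j, hj⟩ := Fin.exists_castSucc_eq.2 hlast
      have hj0 : j ≠ 0 := fun e => hi (by rw [← hj, e]; rfl)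
      refine chainMk_eq_zero _ j hj0 ?_
      rw [Function.update_of_ne hj0, Fin.init, hj, ha]
    · obtain ⟨m, hm, hm'⟩ := contractNth_entry a l (· * ·) i.succ h'.symm hne
      exact chainMk_eq_zero _ m (fun e => hm (by simp) (by simp [e])) (hm'.trans ha))

/-- The map `μ : C_0(A, A_{ν⁻¹}) = A → A = C^0(A, A)`, `μ(m) = ∑ i, u i * m * v i`. -/
noncomputable def mu : Chain k A 0 →ₗ[k] Cochain k A 0 :=
  chainLift (mkMultilinear
      (fun a => (⟨MultilinearMap.constOfIsEmpty k _ (∑ i, F.u i * a 0 * F.v i),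
        fun _ i => i.elim0⟩ : Cochain k A 0))
      (fun a i x y => by
        obtain rfl : i = 0 := Fin.fin_one_eq_zero i
        refine Subtype.ext (MultilinearMap.ext fun b => ?_)
        simp [mul_add, add_mul, Finset.sum_add_distrib])
      (fun a i c x => by
        obtain rfl : i = 0 := Fin.fin_one_eq_zero i
        refine Subtype.ext (MultilinearMap.ext fun b => ?_)
        simp [Finset.smul_sum]))
    (fun a i hi => absurd (Fin.fin_one_eq_zero i) hi)

/-- The terms of the complete Hochschild complex: `D^r = C^r(A, A)` for `r ≥ 0`, and
`D^{-p-1} = C_p(A, A_{ν⁻¹})` for `p ≥ 0`. -/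
def D (k A : Type u) [Field k] [Ring A] [Algebra k A] : ℤ → Type u
  | .ofNat r => Cochain k A r
  | .negSucc p => Chain k A p

section

variable {k A : Type u} [Field k] [Ring A] [Algebra k A]

instance (n : ℤ) : AddCommGroup (D k A n) :=
  match n with
  | .ofNat r => show AddCommGroup (Cochain k A r) from inferInstance
  | .negSucc p => show AddCommGroup (Chain k A p) from inferInstance

instance (n : ℤ) : Module k (D k A n) :=
  match n with
  | .ofNat r => show Module k (Cochain k A r) from inferInstance
  | .negSucc p => show Module k (Chain k A p) from inferInstance

end

end Complex

section Star

variable {k A : Type*} [Field k] [Ring A] [Algebra k A]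

theorem update_comp_injective {B : Type*} {n N : ℕ} (a : Fin N → B) (σ : Fin n → Fin N)
    (hσ : Function.Injective σ) (i : Fin n) (x : B) :
    (fun l => Function.update a (σ i) x (σ l)) = Function.update (fun l => a (σ l)) i x := by
  funext l
  by_cases h : l = i
  · subst h; simp
  · rw [Function.update_of_ne h, Function.update_of_ne (fun e => h (hσ e))]

theorem update_comp_not_mem {B : Type*} {n N : ℕ} (a : Fin N → B) (σ : Fin n → Fin N) (i : Fin N)
    (hi : ∀ l, σ l ≠ i) (x : B) :
    (fun l => Function.update a i x (σ l)) = fun l => a (σ l) := by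
  funext l
  rw [Function.update_of_ne (hi l)]

/-- The cup product `(f ⌣ g)(a₁, …, a_{m+n}) = f(a₁, …, a_m) g(a_{m+1}, …, a_{m+n})`. -/
def cup {m n : ℕ} (f : Cochain k A m) (g : Cochain k A n) : Cochain k A (m + n) :=
  ⟨mkMultilinear
    (fun a => f.1 (fun i => a (Fin.castAdd n i)) * g.1 (fun j => a (Fin.natAdd m j)))
    (fun a i x y => by
      refine Fin.addCases (fun i => ?_) (fun i => ?_) i
      · simp only [update_comp_injective a _ (Fin.castAdd_injective m n) i,
          update_comp_not_mem a (Fin.natAdd m) (Fin.castAdd n i)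
            (fun l e => by simp [Fin.ext_iff] at e; omega),
          MultilinearMap.map_update_add, add_mul]
      · simp only [update_comp_injective a _ (Fin.natAdd_injective n m) i,
          update_comp_not_mem a (Fin.castAdd n) (Fin.natAdd m i)
            (fun l e => by simp [Fin.ext_iff] at e; omega),
          MultilinearMap.map_update_add, mul_add])
    (fun a i c x => by
      refine Fin.addCases (fun i => ?_) (fun i => ?_) i
      · simp only [update_comp_injective a _ (Fin.castAdd_injective m n) i,
          update_comp_not_mem a (Fin.natAdd m) (Fin.castAdd n i)
            (fun l e => by simp [Fin.ext_iff] at e; omega),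
          MultilinearMap.map_update_smul, smul_mul_assoc]
      · simp only [update_comp_injective a _ (Fin.natAdd_injective n m) i,
          update_comp_not_mem a (Fin.castAdd n) (Fin.natAdd m i)
            (fun l e => by simp [Fin.ext_iff] at e; omega),
          MultilinearMap.map_update_smul, mul_smul_comm]),
  by
    intro a i
    refine Fin.addCases (fun i hi => ?_) (fun i hi => ?_) i
    · rw [mkMultilinear_apply, f.2 _ i hi, zero_mul]
    · rw [mkMultilinear_apply, g.2 _ i hi, mul_zero]⟩

variable {ι : Type*} [Fintype ι] [DecidableEq ι] (F : FrobeniusData k A ι)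

/-- For `p = m + q`, the tuple
`(a₀ ν⁻¹(f(a₁, …, a_m)), a_{m+1}, …, a_p)`. -/
noncomputable def chainCochainTuple {m q : ℕ} (f : Cochain k A m) (a : Fin (m + q + 1) → A) :
    Fin (q + 1) → A :=
  Fin.cons (a 0 * F.nakayamaInv (f.1 fun i => a (Fin.castAdd q i).succ))
    fun j => a (Fin.natAdd m j).succ

/-- For `p = q + m`, the tuple `(f(a_{q+1}, …, a_p) a₀, a₁, …, a_q)`. -/
def cochainChainTuple {m q : ℕ} (f : Cochain k A m) (a : Fin (q + m + 1) → A) :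
    Fin (q + 1) → A :=
  Fin.cons ((f.1 fun i => a (Fin.natAdd q i).succ) * a 0) fun j => a (Fin.castAdd m j).succ

theorem tupleLinear_chainCochainTuple {m q : ℕ} (f : Cochain k A m) :
    TupleLinear k (chainCochainTuple F f (q := q)) := by
  have inj1 : Function.Injective fun i : Fin m => (Fin.castAdd q i).succ :=
    (Fin.succ_injective _).comp (Fin.castAdd_injective m q)
  have inj2 : Function.Injective fun i : Fin q => (Fin.natAdd m i).succ :=
    (Fin.succ_injective _).comp (Fin.natAdd_injective q m)
  intro a i
  revert a
  refine Fin.cases (fun a => ?_) (fun i a => ?_) i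
  · refine ⟨0, LinearMap.mulRight k (F.nakayamaInv (f.1 fun i => a (Fin.castAdd q i).succ)),
      fun x => ?_⟩
    simp only [chainCochainTuple, Fin.update_cons_zero, LinearMap.mulRight_apply,
      Function.update_self]
    rw [update_comp_not_mem a (fun i : Fin m => (Fin.castAdd q i).succ) 0
      (fun l => Fin.succ_ne_zero _), update_comp_not_mem a (fun i : Fin q => (Fin.natAdd m i).succ) 0
      (fun l => Fin.succ_ne_zero _)]
  · revert a
    refine Fin.addCases (fun i a => ?_) (fun i a => ?_) i
    · refine ⟨0, LinearMap.mulLeft k (a 0) ∘ₗ F.nakayamaInv ∘ₗ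
        f.1.toLinearMap (fun i => a (Fin.castAdd q i).succ) i, fun x => ?_⟩
      simp only [chainCochainTuple, Fin.update_cons_zero, LinearMap.comp_apply,
        LinearMap.mulLeft_apply, MultilinearMap.toLinearMap_apply,
        Function.update_of_ne (Fin.succ_ne_zero _).symm]
      rw [update_comp_injective a _ inj1 i,
        update_comp_not_mem a (fun i : Fin q => (Fin.natAdd m i).succ) _
          (fun l e => by simp [Fin.ext_iff] at e; omega)]
    · refine ⟨i.succ, LinearMap.id, fun x => ?_⟩
      simp only [chainCochainTuple, LinearMap.id_apply,
        Function.update_of_ne (Fin.succ_ne_zero _).symm]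
      rw [update_comp_injective a _ inj2 i,
        update_comp_not_mem a (fun i : Fin m => (Fin.castAdd q i).succ) _
          (fun l e => by simp [Fin.ext_iff] at e; omega), Fin.cons_update]

theorem tupleLinear_cochainChainTuple {m q : ℕ} (f : Cochain k A m) :
    TupleLinear k (cochainChainTuple f (q := q)) := by
  have inj1 : Function.Injective fun i : Fin q => (Fin.castAdd m i).succ :=
    (Fin.succ_injective _).comp (Fin.castAdd_injective q m)
  have inj2 : Function.Injective fun i : Fin m => (Fin.natAdd q i).succ :=
    (Fin.succ_injective _).comp (Fin.natAdd_injective m q)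
  intro a i
  revert a
  refine Fin.cases (fun a => ?_) (fun i a => ?_) i
  · refine ⟨0, LinearMap.mulLeft k (f.1 fun i => a (Fin.natAdd q i).succ), fun x => ?_⟩
    simp only [cochainChainTuple, Fin.update_cons_zero, LinearMap.mulLeft_apply,
      Function.update_self]
    rw [update_comp_not_mem a (fun i : Fin q => (Fin.castAdd m i).succ) 0
      (fun l => Fin.succ_ne_zero _), update_comp_not_mem a (fun i : Fin m => (Fin.natAdd q i).succ) 0
      (fun l => Fin.succ_ne_zero _)]
  · revert a
    refine Fin.addCases (fun i a => ?_) (fun i a => ?_) i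
    · refine ⟨i.succ, LinearMap.id, fun x => ?_⟩
      simp only [cochainChainTuple, LinearMap.id_apply,
        Function.update_of_ne (Fin.succ_ne_zero _).symm]
      rw [update_comp_injective a _ inj1 i,
        update_comp_not_mem a (fun i : Fin m => (Fin.natAdd q i).succ) _
          (fun l e => by simp [Fin.ext_iff] at e; omega), Fin.cons_update]
    · refine ⟨0, LinearMap.mulRight k (a 0) ∘ₗ
        f.1.toLinearMap (fun i => a (Fin.natAdd q i).succ) i, fun x => ?_⟩
      simp only [cochainChainTuple, Fin.update_cons_zero, LinearMap.comp_apply,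
        LinearMap.mulRight_apply, MultilinearMap.toLinearMap_apply,
        Function.update_of_ne (Fin.succ_ne_zero _).symm]
      rw [update_comp_injective a _ inj2 i,
        update_comp_not_mem a (fun i : Fin q => (Fin.castAdd m i).succ) _
          (fun l e => by simp [Fin.ext_iff] at e; omega)]

/-- For `p = m + q`, the product `C_p × C^m → C_q`,
`α ⋆ f = a₀ ν⁻¹(f(a₁, …, a_m)) ⊗ ā_{m+1} ⊗ ⋯ ⊗ ā_p` for `α = a₀ ⊗ ā₁ ⊗ ⋯ ⊗ ā_p`. -/
noncomputable def starChainCochain {m q : ℕ} (f : Cochain k A m) :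
    Chain k A (m + q) →ₗ[k] Chain k A q :=
  chainLift (pull (chainMk k A q) (chainCochainTuple F f) (tupleLinear_chainCochainTuple F f)) (by
    intro a i hi ha
    obtain ⟨i, rfl⟩ := Fin.exists_succ_eq.2 hi
    rw [pull_apply]
    revert ha
    refine Fin.addCases (fun i ha => ?_) (fun i ha => ?_) i
    · refine MultilinearMap.map_coord_zero _ 0 ?_
      rw [chainCochainTuple, Fin.cons_zero, f.2 _ i ha, map_zero, mul_zero]
    · exact chainMk_eq_zero _ i.succ (Fin.succ_ne_zero i) (by rw [chainCochainTuple, Fin.cons_succ, ha]))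

/-- For `p = q + m`, the product `C^m × C_p → C_q`,
`f ⋆ α = f(a_{q+1}, …, a_p) a₀ ⊗ ā₁ ⊗ ⋯ ⊗ ā_q` for `α = a₀ ⊗ ā₁ ⊗ ⋯ ⊗ ā_p`. -/
def starCochainChain {m q : ℕ} (f : Cochain k A m) :
    Chain k A (q + m) →ₗ[k] Chain k A q :=
  chainLift (pull (chainMk k A q) (cochainChainTuple f) (tupleLinear_cochainChainTuple f)) (by
    intro a i hi ha
    obtain ⟨i, rfl⟩ := Fin.exists_succ_eq.2 hi
    rw [pull_apply]
    revert ha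
    refine Fin.addCases (fun i ha => ?_) (fun i ha => ?_) i
    · exact chainMk_eq_zero _ i.succ (Fin.succ_ne_zero i) (by rw [cochainChainTuple, Fin.cons_succ, ha])
    · refine MultilinearMap.map_coord_zero _ 0 ?_
      rw [cochainChainTuple, Fin.cons_zero, f.2 _ i ha, zero_mul])

/-- The tuple `(b₁, …, b_n, x ν(a₀), a₁, …, a_p)`. -/
noncomputable def appendTuple {n p : ℕ} (x : A) (b : Fin n → A) (a : Fin (p + 1) → A) :
    Fin (n + (p + 1)) → A :=
  Fin.append b (Function.update a 0 (x * F.nakayama (a 0)))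

theorem tupleLinear_append_left {n N : ℕ} (c : Fin N → A) :
    TupleLinear k (fun b : Fin n → A => Fin.append b c) := by
  refine TupleLinear.of_entries _ (Fin.castAdd N) (Fin.castAdd_injective n N)
    (fun _ => LinearMap.id) (fun b i => by simp) (fun b b' j hj => ?_)
  revert hj
  refine Fin.addCases (fun i h => absurd rfl (h i)) (fun i _ => by simp) j

theorem tupleLinear_append_right {n N : ℕ} (c : Fin n → A) :
    TupleLinear k (fun b : Fin N → A => Fin.append c b) := by
  refine TupleLinear.of_entries _ (Fin.natAdd n) (Fin.natAdd_injective N n)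
    (fun _ => LinearMap.id) (fun b i => by simp) (fun b b' j hj => ?_)
  revert hj
  refine Fin.addCases (fun i _ => by simp) (fun i h => absurd rfl (h i)) j

theorem TupleLinear.comp {n N N' : ℕ} {T : (Fin N → A) → (Fin N' → A)}
    {S : (Fin n → A) → (Fin N → A)} (hT : TupleLinear k T) (hS : TupleLinear k S) :
    TupleLinear k (fun a => T (S a)) := by
  intro a i
  obtain ⟨j, L, h⟩ := hS a i
  obtain ⟨l, L', h'⟩ := hT (S a) j
  exact ⟨l, L' ∘ₗ L, fun x => by beta_reduce; rw [h, h']; rfl⟩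

theorem tupleLinear_update_zero {n : ℕ} (L : A →ₗ[k] A) :
    TupleLinear k (fun a : Fin (n + 1) → A => Function.update a 0 (L (a 0))) := by
  refine TupleLinear.of_entries _ id Function.injective_id
    (fun i => if i = 0 then L else LinearMap.id) (fun a i => ?_) (fun a b j h => absurd rfl (h j))
  by_cases h : i = 0
  · subst h; simp
  · simp [h]

theorem tupleLinear_appendTuple {n p : ℕ} (x : A) (b : Fin n → A) :
    TupleLinear k (fun a : Fin (p + 1) → A => appendTuple F x b a) :=
  (tupleLinear_append_right b).comp
    (tupleLinear_update_zero (LinearMap.mulLeft k x ∘ₗ F.nakayama))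

theorem tupleLinear_appendTuple_left {n p : ℕ} (x : A) (a : Fin (p + 1) → A) :
    TupleLinear k (fun b : Fin n → A => appendTuple F x b a) :=
  tupleLinear_append_left _

/-- For `m = n + p + 1`, the product `C^m × C_p → C^n`,
`(f ⋆ α)(b₁, …, b_n) = ∑ i, f(b₁, …, b_n, u_i ν(a₀), a₁, …, a_p) v_i`
for `α = a₀ ⊗ ā₁ ⊗ ⋯ ⊗ ā_p`. -/
noncomputable def starCochainChain' {n p : ℕ} (f : Cochain k A (n + (p + 1))) :
    Chain k A p →ₗ[k] Cochain k A n :=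
  chainLift (mkMultilinear
    (fun a => (⟨∑ i, (LinearMap.mulRight k (F.v i)).compMultilinearMap
        (pull f.1 (fun b => appendTuple F (F.u i) b a) (tupleLinear_appendTuple_left F _ _)), by
      intro b j hj
      rw [sum_apply]
      refine Finset.sum_eq_zero fun i _ => ?_
      rw [LinearMap.compMultilinearMap_apply, pull_apply,
        f.2 _ (Fin.castAdd (p + 1) j) (by simp [appendTuple, hj]), map_zero]⟩ : Cochain k A n))
    (fun a j x y => by
      refine Subtype.ext (MultilinearMap.ext fun b => ?_)
      have := fun i => (pull f.1 _ (tupleLinear_appendTuple F (F.u i) b)).map_update_add a j x y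
      simp only [pull_apply] at this
      simp [this, add_mul, Finset.sum_add_distrib])
    (fun a j c x => by
      refine Subtype.ext (MultilinearMap.ext fun b => ?_)
      have := fun i => (pull f.1 _ (tupleLinear_appendTuple F (F.u i) b)).map_update_smul a j c x
      simp only [pull_apply] at this
      simp [this, Finset.smul_sum]))
  (by
    intro a j hj ha
    refine Subtype.ext (MultilinearMap.ext fun b => ?_)
    rw [mkMultilinear_apply, sum_apply]
    refine Finset.sum_eq_zero fun i _ => ?_
    rw [LinearMap.compMultilinearMap_apply, pull_apply,
      f.2 _ (Fin.natAdd n j) (by simp [appendTuple, hj, ha]), map_zero])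

/-- The tuple `(a₁, …, a_p, x, b₁, …, b_n)`. -/
def snocTuple {n p : ℕ} (x : A) (b : Fin n → A) (a : Fin p → A) : Fin (p + 1 + n) → A :=
  Fin.append (Fin.snoc a x) b

theorem tupleLinear_snocTuple {n p : ℕ} (x : A) (b : Fin n → A) :
    TupleLinear k (fun a : Fin p → A => snocTuple x b a) := by
  refine (tupleLinear_append_left b).comp ?_
  refine TupleLinear.of_entries _ Fin.castSucc (Fin.castSucc_injective p)
    (fun _ => LinearMap.id) (fun b i => by simp) (fun a a' j hj => ?_)
  revert hj
  refine Fin.lastCases (fun _ => by simp) (fun i h => absurd rfl (h i)) j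

theorem tupleLinear_snocTuple_right {n p : ℕ} (x : A) (a : Fin p → A) :
    TupleLinear k (fun b : Fin n → A => snocTuple x b a) :=
  tupleLinear_append_right _

/-- For `m = p + 1 + n`, the product `C_p × C^m → C^n`,
`(α ⋆ f)(b₁, …, b_n) = ∑ i, u_i ν(a₀) f(a₁, …, a_p, v_i, b₁, …, b_n)`
for `α = a₀ ⊗ ā₁ ⊗ ⋯ ⊗ ā_p`. -/
noncomputable def starChainCochain' {n p : ℕ} (f : Cochain k A (p + 1 + n)) :
    Chain k A p →ₗ[k] Cochain k A n :=
  chainLift (mkMultilinear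
    (fun a => (⟨∑ i, (LinearMap.mulLeft k (F.u i * F.nakayama (a 0))).compMultilinearMap
        (pull f.1 (fun b => snocTuple (F.v i) b (Fin.tail a)) (tupleLinear_snocTuple_right _ _)), by
      intro b j hj
      rw [sum_apply]
      refine Finset.sum_eq_zero fun i _ => ?_
      rw [LinearMap.compMultilinearMap_apply, pull_apply,
        f.2 _ (Fin.natAdd (p + 1) j) (by simp [snocTuple, hj]), map_zero]⟩ : Cochain k A n))
    (fun a j x y => by
      refine Subtype.ext (MultilinearMap.ext fun b => ?_)
      revert a
      refine Fin.cases (fun a => ?_) (fun j a => ?_) j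
      · simp [add_mul, mul_add, mul_assoc, Finset.sum_add_distrib]
      · have := fun i =>
          (pull f.1 _ (tupleLinear_snocTuple (F.v i) b)).map_update_add (Fin.tail a) j x y
        simp only [pull_apply] at this
        simp [this, mul_add, Finset.sum_add_distrib,
          Function.update_of_ne (Fin.succ_ne_zero j).symm])
    (fun a j c x => by
      refine Subtype.ext (MultilinearMap.ext fun b => ?_)
      revert a
      refine Fin.cases (fun a => ?_) (fun j a => ?_) j
      · simp [Finset.smul_sum, mul_assoc]
      · have := fun i =>
          (pull f.1 _ (tupleLinear_snocTuple (F.v i) b)).map_update_smul (Fin.tail a) j c x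
        simp only [pull_apply] at this
        simp [this, Finset.smul_sum, Function.update_of_ne (Fin.succ_ne_zero j).symm]))
  (by
    intro a j hj ha
    obtain ⟨j, rfl⟩ := Fin.exists_succ_eq.2 hj
    refine Subtype.ext (MultilinearMap.ext fun b => ?_)
    rw [mkMultilinear_apply, sum_apply]
    refine Finset.sum_eq_zero fun i _ => ?_
    rw [LinearMap.compMultilinearMap_apply, pull_apply,
      f.2 _ (Fin.castAdd n j.castSucc) (by simpa [snocTuple, Fin.tail] using ha), map_zero])

/-- The tuple `(y b₀, b₁, …, b_q, x ν(a₀), a₁, …, a_p)`. -/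
noncomputable def chainChainTuple {p q : ℕ} (x y : A) (b : Fin (q + 1) → A) (a : Fin (p + 1) → A) :
    Fin (p + q + 1 + 1) → A :=
  appendTuple F x (Function.update b 0 (y * b 0)) a ∘ Fin.cast (by omega)

theorem tupleLinear_cast {n N : ℕ} (h : N = n) :
    TupleLinear k (fun a : Fin n → A => a ∘ Fin.cast h) := by
  subst h
  exact fun a i => ⟨i, LinearMap.id, fun x => rfl⟩

theorem tupleLinear_chainChainTuple_left {p q : ℕ} (x y : A) (a : Fin (p + 1) → A) :
    TupleLinear k (fun b : Fin (q + 1) → A => chainChainTuple F x y b a) :=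
  (tupleLinear_cast _).comp ((tupleLinear_append_left _).comp
    (tupleLinear_update_zero (LinearMap.mulLeft k y)))

theorem tupleLinear_chainChainTuple_right {p q : ℕ} (x y : A) (b : Fin (q + 1) → A) :
    TupleLinear k (fun a : Fin (p + 1) → A => chainChainTuple F x y b a) :=
  (tupleLinear_cast _).comp (tupleLinear_appendTuple F x _)

/-- The product `C_p × C_q → C_{p+q+1}`,
`α ⋆ β = ∑ i, v_i b₀ ⊗ b̄₁ ⊗ ⋯ ⊗ b̄_q ⊗ (u_i ν(a₀))‾ ⊗ ā₁ ⊗ ⋯ ⊗ ā_p`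
for `α = a₀ ⊗ ā₁ ⊗ ⋯ ⊗ ā_p` and `β = b₀ ⊗ b̄₁ ⊗ ⋯ ⊗ b̄_q`. -/
noncomputable def starChainChain (p q : ℕ) :
    Chain k A p →ₗ[k] Chain k A q →ₗ[k] Chain k A (p + q + 1) :=
  chainLift (mkMultilinear
    (fun a => chainLift (∑ i, pull (chainMk k A (p + q + 1))
        (fun b => chainChainTuple F (F.u i) (F.v i) b a)
        (tupleLinear_chainChainTuple_left F _ _ a)) (by
      intro b j hj hb
      rw [sum_apply]
      refine Finset.sum_eq_zero fun i _ => ?_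
      rw [pull_apply]
      refine chainMk_eq_zero _ (Fin.cast (by omega) (Fin.castAdd (p + 1) j)) ?_ ?_
      · exact fun e => hj (Fin.ext (by simpa using congrArg Fin.val e))
      · simp [chainChainTuple, appendTuple, hj, hb]))
    (fun a j x y => chain_hom_ext fun b => by
      have := fun i => (pull (chainMk k A (p + q + 1)) _
        (tupleLinear_chainChainTuple_right F (F.u i) (F.v i) b)).map_update_add
          a j x y
      simp only [pull_apply] at this
      simp [this, Finset.sum_add_distrib])
    (fun a j c x => chain_hom_ext fun b => by
      have := fun i => (pull (chainMk k A (p + q + 1)) _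
        (tupleLinear_chainChainTuple_right F (F.u i) (F.v i) b)).map_update_smul
          a j c x
      simp only [pull_apply] at this
      simp [this, Finset.smul_sum]))
  (by
    intro a j hj ha
    refine chain_hom_ext fun b => ?_
    rw [mkMultilinear_apply, chainLift_chainMk, sum_apply, LinearMap.zero_apply]
    refine Finset.sum_eq_zero fun i _ => ?_
    rw [pull_apply]
    refine chainMk_eq_zero _ (Fin.cast (by omega) (Fin.natAdd (q + 1) j)) ?_ ?_
    · exact fun e => by simpa using congrArg Fin.val e
    · simp [chainChainTuple, appendTuple, hj, ha])

end Star

section Cohomology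

universe u

variable {k A : Type u} [Field k] [Ring A] [Algebra k A]

/-- The identity map between terms of the complex whose degrees are equal. -/
def D.cast {m n : ℤ} (h : m = n) (x : D k A m) : D k A n := h ▸ x

variable {ι : Type*} [Fintype ι] [DecidableEq ι] (F : FrobeniusData k A ι)

/-- The `⋆`-product `D^m × D^n → D^{m+n}` on the complete Hochschild complex. -/
noncomputable def starProduct : {m n : ℤ} → D k A m → D k A n → D k A (m + n)
  | .ofNat m, .ofNat n, f, g =>
    D.cast (m := Int.ofNat (m + n)) (by simp) (cup (k := k) (A := A) f g)
  | .negSucc p, .ofNat m, α, f =>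
    if h : m ≤ p then
      D.cast (m := Int.negSucc (p - m)) (by simp only [Int.ofNat_eq_natCast, Int.negSucc_eq]; omega)
        (starChainCochain F (q := p - m) f
          (D.cast (m := Int.negSucc p) (n := Int.negSucc (m + (p - m))) (by simp only [Int.ofNat_eq_natCast, Int.negSucc_eq]; omega) α))
    else
      D.cast (m := Int.ofNat (m - (p + 1))) (by simp only [Int.ofNat_eq_natCast, Int.negSucc_eq]; omega)
        (starChainCochain' F (p := p)
          (D.cast (m := Int.ofNat m) (n := Int.ofNat (p + 1 + (m - (p + 1)))) (by simp only [Int.ofNat_eq_natCast, Int.negSucc_eq]; omega) f) α)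
  | .ofNat m, .negSucc p, f, α =>
    if h : m ≤ p then
      D.cast (m := Int.negSucc (p - m)) (by simp only [Int.ofNat_eq_natCast, Int.negSucc_eq]; omega)
        (starCochainChain (q := p - m) f
          (D.cast (m := Int.negSucc p) (n := Int.negSucc (p - m + m)) (by simp only [Int.ofNat_eq_natCast, Int.negSucc_eq]; omega) α))
    else
      D.cast (m := Int.ofNat (m - (p + 1))) (by simp only [Int.ofNat_eq_natCast, Int.negSucc_eq]; omega)
        (starCochainChain' F (p := p)
          (D.cast (m := Int.ofNat m) (n := Int.ofNat (m - (p + 1) + (p + 1))) (by simp only [Int.ofNat_eq_natCast, Int.negSucc_eq]; omega) f) α)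
  | .negSucc p, .negSucc q, α, β =>
    D.cast (m := Int.negSucc (p + q + 1)) (by simp only [Int.ofNat_eq_natCast, Int.negSucc_eq]; omega) (starChainChain F p q α β)

/-- The differential of the complete Hochschild complex
`⋯ → C_1(A, A_{ν⁻¹}) → A_{ν⁻¹} → A → C^1(A, A) → ⋯`: it is `δ^n` for `n ≥ 0`, it is `μ` for
`n = -1`, and it is `∂_{-n-1}` for `n ≤ -2`. -/
noncomputable def diff : (n : ℤ) → D k A n →ₗ[k] D k A (n + 1)
  | .ofNat r => (delta k A r : Cochain k A r →ₗ[k] Cochain k A (r + 1))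
  | .negSucc 0 => (mu F : Chain k A 0 →ₗ[k] Cochain k A 0)
  | .negSucc (p + 1) => (boundary F p : Chain k A (p + 1) →ₗ[k] Chain k A p)

/-- The cocycles of degree `n`. -/
noncomputable def cocycles (n : ℤ) : Submodule k (D k A n) := LinearMap.ker (diff F n)

/-- The coboundaries of degree `n`. -/
noncomputable def coboundaries : (n : ℤ) → Submodule k (D k A n)
  | .ofNat 0 => LinearMap.range (mu F)
  | .ofNat (r + 1) => LinearMap.range (delta k A r)
  | .negSucc p => LinearMap.range (boundary F p)

/-- The complete cohomology group `ĤH^n(A)`. -/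
abbrev HH (n : ℤ) : Type u := cocycles F n ⧸ (coboundaries F n).submoduleOf (cocycles F n)

/-- The cohomology class of a cocycle. -/
noncomputable def cls {n : ℤ} : cocycles F n →ₗ[k] HH F n :=
  ((coboundaries F n).submoduleOf (cocycles F n)).mkQ

end Cohomology

section Main

universe u

variable {k A : Type u} [Field k] [Ring A] [Algebra k A] {ι : Type*} [Fintype ι] [DecidableEq ι]

/-- The bilinear maps `mul m n : ĤH^m(A) × ĤH^n(A) → ĤH^{m+n}(A)` are induced by the `⋆`-product of
the complete Hochschild complex: the product of two cocycles is a cocycle, and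
`[x] ⋆ [y] = [x ⋆ y]`. -/
def IsInducedByStar (F : FrobeniusData k A ι)
    (mul : ∀ m n : ℤ, HH F m →ₗ[k] HH F n →ₗ[k] HH F (m + n)) : Prop :=
  ∀ (m n : ℤ) (x : cocycles F m) (y : cocycles F n),
    ∃ h : starProduct F x.1 y.1 ∈ cocycles F (m + n), mul m n (cls F x) (cls F y) = cls F ⟨_, h⟩

/-- The element `1 ∈ A = C^0(A, A)`. -/
def unitCochain (k A : Type u) [Field k] [Ring A] [Algebra k A] : D k A 0 :=
  (⟨MultilinearMap.constOfIsEmpty k _ 1, fun _ i => i.elim0⟩ : Cochain k A 0)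

namespace TwoCycleAlgebra

variable (k : Type u) [Field k]

/-- The coefficient of `α i` in an element of `A`. -/
noncomputable def coeffα (i : TwoCycle) : TwoCycleAlgebra k →ₗ[k] k :=
  LinearMap.proj (Sum.inr i) ∘ₗ coord k

theorem coeffα_one (i : TwoCycle) : coeffα k i 1 = 0 := by
  rw [one_eq, map_sum]
  simp [coeffα, coord_e]

/-- The cochain of degree `1` with `α₁ ↦ α₁`, `α₂ ↦ 0` and `e_i ↦ 0`. -/
noncomputable def betaCochain : D k (TwoCycleAlgebra k) 1 :=
  (⟨mkMultilinear (fun a => coeffα k 0 (a 0) • α k 0)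
      (fun a i x y => by
        obtain rfl : i = 0 := Fin.fin_one_eq_zero i
        simp [add_smul])
      (fun a i c x => by
        obtain rfl : i = 0 := Fin.fin_one_eq_zero i
        simp [mul_smul]),
    fun a i hi => by
      obtain rfl : i = 0 := Fin.fin_one_eq_zero i
      simp [hi, coeffα_one]⟩ : Cochain k (TwoCycleAlgebra k) 1)

/-- The cochain of degree `2` with `(α_i, α_{i+1}) ↦ e_i`, and zero on all other pairs of elements
of the basis `(e₁, e₂, α₁, α₂)`. -/
noncomputable def alphaCochain : D k (TwoCycleAlgebra k) 2 :=
  (⟨mkMultilinear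
      (fun a => ∑ i : TwoCycle, (coeffα k i (a 0) * coeffα k (i + 1) (a 1)) • e k i)
      (fun a i x y => by
        fin_cases i <;> simp [add_mul, mul_add, add_smul, Finset.sum_add_distrib])
      (fun a i c x => by
        fin_cases i <;> simp [Finset.smul_sum, smul_smul, mul_assoc, mul_left_comm c]),
    fun a i hi => by
      revert hi
      fin_cases i <;> intro hi <;> simp_all [coeffα_one]⟩ : Cochain k (TwoCycleAlgebra k) 2)

/-- The chain `e₁ ⊗ ᾱ₂ + e₂ ⊗ ᾱ₁` in `C_1(A, A_{ν⁻¹}) = D^{-2}`. -/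
noncomputable def gammaChain : D k (TwoCycleAlgebra k) (-2) :=
  (chainMk k (TwoCycleAlgebra k) 1 ![e k 0, α k 1] +
    chainMk k (TwoCycleAlgebra k) 1 ![e k 1, α k 0] : Chain k (TwoCycleAlgebra k) 1)

open MvPolynomial in
/-- The ideal `⟨αγ - 1, β²⟩` of `k[α, β, γ]`, with `α = X 0`, `β = X 1` and `γ = X 2`. -/
noncomputable def relations : Ideal (MvPolynomial (Fin 3) k) :=
  Ideal.span {X 0 * X 2 - 1, X 1 ^ 2}

/-- The ring `k[α, β, γ] / ⟨αγ - 1, β²⟩`. -/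
abbrev TargetRing := MvPolynomial (Fin 3) k ⧸ relations k

/-- The variables of `k[α, β, γ]` in the quotient ring. -/
noncomputable def gen (i : Fin 3) : TargetRing k := Ideal.Quotient.mk _ (MvPolynomial.X i)

/-- The part of degree `n` of `k[α, β, γ] / ⟨αγ - 1, β²⟩`, where `|α| = 2`, `|β| = 1` and
`|γ| = -2`. -/
noncomputable def targetDegree (n : ℤ) : Submodule k (TargetRing k) :=
  (MvPolynomial.weightedHomogeneousSubmodule k (![2, 1, -2] : Fin 3 → ℤ) n).map
    (Ideal.Quotient.mkₐ k (relations k)).toLinearMap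

end TwoCycleAlgebra

end Main

end CompleteHochschild

open CompleteHochschild

/-! The argument is a duality. The pairing ⟨f, a₀ ⊗ ā₁ ⊗ ⋯ ⊗ ā_p⟩ = ⟨f(a₁, …, a_p), a₀⟩ identifies
C^p with the full dual of C_p (`exists_pairing_eq`). Two features of this algebra make it effective:
the Nakayama automorphism swaps the two vertices, so ν⁻¹ = ν, and μ = 0. The first makes δ the
transpose of ∂ (`pairing_delta`); the second cuts the complex between degrees -1 and 0. The mixed
⋆-products are transposes of only two operations, the cup product and the product of chains, so the
two Leibniz rules for these control cocycles and coboundaries in all cases.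

The cohomology comes from the bimodule extension of A/rad A, spanned by the e_i, by rad A, spanned
by the α_i. With coefficients in the simple bimodule on which A acts through e_i on the left and e_j
on the right, a normalized cocycle of positive degree n bounds as soon as its value on the path of
length n from i to j vanishes, if that path exists (`exists_scalar_primitive`). Paths from i to i
have even length and paths from i to i + 1 have odd length, so the quotient contributes two scalars
in each even degree and the radical two in each odd degree. The connecting map (c₀, c₁) ↦ (c₁ - c₀,
c₀ - c₁) leaves one of each: the common value in even degree, the sum of the values in odd degree
(`exists_primitive`). These two functionals are pairings with explicit cycles `chainRep`, and there
are dual cocycles `cochainRep` with ⟨`cochainRep`, `chainRep`⟩ = 1.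

Consequently ⟨f, x⟩ = ⟨f, `chainRep`⟩ ⟨`cochainRep`, x⟩ for every cocycle f and every cycle x of the
same degree (`pairing_eq_mul`). A class is therefore one scalar, `classCoeff`, and with the
adjunctions every product reduces to a computation on paths: the scalar of x ⋆ y is the product of
the two scalars, or 0 if both degrees are odd (`starProduct_cocycle`). Since the answer involves
only the scalars, the product is well defined on classes.

Finally, k[α, β, γ]/⟨αγ - 1, β²⟩ has the basis αⁿ, αⁿβ for n ∈ ℤ, with one element in each degree
and the same structure constants. Linear independence is seen in the dual numbers over the Laurent
polynomials. Matching the bases gives the isomorphism. -/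

namespace CompleteHochschild

/-! ### Tuples as lists, and a recursive form of the Hochschild differentials -/

section ListTuples

/-- The first `n` entries of a list, as a tuple. -/
def entries {A : Type*} [Zero A] (n : ℕ) (l : List A) : Fin n → A := fun i => l.getD i 0

section

variable {A : Type*} [Zero A]

theorem entries_cons (n : ℕ) (x : A) (l : List A) :
    entries (n + 1) (x :: l) = Fin.cons x (entries n l) := by
  funext i
  refine Fin.cases ?_ (fun i => ?_) i <;> simp [entries]

theorem entries_ofFn {n : ℕ} (a : Fin n → A) : entries n (List.ofFn a) = a := by
  funext i
  simp [entries]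

theorem entries_append_castAdd {m n : ℕ} {l₁ : List A} (l₂ : List A) (h : l₁.length = m) :
    (fun i => entries (m + n) (l₁ ++ l₂) (Fin.castAdd n i)) = entries m l₁ := by
  funext i
  have := i.2
  simp only [entries, Fin.val_castAdd, List.getD_eq_getElem?_getD]
  rw [List.getElem?_append_left (by omega)]

theorem entries_append_natAdd {m n : ℕ} {l₁ : List A} (l₂ : List A) (h : l₁.length = m) :
    (fun i => entries (m + n) (l₁ ++ l₂) (Fin.natAdd m i)) = entries n l₂ := by
  funext i
  simp only [entries, Fin.val_natAdd, List.getD_eq_getElem?_getD]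
  rw [List.getElem?_append_right (by omega), h, Nat.add_sub_cancel_left]

theorem entries_append {m n : ℕ} {l₁ : List A} (l₂ : List A) (h : l₁.length = m) :
    entries (m + n) (l₁ ++ l₂) = Fin.append (entries m l₁) (entries n l₂) := by
  rw [← entries_append_castAdd l₂ h, ← entries_append_natAdd l₂ h]
  exact (Fin.append_castAdd_natAdd).symm

theorem entries_cast {m n : ℕ} (h : m = n) (l : List A) :
    entries n l ∘ Fin.cast h = entries m l := rfl

/-- The placeholder 0 makes a list with one varying entry an update of a fixed tuple, which is the
form in which multilinearity applies. -/
theorem entries_eq_update {n : ℕ} (l₁ l₂ : List A) (x : A) (h : l₁.length < n) :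
    entries n (l₁ ++ x :: l₂) =
      Function.update (entries n (l₁ ++ 0 :: l₂)) ⟨l₁.length, h⟩ x := by
  funext i
  by_cases hi : i = ⟨l₁.length, h⟩
  · subst hi
    simp [entries]
  · rw [Function.update_of_ne hi]
    have hi' : (i : ℕ) ≠ l₁.length := fun e => hi (Fin.ext e)
    rcases lt_or_gt_of_ne hi' with h' | h'
    · simp only [entries, List.getD_eq_getElem?_getD]
      rw [List.getElem?_append_left h', List.getElem?_append_left h']
    · obtain ⟨j, hj⟩ : ∃ j, (i : ℕ) = l₁.length + (j + 1) := ⟨i - l₁.length - 1, by omega⟩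
      simp only [entries, List.getD_eq_getElem?_getD, hj]
      rw [List.getElem?_append_right (by omega), List.getElem?_append_right (by omega)]
      simp

theorem entries_eq_of_mem {n : ℕ} {l : List A} (h : l.length = n) {x : A} (hx : x ∈ l) :
    ∃ i, entries n l i = x := by
  obtain ⟨i, hi, rfl⟩ := List.getElem_of_mem hx
  exact ⟨⟨i, h ▸ hi⟩, by simp [entries, hi]⟩

end

variable {k A M : Type*} [Field k] [Ring A] [Algebra k A] [AddCommGroup M] [Module k M]

/-- The value of a multilinear map on the first entries of a list. -/
def onList {n : ℕ} (f : MultilinearMap k (fun _ : Fin n => A) M) (l : List A) : M :=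
  f (entries n l)

theorem onList_ofFn {n : ℕ} (f : MultilinearMap k (fun _ : Fin n => A) M) (a : Fin n → A) :
    onList f (List.ofFn a) = f a := by
  rw [onList, entries_ofFn]

theorem multilinear_ext_list {n : ℕ} {f g : MultilinearMap k (fun _ : Fin n => A) M}
    (h : ∀ l : List A, l.length = n → onList f l = onList g l) : f = g :=
  MultilinearMap.ext fun a => by simpa [onList_ofFn] using h (List.ofFn a) (by simp)

theorem onList_curryLeft {n : ℕ} (f : MultilinearMap k (fun _ : Fin (n + 1) => A) M) (x : A)
    (l : List A) : onList (n := n) (f.curryLeft x) l = onList f (x :: l) := by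
  rw [onList, onList, entries_cons]; rfl

/-- The linear map obtained by varying one entry of the list. -/
theorem exists_linear_onList {n : ℕ} (f : MultilinearMap k (fun _ : Fin n => A) M)
    (l₁ l₂ : List A) (h : l₁.length < n) :
    ∃ L : A →ₗ[k] M, ∀ x, onList f (l₁ ++ x :: l₂) = L x :=
  ⟨f.toLinearMap (entries n (l₁ ++ 0 :: l₂)) ⟨l₁.length, h⟩, fun x => by
    rw [onList, entries_eq_update l₁ l₂ x h]; rfl⟩

theorem exists_linear_onList_cons {n : ℕ} (f : MultilinearMap k (fun _ : Fin (n + 1) => A) M)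
    (l : List A) : ∃ L : A →ₗ[k] M, ∀ x, onList f (x :: l) = L x :=
  exists_linear_onList f [] l (Nat.succ_pos n)

theorem onList_eq_zero_of_mem {n : ℕ} (f : MultilinearMap k (fun _ : Fin n => A) M)
    {l : List A} (hl : l.length = n) (h : (0 : A) ∈ l) : onList f l = 0 := by
  obtain ⟨i, hi⟩ := entries_eq_of_mem hl h
  exact f.map_coord_zero i hi

/-- The chain `a₀ ⊗ ā₁ ⊗ ⋯ ⊗ ā_p` given by a list of entries. -/
def chainOfList (k : Type*) {A : Type*} [Field k] [Ring A] [Algebra k A] (p : ℕ) (l : List A) :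
    Chain k A p := onList (chainMk k A p) l

theorem chain_hom_ext_list {p : ℕ} {f g : Chain k A p →ₗ[k] M}
    (h : ∀ (a : A) (l : List A), l.length = p →
      f (chainOfList k p (a :: l)) = g (chainOfList k p (a :: l))) : f = g :=
  chain_hom_ext fun a => by
    have := h (a 0) (List.ofFn (Fin.tail a)) (by simp)
    rwa [show a 0 :: List.ofFn (Fin.tail a) = List.ofFn a by rw [List.ofFn_succ]; rfl, chainOfList,
      onList_ofFn] at this

theorem exists_linear_chainOfList (p : ℕ) (l₁ l₂ : List A) (h : l₁.length < p + 1) :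
    ∃ L : A →ₗ[k] Chain k A p, ∀ x, chainOfList k p (l₁ ++ x :: l₂) = L x :=
  exists_linear_onList _ l₁ l₂ h

/-- The alternating sum of the terms `F (a₁, …, a_j a_{j+1}, …, a_r)`, followed by
`T (a₁, …, a_{r-1}) a_r`. -/
def contractSum {A M : Type*} [Mul A] [AddCommGroup M] :
    (List A → M) → (List A → A → M) → List A → M
  | _, _, [] => 0
  | _, T, [x] => T [] x
  | F, T, x :: y :: l =>
    F (x * y :: l) - contractSum (fun t => F (x :: t)) (fun t => T (x :: t)) (y :: l)

section

variable {A M N : Type*} [Mul A] [AddCommGroup M] [AddCommGroup N]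

@[simp] theorem contractSum_nil (F : List A → M) (T : List A → A → M) :
    contractSum F T [] = 0 := rfl

@[simp] theorem contractSum_singleton (F : List A → M) (T : List A → A → M) (x : A) :
    contractSum F T [x] = T [] x := rfl

theorem contractSum_cons_cons (F : List A → M) (T : List A → A → M) (x y : A) (l : List A) :
    contractSum F T (x :: y :: l) = F (x * y :: l) -
      contractSum (fun t => F (x :: t)) (fun t => T (x :: t)) (y :: l) := rfl

theorem contractSum_congr {F F' : List A → M} {T T' : List A → A → M} {l : List A}
    (hF : ∀ t, t.length + 1 = l.length → F t = F' t)
    (hT : ∀ t x, t.length + 1 = l.length → T t x = T' t x) :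
    contractSum F T l = contractSum F' T' l := by
  induction l generalizing F F' T T' with
  | nil => rfl
  | cons x l ih =>
    cases l with
    | nil => exact hT _ _ rfl
    | cons y l =>
      rw [contractSum_cons_cons, contractSum_cons_cons, hF _ (by simp)]
      congr 1
      exact ih (fun t ht => hF _ (by simpa using ht)) (fun t z ht => hT _ _ (by simpa using ht))

/-- The contractions split at `y`: those inside `l₁`, together with the one merging the end of `l₁`
into `y`, which plays the role of the final term; then those from `y` onwards, with the sign
accumulated by passing `l₁`. Both Leibniz rules are instances of this cut. -/
theorem contractSum_append (F : List A → M) (T : List A → A → M) (l₁ : List A) (y : A)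
    (l₂ : List A) : contractSum F T (l₁ ++ y :: l₂) =
      contractSum (fun t => F (t ++ y :: l₂)) (fun t x => F (t ++ x * y :: l₂)) l₁ +
        (-1 : ℤ) ^ l₁.length •
          contractSum (fun t => F (l₁ ++ t)) (fun t => T (l₁ ++ t)) (y :: l₂) := by
  induction l₁ generalizing F T with
  | nil => simp
  | cons x l ih =>
    cases l with
    | nil => simp [contractSum_cons_cons, sub_eq_add_neg]
    | cons z l =>
      have := ih (fun t => F (x :: t)) (fun t => T (x :: t))
      simp only [List.cons_append, contractSum_cons_cons, List.length_cons, pow_succ] at this ⊢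
      rw [this]
      simp only [neg_smul, neg_neg, mul_neg, mul_one]
      abel

theorem contractSum_snoc (F : List A → M) (T : List A → A → M) (l : List A) (y : A) :
    contractSum F T (l ++ [y]) =
      contractSum (fun t => F (t ++ [y])) (fun t x => F (t ++ [x * y])) l +
        (-1 : ℤ) ^ l.length • T l y := by
  rw [contractSum_append]; simp

theorem map_contractSum (L : M →+ N) (F : List A → M) (T : List A → A → M) (l : List A) :
    L (contractSum F T l) = contractSum (fun t => L (F t)) (fun t x => L (T t x)) l := by
  induction l generalizing F T with
  | nil => simp
  | cons x l ih =>
    cases l with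
    | nil => rfl
    | cons y l => rw [contractSum_cons_cons, contractSum_cons_cons, map_sub, ih]

theorem sum_contractSum {ι : Type*} (s : Finset ι) (F : ι → List A → M) (T : ι → List A → A → M)
    (l : List A) : ∑ i ∈ s, contractSum (F i) (T i) l =
      contractSum (fun t => ∑ i ∈ s, F i t) (fun t x => ∑ i ∈ s, T i t x) l := by
  induction l generalizing F T with
  | nil => simp
  | cons x l ih =>
    cases l with
    | nil => rfl
    | cons y l => simp only [contractSum_cons_cons, Finset.sum_sub_distrib, ih]

theorem contractSum_sub (F F' : List A → M) (T T' : List A → A → M) (l : List A) :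
    contractSum (fun t => F t - F' t) (fun t x => T t x - T' t x) l =
      contractSum F T l - contractSum F' T' l := by
  induction l generalizing F F' T T' with
  | nil => simp
  | cons x l ih =>
    cases l with
    | nil => rfl
    | cons y l =>
      simp only [contractSum_cons_cons, ih]
      abel

/-- Used on paths, where two adjacent arrows multiply to zero and only the last term survives. -/
theorem contractSum_eq_of_contract_eq_zero (F : List A → M) (T : List A → A → M)
    (l : List A) (y : A) (hF : ∀ l₁ x z l₂, l ++ [y] = l₁ ++ x :: z :: l₂ → F (l₁ ++ x * z :: l₂) = 0) :
    contractSum F T (l ++ [y]) = (-1 : ℤ) ^ l.length • T l y := by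
  induction l generalizing F T with
  | nil => simp
  | cons x l ih =>
    have := ih (fun t => F (x :: t)) (fun t => T (x :: t))
      (fun l₁ u v l₂ h => hF (x :: l₁) u v l₂ (by rw [List.cons_append, h]; rfl))
    cases l with
    | nil =>
      have h := hF [] x y [] rfl
      simp only [List.nil_append] at h
      simp [contractSum_cons_cons, h]
    | cons z l =>
      have h := hF [] x z (l ++ [y]) rfl
      simp only [List.nil_append] at h
      simp only [List.cons_append, contractSum_cons_cons, h] at this ⊢
      rw [this]
      simp [pow_succ]

end

theorem contractNth_succ {n : ℕ} {B : Type*} (op : B → B → B) (x : B) (b : Fin (n + 1) → B)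
    (j : Fin (n + 1)) :
    Fin.contractNth j.succ op (Fin.cons x b : Fin (n + 2) → B) =
      Fin.cons x (Fin.contractNth j op b) := by
  funext i
  refine Fin.cases ?_ (fun i => ?_) i
  · simp [Fin.contractNth]
  · simp only [Fin.contractNth, Fin.cons_succ, Fin.val_succ, add_lt_add_iff_right,
      add_left_inj, ← Fin.succ_castSucc]

theorem contractNth_zero {n : ℕ} {B : Type*} (op : B → B → B) (x y : B) (b : Fin n → B) :
    Fin.contractNth 0 op (Fin.cons x (Fin.cons y b) : Fin (n + 2) → B) =
      Fin.cons (op x y) b := by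
  funext i
  refine Fin.cases ?_ (fun i => ?_) i
  · simp only [Fin.contractNth, Fin.cons_zero]
    simp
  · simp [Fin.contractNth]

/-- Bridge from sums over `Fin.contractNth` to the recursion on lists. The sign starts at +1 for the
first contraction, so `contractSum` enters both δ and ∂ with a minus sign. -/
theorem sum_contractNth {A : Type*} [Ring A] {r : ℕ} (G : (Fin r → A) → M) (T : (Fin r → A) → A → M) (l : List A)
    (hl : l.length = r + 1) :
    ∑ j : Fin r, (-1 : k) ^ (j : ℕ) •
        G (Fin.contractNth j.castSucc (· * ·) (entries (r + 1) l)) +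
      (-1 : k) ^ r • T (Fin.init (entries (r + 1) l)) (entries (r + 1) l (Fin.last r)) =
      contractSum (fun t => G (entries r t)) (fun t => T (entries r t)) l := by
  induction r generalizing l with
  | zero =>
    obtain ⟨x, rfl⟩ := List.length_eq_one_iff.1 hl
    simp only [Finset.univ_eq_empty, Finset.sum_empty, pow_zero, one_smul, zero_add,
      contractSum_singleton]
    congr 1
    exact Subsingleton.elim _ _
  | succ r ih =>
    match l, hl with
    | x :: y :: l, hl =>
      have := ih (fun b => G (Fin.cons x b)) (fun b => T (Fin.cons x b)) (y :: l) (by simpa using hl)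
      rw [contractSum_cons_cons]
      simp only [entries_cons] at this ⊢
      rw [← this, Fin.sum_univ_succ, Fin.castSucc_zero, contractNth_zero]
      have h1 : ∀ j : Fin r, Fin.contractNth j.succ.castSucc (fun x y : A => x * y)
          (Fin.cons x (Fin.cons y (entries r l)) : Fin (r + 2) → A) =
          Fin.cons x (Fin.contractNth j.castSucc (fun x y : A => x * y)
            (Fin.cons y (entries r l) : Fin (r + 1) → A)) := fun j => by
        rw [← Fin.succ_castSucc, contractNth_succ]
      have h2 : Fin.init (α := fun _ => A) (Fin.cons x (Fin.cons y (entries r l))) =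
          Fin.cons x (Fin.init (α := fun _ => A) (Fin.cons y (entries r l))) := by
        funext i
        refine Fin.cases ?_ (fun i => ?_) i
        · simp [Fin.init]
        · simp [Fin.init]
      have h3 : (Fin.cons x (Fin.cons y (entries r l)) : Fin (r + 2) → A) (Fin.last (r + 1)) =
          (Fin.cons y (entries r l) : Fin (r + 1) → A) (Fin.last r) := by
        rw [← Fin.succ_last, Fin.cons_succ]
      rw [h2, h3]
      simp only [h1, Fin.val_zero, pow_zero, one_smul, Fin.val_succ, pow_succ, mul_neg_one, neg_smul,
        Finset.sum_neg_distrib]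
      abel

theorem onList_deltaMultilinear {r : ℕ} (f : MultilinearMap k (fun _ : Fin r => A) A) (x : A)
    (l : List A) (hl : l.length = r) :
    onList (deltaMultilinear f) (x :: l) =
      x * onList f l - contractSum (onList f) (fun t y => onList f t * y) (x :: l) := by
  have := sum_contractNth (k := k) f (fun t y => f t * y) (x :: l) (by simpa using hl)
  change _ = _ - contractSum (fun t => f (entries r t)) (fun t y => f (entries r t) * y) (x :: l)
  rw [← this]
  simp only [onList, deltaMultilinear, leftMul, rightMul, add_apply,
    smul_apply, mkMultilinear_apply, sum_apply, pull_apply, pow_succ,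
    mul_neg_one, neg_smul, Finset.sum_neg_distrib]
  simp only [entries_cons, Fin.tail_cons, Fin.cons_zero]
  abel

variable {ι : Type*} [Fintype ι] [DecidableEq ι] (F : FrobeniusData k A ι)

theorem boundary_chainOfList {p : ℕ} (a b : A) (l : List A) (hl : l.length = p) :
    boundary F p (chainOfList k (p + 1) (a :: b :: l)) =
      chainOfList k p (a * F.nakayamaInv b :: l) -
        contractSum (fun t => chainOfList k p (a :: t)) (fun t y => chainOfList k p (y * a :: t))
          (b :: l) := by
  have := sum_contractNth (k := k) (fun t => chainMk k A p (Fin.cons a t))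
    (fun t y => chainMk k A p (Fin.cons (y * a) t)) (b :: l) (by simpa using hl)
  simp only [chainOfList, onList, boundary, chainLift_chainMk, sum_apply,
    smul_apply, pull_apply]
  simp only [entries_cons] at this ⊢
  rw [← this, Fin.sum_univ_succ, Fin.sum_univ_castSucc]
  have h0 : chainFace F 0 (Fin.cons a (Fin.cons b (entries p l))) =
      Fin.cons (a * F.nakayamaInv b) (entries p l) := by
    rw [chainFace, if_pos rfl, contractNth_zero]
  have h1 : ∀ j : Fin p, chainFace F j.castSucc.succ (Fin.cons a (Fin.cons b (entries p l))) =
      Fin.cons a (Fin.contractNth j.castSucc (· * ·) (Fin.cons b (entries p l))) := fun j => by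
    rw [chainFace, if_neg (Fin.succ_ne_zero _), if_neg, contractNth_succ]
    rw [← Fin.succ_last]
    exact fun e => Fin.castSucc_ne_last j (Fin.succ_injective _ e)
  have h2 : chainFace F (Fin.last p).succ (Fin.cons a (Fin.cons b (entries p l))) =
      Fin.cons ((Fin.cons b (entries p l) : Fin (p + 1) → A) (Fin.last p) * a)
        (Fin.init (α := fun _ => A) (Fin.cons b (entries p l))) := by
    rw [chainFace, if_neg (Fin.succ_ne_zero _), if_pos (Fin.succ_last p), ← Fin.succ_last]
    funext i
    refine Fin.cases ?_ (fun i => ?_) i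
    · simp
    · simp [Fin.init]
  simp only [h0, h1, h2, Fin.val_zero, pow_zero, one_smul, Fin.val_succ, pow_succ, mul_neg_one,
    neg_smul, Finset.sum_neg_distrib, Fin.val_castSucc, Fin.val_last]
  abel

end ListTuples

/-! ### Nakayama and Casimir identities for dual bases -/

section FrobeniusLemmas

variable {k A ι : Type*} [Field k] [Ring A] [Algebra k A] [Fintype ι] [DecidableEq ι]
  (F : FrobeniusData k A ι) {M : Type*} [AddCommGroup M] [Module k M]

namespace FrobeniusData

theorem sum_form_v_smul_u (x : A) : ∑ i, F.form (F.v i) x • F.u i = x := by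
  have H : ∑ i, (F.form (F.v i)).smulRight (F.u i) = LinearMap.id := by
    refine F.u.ext fun j => ?_
    simp [F.dual]
  simpa using LinearMap.congr_fun H x

theorem form_right_ext {x y : A} (h : ∀ z, F.form z x = F.form z y) : x = y := by
  rw [← F.sum_form_v_smul_u x, ← F.sum_form_v_smul_u y]
  simp only [h]

theorem form_left_ext {x y : A} (h : ∀ z, F.form x z = F.form y z) : x = y := by
  rw [← F.sum_form_u_smul_v x, ← F.sum_form_u_smul_v y]
  simp only [h]

theorem form_nakayama (x y : A) : F.form y (F.nakayama x) = F.form x y := by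
  have H : F.form.flip (F.nakayama x) = F.form x := by
    refine F.v.ext fun j => ?_
    simp [nakayama_apply, F.dual]
  exact LinearMap.congr_fun H y

theorem form_nakayamaInv (x y : A) : F.form (F.nakayamaInv x) y = F.form y x := by
  have H : F.form (F.nakayamaInv x) = F.form.flip x := by
    refine F.u.ext fun j => ?_
    simp [nakayamaInv_apply, F.dual]
  exact LinearMap.congr_fun H y

theorem nakayama_nakayamaInv (x : A) : F.nakayama (F.nakayamaInv x) = x :=
  F.form_right_ext fun z => by rw [form_nakayama, form_nakayamaInv]

theorem nakayama_mul (x y : A) : F.nakayama (x * y) = F.nakayama x * F.nakayama y :=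
  F.form_right_ext fun z => by
    rw [form_nakayama, F.assoc, ← form_nakayama, F.assoc, ← form_nakayama F y, F.assoc]

/-- The element `∑ i, u i ⊗ v i` commutes with the elements of `A`. -/
theorem sum_mul_u (B : A →ₗ[k] A →ₗ[k] M) (a : A) :
    ∑ i, B (a * F.u i) (F.v i) = ∑ i, B (F.u i) (F.v i * a) := by
  have h1 : ∀ i, B (a * F.u i) (F.v i) =
      ∑ j, F.form (F.v j) (a * F.u i) • B (F.u j) (F.v i) := fun i => by
    conv_lhs => rw [← F.sum_form_v_smul_u (a * F.u i)]
    simp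
  have h2 : ∀ j, B (F.u j) (F.v j * a) =
      ∑ i, F.form (F.v j * a) (F.u i) • B (F.u j) (F.v i) := fun j => by
    conv_lhs => rw [← F.sum_form_u_smul_v (F.v j * a)]
    simp
  simp only [h1, h2]
  rw [Finset.sum_comm]
  simp only [F.assoc]

/-- An arbitrary bilinear `B` stands for the tensor product, so this says ∑ uᵢ ν(a) ⊗ vᵢ = ∑ uᵢ ⊗ a
vᵢ. Expanding in the dual bases, both sides have the same coefficients because ⟨v, u ν(a)⟩ = ⟨a, v
u⟩ = ⟨a v, u⟩. -/
theorem sum_u_mul_nakayama (B : A →ₗ[k] A →ₗ[k] M) (a : A) :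
    ∑ i, B (F.u i * F.nakayama a) (F.v i) = ∑ i, B (F.u i) (a * F.v i) := by
  have h1 : ∀ i, B (F.u i * F.nakayama a) (F.v i) =
      ∑ j, F.form (F.v j) (F.u i * F.nakayama a) • B (F.u j) (F.v i) := fun i => by
    conv_lhs => rw [← F.sum_form_v_smul_u (F.u i * F.nakayama a)]
    simp
  have h2 : ∀ j, B (F.u j) (a * F.v j) =
      ∑ i, F.form (a * F.v j) (F.u i) • B (F.u j) (F.v i) := fun j => by
    conv_lhs => rw [← F.sum_form_u_smul_v (a * F.v j)]
    simp
  simp only [h1, h2]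
  rw [Finset.sum_comm]
  refine Finset.sum_congr rfl fun j _ => Finset.sum_congr rfl fun i _ => ?_
  rw [← F.assoc, form_nakayama, F.assoc]

/-- Both sides expand to ∑ ⟨uⱼ, uᵢ⟩ vᵢ ⊗ vⱼ. This exchanges the roles of the two bases in the
Casimir element. -/
theorem sum_v_nakayamaInv_u (B : A →ₗ[k] A →ₗ[k] M) :
    ∑ i, B (F.v i) (F.nakayamaInv (F.u i)) = ∑ i, B (F.u i) (F.v i) := by
  have h1 : ∀ i, B (F.v i) (F.nakayamaInv (F.u i)) =
      ∑ j, F.form (F.u j) (F.u i) • B (F.v i) (F.v j) := fun i => by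
    simp [nakayamaInv_apply]
  have h2 : ∀ j, B (F.u j) (F.v j) = ∑ i, F.form (F.u j) (F.u i) • B (F.v i) (F.v j) := fun j => by
    conv_lhs => rw [← F.sum_form_u_smul_v (F.u j)]
    simp
  simp only [h1, h2]
  rw [Finset.sum_comm]

end FrobeniusData

end FrobeniusLemmas

/-! ### Duality between cochains and chains -/

section Pairing

variable {k A ι : Type*} [Field k] [Ring A] [Algebra k A] [Fintype ι] [DecidableEq ι]
  (F : FrobeniusData k A ι)

theorem chain_induction {p : ℕ} {motive : Chain k A p → Prop}
    (mk : ∀ (a : A) (l : List A), l.length = p → motive (chainOfList k p (a :: l)))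
    (add : ∀ x y, motive x → motive y → motive (x + y)) (x : Chain k A p) : motive x := by
  obtain ⟨x, rfl⟩ := Submodule.mkQ_surjective _ x
  induction x using PiTensorProduct.induction_on with
  | smul_tprod r a =>
    -- The scalar is absorbed into a₀, so the induction principle needs no case for scalar
    -- multiples.
    have h : (degenerate k A p).mkQ (r • PiTensorProduct.tprod k a) =
        chainOfList k p (r • a 0 :: List.ofFn (Fin.tail a)) := by
      rw [chainOfList, onList, entries_cons, entries_ofFn, map_smul]
      have := (chainMk k A p).map_update_smul a 0 r (a 0)
      rw [Function.update_eq_self] at this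
      refine this.symm.trans ?_
      congr 1
      funext i
      refine Fin.cases ?_ (fun i => ?_) i
      · simp
      · simp [Fin.tail]
    rw [h]
    exact mk _ _ (by simp)
  | add x y hx hy => rw [map_add]; exact add _ _ hx hy

/-- The pairing `⟨f, a₀ ⊗ ā₁ ⊗ ⋯ ⊗ ā_p⟩ = ⟨f(a₁, …, a_p), a₀⟩` of cochains and chains. -/
noncomputable def pairingSelf (p : ℕ) : Cochain k A p →ₗ[k] Chain k A p →ₗ[k] k where
  toFun f := chainLift (LinearMap.uncurryLeft (M := fun _ : Fin (p + 1) => A)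
      { toFun := fun x => (F.form.flip x).compMultilinearMap f.1
        map_add' := fun x y => MultilinearMap.ext fun a => by simp
        map_smul' := fun c x => MultilinearMap.ext fun a => by simp })
    (fun a i hi ha => by
      obtain ⟨i, rfl⟩ := Fin.exists_succ_eq.2 hi
      simp only [LinearMap.uncurryLeft_apply, LinearMap.coe_mk, AddHom.coe_mk,
        LinearMap.compMultilinearMap_apply]
      rw [f.2 _ i ha, map_zero])
  map_add' f g := chain_hom_ext fun a => by simp
  map_smul' c f := chain_hom_ext fun a => by simp

/-- The pairing of cochains and chains whose degrees are equal. -/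
noncomputable def pairing {m p : ℕ} (h : m = p) : Cochain k A m →ₗ[k] Chain k A p →ₗ[k] k :=
  h ▸ pairingSelf F m

theorem pairing_chainOfList {m p : ℕ} (h : m = p) (f : Cochain k A m) (a : A) (l : List A) :
    pairing F h f (chainOfList k p (a :: l)) = F.form (onList f.1 l) a := by
  subst h
  simp only [pairing, pairingSelf, LinearMap.coe_mk, AddHom.coe_mk, chainOfList, onList,
    entries_cons]
  rw [chainLift_chainMk, LinearMap.uncurryLeft_apply]
  simp

theorem cochain_ext_list {m : ℕ} {f g : Cochain k A m}
    (h : ∀ l : List A, l.length = m → onList f.1 l = onList g.1 l) : f = g :=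
  Subtype.ext (multilinear_ext_list h)

theorem cochain_eq_of_pairing {m p : ℕ} (h : m = p) {f g : Cochain k A m}
    (H : ∀ x, pairing F h f x = pairing F h g x) : f = g :=
  cochain_ext_list fun l _ => F.form_left_ext fun z => by
    rw [← pairing_chainOfList F h, ← pairing_chainOfList F h, H]

/-- The cochain is f(l) = ∑ λ(uᵢ ⊗ l) vᵢ, and expanding a₀ in the basis u recovers λ. Normalization
of f is exactly the vanishing of λ on degenerate tensors. -/
theorem exists_pairing_eq {p : ℕ} (lam : Chain k A p →ₗ[k] k) :
    ∃ f : Cochain k A p, pairing F rfl f = lam := by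
  refine ⟨⟨∑ i, ((lam.compMultilinearMap (chainMk k A p)).curryLeft (F.u i)).smulRight (F.v i),
    fun a j hj => ?_⟩, chain_hom_ext_list fun a l hl => ?_⟩
  · simp only [sum_apply, MultilinearMap.smulRight_apply, MultilinearMap.curryLeft_apply,
      LinearMap.compMultilinearMap_apply]
    refine Finset.sum_eq_zero fun i _ => ?_
    rw [chainMk_eq_zero _ j.succ (Fin.succ_ne_zero j) (by simpa using hj), map_zero, zero_smul]
  · rw [pairing_chainOfList]
    obtain ⟨L, hL⟩ := exists_linear_chainOfList (k := k) p [] l (by simp)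
    simp only [List.nil_append] at hL
    have h1 : ∀ i, lam (chainMk k A p (Fin.cons (F.u i) (entries p l))) = lam (L (F.u i)) :=
      fun i => by rw [← hL, chainOfList, onList, entries_cons]
    simp only [onList, sum_apply, MultilinearMap.smulRight_apply, MultilinearMap.curryLeft_apply,
      LinearMap.compMultilinearMap_apply, map_sum, map_smul, LinearMap.sum_apply,
      LinearMap.smul_apply]
    simp only [h1, hL, smul_eq_mul]
    conv_rhs => rw [← F.sum_form_v_smul_u a]
    simp [mul_comm]

theorem chain_eq_zero_of_pairing {p : ℕ} {x : Chain k A p}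
    (H : ∀ f : Cochain k A p, pairing F rfl f x = 0) : x = 0 := by
  refine (Module.forall_dual_apply_eq_zero_iff k x).1 fun lam => ?_
  obtain ⟨f, rfl⟩ := exists_pairing_eq F lam
  exact H f

theorem onList_delta {r : ℕ} (f : Cochain k A r) (x : A) (l : List A) (hl : l.length = r) :
    onList (delta k A r f).1 (x :: l) =
      x * onList f.1 l - contractSum (onList f.1) (fun t y => onList f.1 t * y) (x :: l) :=
  onList_deltaMultilinear f.1 x l hl

/-- The inner faces match term by term and the last one matches by associativity of the form. For
the first, ⟨b f(l), a⟩ = ⟨f(l) a, ν(b)⟩ = ⟨f(l), a ν(b)⟩, while ∂ carries ν⁻¹(b); this is where ν⁻¹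
= ν is needed. -/
theorem pairing_delta (hν : ∀ x, F.nakayamaInv x = F.nakayama x) {r p : ℕ} (h : r = p)
    (f : Cochain k A r) (x : Chain k A (p + 1)) :
    pairing F (congrArg (· + 1) h) (delta k A r f) x = pairing F h f (boundary F p x) := by
  subst h
  induction x using chain_induction with
  | mk a l hl =>
    match l, hl with
    | b :: l, hl =>
      simp only [List.length_cons, add_left_inj] at hl
      rw [boundary_chainOfList F _ _ _ hl, pairing_chainOfList, onList_delta f _ _ hl, map_sub,
        map_sub, LinearMap.sub_apply, pairing_chainOfList, hν, ← F.assoc, F.form_nakayama,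
        F.assoc]
      congr 1
      have h1 := map_contractSum (F.form.flip a).toAddMonoidHom (onList f.1)
        (fun t y => onList f.1 t * y) (b :: l)
      have h2 := map_contractSum (pairing F rfl f).toAddMonoidHom (fun t => chainOfList k r (a :: t))
        (fun t y => chainOfList k r (y * a :: t)) (b :: l)
      simp only [LinearMap.toAddMonoidHom_coe, LinearMap.flip_apply, pairing_chainOfList] at h1 h2
      rw [h1, h2]
      simp only [F.assoc]
  | add x y hx hy => rw [map_add, map_add, map_add, hx, hy]

end Pairing

/-! ### The star products evaluated on lists -/

section StarLists

variable {k A ι : Type*} [Field k] [Ring A] [Algebra k A] [Fintype ι] [DecidableEq ι]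
  (F : FrobeniusData k A ι)

theorem onList_cup {m n : ℕ} (f : Cochain k A m) (g : Cochain k A n) (l₁ l₂ : List A)
    (h : l₁.length = m) : onList (cup f g).1 (l₁ ++ l₂) = onList f.1 l₁ * onList g.1 l₂ := by
  simp only [onList, cup, mkMultilinear_apply]
  rw [entries_append_castAdd l₂ h, entries_append_natAdd l₂ h]

theorem starChainCochain_chainOfList {m q : ℕ} (f : Cochain k A m) (a : A) (l₁ l₂ : List A)
    (h : l₁.length = m) : starChainCochain F f (chainOfList k (m + q) (a :: (l₁ ++ l₂))) =
      chainOfList k q (a * F.nakayamaInv (onList f.1 l₁) :: l₂) := by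
  simp only [starChainCochain, chainOfList, onList, chainLift_chainMk, pull_apply, entries_cons,
    chainCochainTuple, Fin.cons_zero, Fin.cons_succ]
  rw [entries_append_castAdd l₂ h, entries_append_natAdd l₂ h]

theorem starCochainChain_chainOfList {m q : ℕ} (f : Cochain k A m) (a : A) (l₁ l₂ : List A)
    (h : l₁.length = q) : starCochainChain f (chainOfList k (q + m) (a :: (l₁ ++ l₂))) =
      chainOfList k q (onList f.1 l₂ * a :: l₁) := by
  simp only [starCochainChain, chainOfList, onList, chainLift_chainMk, pull_apply, entries_cons,
    cochainChainTuple, Fin.cons_zero, Fin.cons_succ]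
  rw [entries_append_castAdd l₂ h, entries_append_natAdd l₂ h]

theorem appendTuple_entries {n p : ℕ} (x a : A) (b l : List A) (h : b.length = n) :
    appendTuple F x (entries n b) (entries (p + 1) (a :: l)) =
      entries (n + (p + 1)) (b ++ (x * F.nakayama a) :: l) := by
  rw [entries_append _ h, appendTuple, entries_cons, entries_cons, Fin.cons_zero,
    Fin.update_cons_zero]

theorem onList_starCochainChain' {n p : ℕ} (f : Cochain k A (n + (p + 1))) (a : A)
    (b l : List A) (h : b.length = n) :
    onList (starCochainChain' F f (chainOfList k p (a :: l))).1 b =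
      ∑ i, onList f.1 (b ++ (F.u i * F.nakayama a) :: l) * F.v i := by
  simp only [starCochainChain', chainOfList, onList, chainLift_chainMk, mkMultilinear_apply,
    sum_apply, LinearMap.compMultilinearMap_apply, pull_apply, appendTuple_entries F _ _ _ _ h,
    LinearMap.mulRight_apply]

theorem onList_starChainCochain' {n p : ℕ} (f : Cochain k A (p + 1 + n)) (a : A)
    (b l : List A) (h : l.length = p) :
    onList (starChainCochain' F f (chainOfList k p (a :: l))).1 b =
      ∑ i, F.u i * F.nakayama a * onList f.1 (l ++ F.v i :: b) := by
  have : ∀ x, snocTuple x (entries n b) (entries p l) = entries (p + 1 + n) (l ++ x :: b) := by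
    intro x
    have h1 : l ++ x :: b = (l ++ [x]) ++ b := by simp
    rw [h1, entries_append _ (by simp [h]), entries_append _ h, snocTuple, Fin.snoc_eq_append]
    congr 2
    funext i
    obtain rfl : i = 0 := Fin.fin_one_eq_zero i
    rfl
  simp only [starChainCochain', chainOfList, onList, chainLift_chainMk, mkMultilinear_apply,
    sum_apply, LinearMap.compMultilinearMap_apply, pull_apply, LinearMap.mulLeft_apply,
    entries_cons, Fin.cons_zero, Fin.tail_cons, this]

theorem starChainChain_chainOfList {p q : ℕ} (a b : A) (l l' : List A) (h : l'.length = q) :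
    starChainChain F p q (chainOfList k p (a :: l)) (chainOfList k q (b :: l')) =
      ∑ i, chainOfList k (p + q + 1) (F.v i * b :: (l' ++ (F.u i * F.nakayama a) :: l)) := by
  have : ∀ x y, chainChainTuple F x y (entries (q + 1) (b :: l')) (entries (p + 1) (a :: l)) =
      entries (p + q + 1 + 1) (y * b :: (l' ++ (x * F.nakayama a) :: l)) := by
    intro x y
    rw [← entries_cast (show p + q + 1 + 1 = q + 1 + (p + 1) by omega), ← List.cons_append,
      ← appendTuple_entries F x a (y * b :: l') l (by simp [h]), chainChainTuple,
      entries_cons q, entries_cons q, Fin.cons_zero, Fin.update_cons_zero]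
  simp only [starChainChain, chainOfList, onList, chainLift_chainMk, mkMultilinear_apply,
    sum_apply, pull_apply, this]

end StarLists

/-! ### Every mixed product as a transpose -/

section Adjunctions

variable {k A ι : Type*} [Field k] [Ring A] [Algebra k A] [Fintype ι] [DecidableEq ι]
  (F : FrobeniusData k A ι)

/-- Degrees such as m + 1 + n and m + n + 1 give different types of cochains; values on lists
compare them without transport. -/
theorem pairing_congr {m m' p : ℕ} (h : m = p) (h' : m' = p) {f : Cochain k A m}
    {f' : Cochain k A m'} (H : ∀ l : List A, l.length = p → onList f.1 l = onList f'.1 l)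
    (x : Chain k A p) : pairing F h f x = pairing F h' f' x := by
  induction x using chain_induction with
  | mk a l hl => rw [pairing_chainOfList, pairing_chainOfList, H l hl]
  | add x y hx hy => rw [map_add, map_add, hx, hy]

theorem exists_append_of_length {A : Type*} {m n : ℕ} (l : List A) (h : l.length = m + n) :
    ∃ l₁ l₂ : List A, l₁.length = m ∧ l₂.length = n ∧ l = l₁ ++ l₂ :=
  ⟨l.take m, l.drop m, by simp [h], by simp [h], (List.take_append_drop m l).symm⟩

/-- Associativity of the form moves f(a_{q+1}, …, a_p) from the front of a₀ to the right of the
value of g. -/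
theorem pairing_starCochainChain {m q : ℕ} (f : Cochain k A m) (g : Cochain k A q)
    (x : Chain k A (q + m)) :
    pairing F rfl g (starCochainChain f x) = pairing F rfl (cup g f) x := by
  induction x using chain_induction with
  | mk a l hl =>
    obtain ⟨l₁, l₂, h₁, -, rfl⟩ := exists_append_of_length l hl
    rw [starCochainChain_chainOfList f a _ _ h₁, pairing_chainOfList, pairing_chainOfList,
      onList_cup g f _ _ h₁, F.assoc]
  | add x y hx hy => simp only [map_add, hx, hy]

theorem pairing_starChainCochain (hν : ∀ x, F.nakayamaInv x = F.nakayama x) {m q : ℕ}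
    (f : Cochain k A m) (g : Cochain k A q) (x : Chain k A (m + q)) :
    pairing F rfl g (starChainCochain F f x) = pairing F rfl (cup f g) x := by
  induction x using chain_induction with
  | mk a l hl =>
    obtain ⟨l₁, l₂, h₁, -, rfl⟩ := exists_append_of_length l hl
    rw [starChainCochain_chainOfList F f a _ _ h₁, pairing_chainOfList, pairing_chainOfList,
      onList_cup f g _ _ h₁, hν, ← F.assoc, F.form_nakayama, F.assoc]
  | add x y hx hy => simp only [map_add, hx, hy]

/-- When the cochain is longer than the chain, `x` and `y` together fill its arguments, so the
product is transposed from the product of chains. -/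
theorem pairing_starCochainChain' {n p : ℕ} (f : Cochain k A (n + (p + 1)))
    (h : n + (p + 1) = p + n + 1) (x : Chain k A p) (y : Chain k A n) :
    pairing F rfl (starCochainChain' F f x) y = pairing F h f (starChainChain F p n x y) := by
  induction x using chain_induction with
  | mk a l hl =>
    induction y using chain_induction with
    | mk b l' hl' =>
      rw [pairing_chainOfList, onList_starCochainChain' F _ _ _ _ hl',
        starChainChain_chainOfList F _ _ _ _ hl', map_sum, map_sum, LinearMap.sum_apply]
      simp only [pairing_chainOfList, F.assoc]
    | add x y hx hy => simp only [map_add, hx, hy]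
  | add x y hx hy => simp only [map_add, LinearMap.add_apply, hx, hy]

theorem pairing_starChainCochain' (hν : ∀ x, F.nakayamaInv x = F.nakayama x) {n p : ℕ}
    (f : Cochain k A (p + 1 + n))
    (h : p + 1 + n = n + p + 1) (x : Chain k A p) (y : Chain k A n) :
    pairing F rfl (starChainCochain' F f x) y = pairing F h f (starChainChain F n p y x) := by
  induction x using chain_induction with
  | mk a l hl =>
    induction y using chain_induction with
    | mk b l' hl' =>
      rw [pairing_chainOfList, onList_starChainCochain' F _ _ _ _ hl,
        starChainChain_chainOfList F _ _ _ _ hl, map_sum, map_sum, LinearMap.sum_apply]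
      simp only [pairing_chainOfList]
      obtain ⟨L, hL⟩ := exists_linear_onList f.1 l l' (by omega)
      simp only [hL]
      -- The sum over i on the right has uᵢ ν(b) as an argument of f. The first identity moves b
      -- next to vᵢ; the second then replaces uᵢ ⊗ vᵢ by vᵢ ⊗ ν⁻¹(uᵢ), so that vᵢ becomes the
      -- argument as on the left. The two sides then agree for each i.
      have h1 := F.sum_u_mul_nakayama ((F.form ∘ₗ L).compl₂ (LinearMap.mulRight k a)) b
      have h2 := F.sum_v_nakayamaInv_u
        ((F.form ∘ₗ L).compl₂ (LinearMap.mulRight k a ∘ₗ LinearMap.mulLeft k b))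
      simp only [LinearMap.compl₂_apply, LinearMap.comp_apply, LinearMap.mulRight_apply,
        LinearMap.mulLeft_apply] at h1 h2
      rw [h1, ← h2]
      refine Finset.sum_congr rfl fun i _ => ?_
      rw [F.assoc, F.assoc, ← F.form_nakayama, ← hν, F.assoc, ← hν, F.form_nakayamaInv, F.assoc,
        F.assoc, mul_assoc]
    | add x y hx hy => simp only [map_add, LinearMap.add_apply, hx, hy]
  | add x y hx hy => simp only [map_add, LinearMap.add_apply, hx, hy]

end Adjunctions

/-! ### The two Leibniz rules -/

section Leibniz

variable {k A ι : Type*} [Field k] [Ring A] [Algebra k A] [Fintype ι] [DecidableEq ι]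
  (F : FrobeniusData k A ι)

/-- The Leibniz rule for the cup product. -/
theorem onList_delta_cup {m n : ℕ} (f : Cochain k A m) (g : Cochain k A n) (l₁ l₂ : List A) (y : A)
    (h₁ : l₁.length = m) (h₂ : l₂.length = n) :
    onList (delta k A _ (cup f g)).1 (l₁ ++ y :: l₂) =
      onList (delta k A _ f).1 (l₁ ++ [y]) * onList g.1 l₂ +
        (-1 : ℤ) ^ m • (onList f.1 l₁ * onList (delta k A _ g).1 (y :: l₂)) := by
  have hg := map_contractSum (AddMonoidHom.mulLeft (onList f.1 l₁)) (onList g.1)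
    (fun t z => onList g.1 t * z) (y :: l₂)
  simp only [AddMonoidHom.coe_mulLeft] at hg
  have hg' : contractSum (fun t => onList (cup f g).1 (l₁ ++ t))
      (fun t z => onList (cup f g).1 (l₁ ++ t) * z) (y :: l₂) =
      onList f.1 l₁ * contractSum (onList g.1) (fun t z => onList g.1 t * z) (y :: l₂) := by
    rw [hg]
    exact contractSum_congr (fun t _ => onList_cup f g _ _ h₁)
      (fun t z _ => by rw [onList_cup f g _ _ h₁, mul_assoc])
  -- If `l₁` is empty, then y is the first argument and the term y f g of δ(f ⌣ g) comes from it;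
  -- otherwise the first argument lies in `l₁`.
  cases l₁ with
  | nil =>
    simp only [List.length_nil] at h₁
    subst h₁
    simp only [List.nil_append] at hg' ⊢
    rw [onList_delta _ _ _ (by omega), onList_delta f y [] rfl, onList_delta _ _ _ h₂, hg',
      ← List.nil_append l₂, onList_cup f g [] l₂ rfl]
    simp only [List.nil_append, contractSum_singleton, pow_zero, one_smul]
    noncomm_ring
  | cons x l₁ =>
    simp only [List.length_cons] at h₁
    have hf := map_contractSum (AddMonoidHom.mulRight (onList g.1 l₂))
      (fun t => onList f.1 (t ++ [y])) (fun t z => onList f.1 (t ++ [z * y])) (x :: l₁)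
    simp only [AddMonoidHom.mulRight_apply] at hf
    have hf' : contractSum (fun t => onList (cup f g).1 (t ++ y :: l₂))
        (fun t z => onList (cup f g).1 (t ++ z * y :: l₂)) (x :: l₁) =
        contractSum (fun t => onList f.1 (t ++ [y])) (fun t z => onList f.1 (t ++ [z * y]))
          (x :: l₁) * onList g.1 l₂ := by
      rw [hf]
      have key : ∀ (t : List A) (z : A), t.length + 1 = (x :: l₁).length →
          onList (cup f g).1 (t ++ z :: l₂) = onList f.1 (t ++ [z]) * onList g.1 l₂ :=
        fun t z ht => by
          rw [← onList_cup f g (t ++ [z]) l₂ (by simp at ht ⊢; omega)]; simp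
      exact contractSum_congr (fun t ht => key t y ht) (fun t z ht => key t _ ht)
    have h3 : l₁ ++ y :: l₂ = (l₁ ++ [y]) ++ l₂ := by simp
    rw [List.cons_append, onList_delta _ _ _ (by simp; omega), List.cons_append,
      onList_delta _ _ _ (by simp; omega), onList_delta _ _ _ h₂, ← List.cons_append,
      contractSum_append, ← List.cons_append, contractSum_snoc, hf', hg', h3,
      onList_cup f g _ l₂ (by simp; omega)]
    simp only [List.length_cons, h₁, smul_mul_assoc, mul_sub, sub_mul, add_mul, smul_sub, mul_assoc]
    abel

/-- Puts the summands of a product of chains in the shape B(uᵢ, vᵢ) required by the Casimir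
identities. -/
theorem exists_bilinear_form_onList {m : ℕ} (f : Cochain k A m) (l₁ l₂ : List A)
    (h : l₁.length < m) (c d : A) :
    ∃ B : A →ₗ[k] A →ₗ[k] k, ∀ x y,
      F.form (onList f.1 (l₁ ++ (x * c) :: l₂)) (y * d) = B x y := by
  obtain ⟨L, hL⟩ := exists_linear_onList f.1 l₁ l₂ h
  exact ⟨(F.form ∘ₗ L ∘ₗ LinearMap.mulRight k c).compl₂ (LinearMap.mulRight k d),
    fun x y => by simp [hL]⟩

theorem form_onList_delta (hν : ∀ x, F.nakayamaInv x = F.nakayama x) {m : ℕ} (f : Cochain k A m)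
    (a b : A) (l : List A) (hl : l.length = m) :
    F.form (onList (delta k A m f).1 (b :: l)) a =
      F.form (onList f.1 l) (a * F.nakayamaInv b) -
        contractSum (fun t => F.form (onList f.1 t) a) (fun t y => F.form (onList f.1 t) (y * a))
          (b :: l) := by
  have h1 := map_contractSum (F.form.flip a).toAddMonoidHom (onList f.1)
    (fun t y => onList f.1 t * y) (b :: l)
  simp only [LinearMap.toAddMonoidHom_coe, LinearMap.flip_apply, F.assoc] at h1
  rw [onList_delta f _ _ hl, map_sub, LinearMap.sub_apply, h1, hν, ← F.assoc, F.form_nakayama,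
    F.assoc]

theorem pairing_starChainChain_chainOfList {m p q : ℕ} (h : m = p + q + 1) (f : Cochain k A m)
    (a b : A) (l l' : List A) (hl' : l'.length = q) :
    pairing F h f (starChainChain F p q (chainOfList k p (a :: l)) (chainOfList k q (b :: l'))) =
      ∑ i, F.form (onList f.1 (l' ++ (F.u i * F.nakayama a) :: l)) (F.v i * b) := by
  rw [starChainChain_chainOfList F _ _ _ _ hl', map_sum]
  simp only [pairing_chainOfList]

/-- The faces of x ⋆ y from the entry uᵢ ν(a) onwards assemble to (∂x) ⋆ y. Contracting that entry
with a₁ gives uᵢ ν(a ν⁻¹(a₁)), the first face of x, and the cyclic last face gives ya inside ν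
because ∑ uᵢ ν(y) ⊗ vᵢ = ∑ uᵢ ⊗ y vᵢ. -/
theorem sum_contractSum_tail {m p q : ℕ} (h : m = p + q + 1) (f : Cochain k A m)
    (a b a₁ : A) (l l' : List A) (hl : l.length = p) (hl' : l'.length = q) :
    ∑ i, contractSum (fun t => F.form (onList f.1 (l' ++ t)) (F.v i * b))
        (fun t y => F.form (onList f.1 (l' ++ t)) (y * (F.v i * b)))
        ((F.u i * F.nakayama a) :: a₁ :: l) =
      pairing F h f (starChainChain F p q (boundary F p (chainOfList k (p + 1) (a :: a₁ :: l)))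
        (chainOfList k q (b :: l'))) := by
  have hS := map_contractSum ((pairing F h f).comp ((starChainChain F p q).flip
      (chainOfList k q (b :: l')))).toAddMonoidHom
    (fun t => chainOfList k p (a :: t)) (fun t y => chainOfList k p (y * a :: t)) (a₁ :: l)
  simp only [LinearMap.toAddMonoidHom_coe, LinearMap.comp_apply, LinearMap.flip_apply,
    pairing_starChainChain_chainOfList F h f _ b _ l' hl'] at hS
  rw [boundary_chainOfList F _ _ _ hl, map_sub, LinearMap.sub_apply, map_sub, hS,
    pairing_starChainChain_chainOfList F h f _ b _ l' hl']
  simp only [contractSum_cons_cons, Finset.sum_sub_distrib, sum_contractSum, F.nakayama_mul,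
    F.nakayama_nakayamaInv, mul_assoc]
  congr 1
  refine contractSum_congr (fun _ _ => rfl) fun t y _ => ?_
  obtain ⟨B, hB⟩ := exists_bilinear_form_onList F f l' t (by omega) (F.nakayama a) b
  have := F.sum_u_mul_nakayama B y
  simp only [← hB, mul_assoc] at this
  exact this.symm

/-- For x of degree zero only the last face remains, and it contains μ(ν(a)) = 0 as a factor. -/
theorem sum_contractSum_singleton (hμ : ∀ a, ∑ i, F.u i * a * F.v i = 0) {m : ℕ}
    (f : Cochain k A m) (a b : A) (l' : List A) :
    ∑ i, contractSum (fun t => F.form (onList f.1 (l' ++ t)) (F.v i * b))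
        (fun t y => F.form (onList f.1 (l' ++ t)) (y * (F.v i * b)))
        [F.u i * F.nakayama a] = 0 := by
  simp only [contractSum_singleton, ← map_sum, ← mul_assoc, ← Finset.sum_mul, hμ, zero_mul,
    map_zero]

/-- The faces before the entry uᵢ ν(a) assemble to x ⋆ ∂y. The face merging the last entry of y into
uᵢ becomes the cyclic face of y, since ∑ y uᵢ ⊗ vᵢ = ∑ uᵢ ⊗ vᵢ y. The later faces are left over,
with the sign of passing q + 1 entries. -/
theorem sum_form_delta_cons (hν : ∀ x, F.nakayamaInv x = F.nakayama x) {m p q : ℕ}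
    (h : m = p + q + 1) (f : Cochain k A m)
    (a b b₁ : A) (l l' : List A) (hl : l.length = p) (hl' : l'.length = q) :
    ∑ i, F.form (onList (delta k A m f).1 (b₁ :: l' ++ (F.u i * F.nakayama a) :: l)) (F.v i * b) =
      pairing F h f (starChainChain F p q (chainOfList k p (a :: l))
        (boundary F q (chainOfList k (q + 1) (b :: b₁ :: l')))) -
      (-1 : ℤ) ^ (q + 1) • ∑ i,
        contractSum (fun t => F.form (onList f.1 (b₁ :: l' ++ t)) (F.v i * b))
        (fun t y => F.form (onList f.1 (b₁ :: l' ++ t)) (y * (F.v i * b)))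
        ((F.u i * F.nakayama a) :: l) := by
  have hS := map_contractSum ((pairing F h f).comp (starChainChain F p q
      (chainOfList k p (a :: l)))).toAddMonoidHom
    (fun t => chainOfList k q (b :: t)) (fun t y => chainOfList k q (y * b :: t)) (b₁ :: l')
  simp only [LinearMap.toAddMonoidHom_coe, LinearMap.comp_apply] at hS
  rw [boundary_chainOfList F _ _ _ hl', map_sub, map_sub, hS,
    pairing_starChainChain_chainOfList F h f _ _ _ l' hl']
  have h1 : ∀ i, F.form (onList (delta k A m f).1 (b₁ :: l' ++ (F.u i * F.nakayama a) :: l))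
      (F.v i * b) = _ := fun i => by
    rw [List.cons_append, form_onList_delta F hν f _ _ _ (by simp; omega), ← List.cons_append,
      contractSum_append]
  simp only [h1, Finset.sum_sub_distrib, ← Finset.smul_sum,
    sum_contractSum, List.length_cons, hl', mul_assoc, ← sub_sub]
  congr 2
  refine contractSum_congr (fun t ht => ?_) fun t y ht => ?_
  · rw [pairing_starChainChain_chainOfList F h f _ _ _ t (by simp at ht; omega)]
  · rw [pairing_starChainChain_chainOfList F h f _ _ _ t (by simp at ht; omega)]
    obtain ⟨B, hB⟩ := exists_bilinear_form_onList F f t l (by simp at ht; omega) (F.nakayama a) b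
    have := F.sum_mul_u B y
    simp only [← hB, mul_assoc] at this
    exact this

/-- For y of degree zero the first face contains ∑ vᵢ b ν⁻¹(uᵢ) = ∑ uᵢ b vᵢ = μ(b), hence vanishes.
-/
theorem sum_form_delta_nil (hν : ∀ x, F.nakayamaInv x = F.nakayama x)
    (hμ : ∀ a, ∑ i, F.u i * a * F.v i = 0) {m : ℕ} (f : Cochain k A m)
    (a b : A) (l : List A) (hl : l.length = m) :
    ∑ i, F.form (onList (delta k A m f).1 ([] ++ (F.u i * F.nakayama a) :: l)) (F.v i * b) =
      -∑ i, contractSum (fun t => F.form (onList f.1 ([] ++ t)) (F.v i * b))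
        (fun t y => F.form (onList f.1 ([] ++ t)) (y * (F.v i * b)))
        ((F.u i * F.nakayama a) :: l) := by
  have h0 := F.sum_v_nakayamaInv_u ((LinearMap.mul k A) ∘ₗ LinearMap.mulRight k b)
  simp only [LinearMap.comp_apply, LinearMap.mulRight_apply, LinearMap.mul_apply', hμ] at h0
  simp only [List.nil_append, form_onList_delta F hν f _ _ _ hl, Finset.sum_sub_distrib, hν,
    F.nakayama_mul]
  simp only [hν] at h0
  rw [← map_sum]
  simp only [← mul_assoc, ← Finset.sum_mul] at h0 ⊢
  rw [h0]
  simp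

end Leibniz

/-! ### Products of cocycles and cycles; products with boundaries -/

section Cycles

variable {k A ι : Type*} [Field k] [Ring A] [Algebra k A] [Fintype ι] [DecidableEq ι]
  (F : FrobeniusData k A ι)

/-- By duality this is the Leibniz rule for ∂(x ⋆ y): the faces are cut at the junction of the two
chains. -/
theorem pairing_delta_star_succ_succ (hν : ∀ x, F.nakayamaInv x = F.nakayama x) {m p q : ℕ}
    (h : m + 1 = p + 1 + (q + 1) + 1) (h₁ : m = p + 1 + q + 1) (h₂ : m = p + (q + 1) + 1)
    (f : Cochain k A m) (x : Chain k A (p + 1)) (y : Chain k A (q + 1)) :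
    pairing F h (delta k A m f) (starChainChain F (p + 1) (q + 1) x y) =
      pairing F h₁ f (starChainChain F (p + 1) q x (boundary F q y)) -
      (-1 : ℤ) ^ (q + 1) • pairing F h₂ f (starChainChain F p (q + 1) (boundary F p x) y) := by
  induction x using chain_induction with
  | mk a l hl =>
    induction y using chain_induction with
    | mk b l' hl' =>
      match l, hl, l', hl' with
      | a₁ :: l, hl, b₁ :: l', hl' =>
        rw [pairing_starChainChain_chainOfList F h _ _ _ _ _ hl',
          sum_form_delta_cons F hν h₁ f a b b₁ (a₁ :: l) l' hl (by simpa using hl'),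
          sum_contractSum_tail F h₂ f a b a₁ l (b₁ :: l') (by simpa using hl) hl']
    | add x y hx hy => simp only [map_add, hx, hy, smul_add]; abel
  | add x y hx hy => simp only [map_add, LinearMap.add_apply, hx, hy, smul_add]; abel

/-- The term with ∂x is replaced by one containing a value of μ, which is zero. The same happens for
y in the next lemma, so a chain of degree zero behaves as a cycle. -/
theorem pairing_delta_star_zero_succ (hν : ∀ x, F.nakayamaInv x = F.nakayama x)
    (hμ : ∀ a, ∑ i, F.u i * a * F.v i = 0) {m q : ℕ}
    (h : m + 1 = 0 + (q + 1) + 1) (h₁ : m = 0 + q + 1)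
    (f : Cochain k A m) (x : Chain k A 0) (y : Chain k A (q + 1)) :
    pairing F h (delta k A m f) (starChainChain F 0 (q + 1) x y) =
      pairing F h₁ f (starChainChain F 0 q x (boundary F q y)) := by
  induction x using chain_induction with
  | mk a l hl =>
    induction y using chain_induction with
    | mk b l' hl' =>
      match l, hl, l', hl' with
      | [], hl, b₁ :: l', hl' =>
        rw [pairing_starChainChain_chainOfList F h _ _ _ _ _ hl',
          sum_form_delta_cons F hν h₁ f a b b₁ [] l' hl (by simpa using hl'),
          sum_contractSum_singleton F hμ, smul_zero, sub_zero]
    | add x y hx hy => simp only [map_add, hx, hy]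
  | add x y hx hy => simp only [map_add, LinearMap.add_apply, hx, hy]

theorem pairing_delta_star_succ_zero (hν : ∀ x, F.nakayamaInv x = F.nakayama x)
    (hμ : ∀ a, ∑ i, F.u i * a * F.v i = 0) {m p : ℕ}
    (h : m + 1 = p + 1 + 0 + 1) (h₁ : m = p + 0 + 1)
    (f : Cochain k A m) (x : Chain k A (p + 1)) (y : Chain k A 0) :
    pairing F h (delta k A m f) (starChainChain F (p + 1) 0 x y) =
      -pairing F h₁ f (starChainChain F p 0 (boundary F p x) y) := by
  induction x using chain_induction with
  | mk a l hl =>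
    induction y using chain_induction with
    | mk b l' hl' =>
      match l, hl, l', hl' with
      | a₁ :: l, hl, [], hl' =>
        rw [pairing_starChainChain_chainOfList (p := p + 1) (q := 0) F h _ _ _ _ _ hl',
          sum_form_delta_nil F hν hμ f a b (a₁ :: l) (by simp at hl ⊢; omega),
          sum_contractSum_tail F h₁ f a b a₁ l [] (by simpa using hl) hl']
    | add x y hx hy => simp only [map_add, hx, hy]; abel
  | add x y hx hy => simp only [map_add, LinearMap.add_apply, hx, hy]; abel

theorem pairing_delta_star_zero_zero (hν : ∀ x, F.nakayamaInv x = F.nakayama x)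
    (hμ : ∀ a, ∑ i, F.u i * a * F.v i = 0) {m : ℕ} (h : m + 1 = 0 + 0 + 1)
    (f : Cochain k A m) (x : Chain k A 0) (y : Chain k A 0) :
    pairing F h (delta k A m f) (starChainChain F 0 0 x y) = 0 := by
  induction x using chain_induction with
  | mk a l hl =>
    induction y using chain_induction with
    | mk b l' hl' =>
      match l, hl, l', hl' with
      | [], hl, [], hl' =>
        rw [pairing_starChainChain_chainOfList F h _ _ _ _ _ hl',
          sum_form_delta_nil F hν hμ f a b [] (by simp; omega),
          sum_contractSum_singleton F hμ, neg_zero]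
    | add x y hx hy => simp only [map_add, hx, hy, add_zero]
  | add x y hx hy => simp only [map_add, LinearMap.add_apply, hx, hy, add_zero]

/-- A chain which pairs to zero with all coboundaries; in positive degrees these are the cycles, and
in degree zero all chains have this property. -/
def IsCycle {p : ℕ} (x : Chain k A p) : Prop :=
  ∀ (r : ℕ) (h : r + 1 = p) (f : Cochain k A r), pairing F h (delta k A r f) x = 0

theorem isCycle_zero (x : Chain k A 0) : IsCycle F x := fun _ h => absurd h (Nat.succ_ne_zero _)

theorem isCycle_succ_iff (hν : ∀ x, F.nakayamaInv x = F.nakayama x) {p : ℕ}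
    (x : Chain k A (p + 1)) : IsCycle F x ↔ boundary F p x = 0 := by
  refine ⟨fun H => chain_eq_zero_of_pairing F fun f => ?_, fun H r h f => ?_⟩
  · rw [← pairing_delta F hν rfl, H p rfl f]
  · obtain rfl : r = p := Nat.succ_injective h
    rw [pairing_delta F hν rfl, H, map_zero]

/-- Up to sign x ⋆ ∂y is ∂(x ⋆ y) when x is a cycle, and a cocycle annihilates boundaries. Through
the adjunctions this shows that products of a long cocycle with a cycle are cocycles. -/
theorem pairing_star_boundary (hν : ∀ x, F.nakayamaInv x = F.nakayama x)
    (hμ : ∀ a, ∑ i, F.u i * a * F.v i = 0) {m p q : ℕ} (h : m = p + q + 1)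
    (f : Cochain k A m) (hf : delta k A m f = 0) (x : Chain k A p) (hx : IsCycle F x)
    (y : Chain k A (q + 1)) : pairing F h f (starChainChain F p q x (boundary F q y)) = 0 := by
  cases p with
  | zero =>
    rw [← pairing_delta_star_zero_succ F hν hμ (by omega) h, hf, map_zero, LinearMap.zero_apply]
  | succ p =>
    have := pairing_delta_star_succ_succ F hν (by omega) h (by omega) f x y
    rw [hf, (isCycle_succ_iff F hν x).1 hx] at this
    simpa using this.symm

theorem pairing_boundary_star (hν : ∀ x, F.nakayamaInv x = F.nakayama x)
    (hμ : ∀ a, ∑ i, F.u i * a * F.v i = 0) {m p q : ℕ} (h : m = p + q + 1)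
    (f : Cochain k A m) (hf : delta k A m f = 0) (x : Chain k A (p + 1))
    (y : Chain k A q) (hy : IsCycle F y) :
    pairing F h f (starChainChain F p q (boundary F p x) y) = 0 := by
  cases q with
  | zero =>
    have := pairing_delta_star_succ_zero F hν hμ (by omega) h f x y
    rw [hf] at this
    simpa using this.symm
  | succ q =>
    have := pairing_delta_star_succ_succ F hν (by omega) (by omega) h f x y
    rw [hf, (isCycle_succ_iff F hν y).1 hy] at this
    simpa using this.symm

theorem IsCycle.starChainChain (hν : ∀ x, F.nakayamaInv x = F.nakayama x)
    (hμ : ∀ a, ∑ i, F.u i * a * F.v i = 0) {p q : ℕ} {x : Chain k A p} {y : Chain k A q}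
    (hx : IsCycle F x) (hy : IsCycle F y) : IsCycle F (starChainChain F p q x y) := by
  intro r h f
  match p, q, x, y, hx, hy, h with
  | 0, 0, x, y, hx, hy, h => exact pairing_delta_star_zero_zero F hν hμ h f x y
  | 0, q + 1, x, y, hx, hy, h =>
    rw [pairing_delta_star_zero_succ F hν hμ h (by omega), (isCycle_succ_iff F hν y).1 hy]
    simp
  | p + 1, 0, x, y, hx, hy, h =>
    rw [pairing_delta_star_succ_zero F hν hμ h (by omega), (isCycle_succ_iff F hν x).1 hx]
    simp
  | p + 1, q + 1, x, y, hx, hy, h =>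
    rw [pairing_delta_star_succ_succ F hν h (by omega) (by omega),
      (isCycle_succ_iff F hν x).1 hx, (isCycle_succ_iff F hν y).1 hy]
    simp

theorem delta_eq_zero_of_pairing (hν : ∀ x, F.nakayamaInv x = F.nakayama x) {n : ℕ}
    (f : Cochain k A n) (H : ∀ y, pairing F rfl f (boundary F n y) = 0) : delta k A n f = 0 :=
  cochain_eq_of_pairing F rfl fun y => by
    rw [map_zero, LinearMap.zero_apply, ← H y]
    exact pairing_delta F hν rfl f y

theorem delta_starCochainChain' (hν : ∀ x, F.nakayamaInv x = F.nakayama x)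
    (hμ : ∀ a, ∑ i, F.u i * a * F.v i = 0) {n p : ℕ} (f : Cochain k A (n + (p + 1)))
    (hf : delta k A _ f = 0) (x : Chain k A p) (hx : IsCycle F x) :
    delta k A n (starCochainChain' F f x) = 0 :=
  delta_eq_zero_of_pairing F hν _ fun y => by
    rw [pairing_starCochainChain' F f (by omega), pairing_star_boundary F hν hμ _ f hf x hx]

theorem delta_starChainCochain' (hν : ∀ x, F.nakayamaInv x = F.nakayama x)
    (hμ : ∀ a, ∑ i, F.u i * a * F.v i = 0) {n p : ℕ} (f : Cochain k A (p + 1 + n))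
    (hf : delta k A _ f = 0) (x : Chain k A p) (hx : IsCycle F x) :
    delta k A n (starChainCochain' F f x) = 0 :=
  delta_eq_zero_of_pairing F hν _ fun y => by
    rw [pairing_starChainCochain' F hν f (by omega), pairing_boundary_star F hν hμ _ f hf y x hx]

theorem delta_cup {m n : ℕ} {f : Cochain k A m} {g : Cochain k A n} (hf : delta k A m f = 0)
    (hg : delta k A n g = 0) : delta k A _ (cup f g) = 0 :=
  cochain_ext_list fun l hl => by
    obtain ⟨l₁, l₂, h₁, h₂, rfl⟩ := exists_append_of_length (m := m) (n := n + 1) l hl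
    match l₂, h₂ with
    | y :: l₂, h₂ =>
      rw [onList_delta_cup f g _ _ _ h₁ (by simpa using h₂), hf, hg]
      simp [onList]

/-- The Leibniz rule with δf = 0, compared on lists. It is the input showing that the action of a
cocycle on chains preserves cycles. -/
theorem onList_cup_delta {m n : ℕ} (f : Cochain k A m) (g : Cochain k A n)
    (hf : delta k A m f = 0) (l : List A) (hl : l.length = m + (n + 1)) :
    onList (cup f (delta k A n g)).1 l =
      (-1 : k) ^ m • onList (delta k A _ (cup f g)).1 l := by
  obtain ⟨l₁, l₂, h₁, h₂, rfl⟩ := exists_append_of_length (m := m) (n := n + 1) l hl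
  match l₂, h₂ with
  | y :: l₂, h₂ =>
    rw [onList_delta_cup f g _ _ _ h₁ (by simpa using h₂), hf, onList_cup _ _ _ _ h₁]
    rcases Nat.even_or_odd m with h | h <;> simp [onList, h]

theorem onList_delta_cup_of_cocycle {m n : ℕ} (f : Cochain k A m) (g : Cochain k A n)
    (hg : delta k A n g = 0) (l : List A) (hl : l.length = m + n + 1) :
    onList (cup (delta k A m f) g).1 l = onList (delta k A _ (cup f g)).1 l := by
  obtain ⟨l₁, l₂, h₁, h₂, rfl⟩ := exists_append_of_length (m := m) (n := n + 1) l hl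
  match l₂, h₂ with
  | y :: l₂, h₂ =>
    rw [onList_delta_cup f g _ _ _ h₁ (by simpa using h₂), hg,
      show l₁ ++ y :: l₂ = (l₁ ++ [y]) ++ l₂ by simp, onList_cup _ _ _ _ (by simpa using h₁)]
    simp [onList]

theorem IsCycle.starCochainChain {m q : ℕ} {f : Cochain k A m} (hf : delta k A m f = 0)
    {x : Chain k A (q + m)} (hx : IsCycle F x) : IsCycle F (starCochainChain f x) := by
  rintro r rfl g
  rw [pairing_starCochainChain, pairing_congr F rfl (by omega)
    (fun l hl => onList_delta_cup_of_cocycle g f hf l (by omega)), hx _ (by omega)]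

theorem IsCycle.starChainCochain (hν : ∀ x, F.nakayamaInv x = F.nakayama x) {m q : ℕ}
    {f : Cochain k A m} (hf : delta k A m f = 0)
    {x : Chain k A (m + q)} (hx : IsCycle F x) : IsCycle F (starChainCochain F f x) := by
  rintro r rfl g
  rw [pairing_starChainCochain F hν, pairing_congr F rfl (by omega)
    (f' := (-1 : k) ^ m • delta k A _ (cup f g)) (fun l hl => onList_cup_delta f g hf l hl),
    map_smul, LinearMap.smul_apply, hx _ (by omega), smul_zero]

end Cycles

/-! ### Arithmetic of the two vertices -/

instance : Nontrivial TwoCycle := ⟨0, 1, by decide⟩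

theorem TwoCycle.add_self (i : TwoCycle) : i + i = 0 := by revert i; decide

theorem TwoCycle.add_one_add_one (i : TwoCycle) : i + 1 + 1 = i := by revert i; decide

theorem TwoCycle.add_one_ne (i : TwoCycle) : i + 1 ≠ i := by revert i; decide

theorem TwoCycle.one_add_one : (1 : TwoCycle) + 1 = 0 := by decide

theorem TwoCycle.sum_eq {M : Type*} [AddCommMonoid M] (f : TwoCycle → M) :
    ∑ i, f i = f 0 + f 1 := Fin.sum_univ_two (f : Fin 2 → M)

theorem TwoCycle.cast_even {n : ℕ} (h : Even n) : (n : TwoCycle) = 0 := by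
  obtain ⟨m, rfl⟩ := h
  rw [Nat.cast_add, TwoCycle.add_self]

theorem TwoCycle.cast_odd {n : ℕ} (h : Odd n) : (n : TwoCycle) = 1 := by
  obtain ⟨m, rfl⟩ := h
  rw [Nat.cast_add, cast_even (even_two_mul m), zero_add, Nat.cast_one]

namespace TwoCycleAlgebra

universe u

variable (k : Type u) [Field k]

/-! ### Coordinates on A, ν⁻¹ = ν and μ = 0 -/

section Coefficients

/-- The coefficient of `e i` in an element of `A`. -/
noncomputable def coeffE (i : TwoCycle) : TwoCycleAlgebra k →ₗ[k] k :=
  LinearMap.proj (Sum.inl i) ∘ₗ coord k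

@[simp] theorem coeffE_e (i j : TwoCycle) : coeffE k i (e k j) = if i = j then 1 else 0 := by
  simp [coeffE, coord_e, Pi.single_apply]

@[simp] theorem coeffE_α (i j : TwoCycle) : coeffE k i (α k j) = 0 := by
  simp [coeffE, coord_α]

@[simp] theorem coeffα_e (i j : TwoCycle) : coeffα k i (e k j) = 0 := by
  simp [coeffα, coord_e]

@[simp] theorem coeffα_α (i j : TwoCycle) : coeffα k i (α k j) = if i = j then 1 else 0 := by
  simp [coeffα, coord_α, Pi.single_apply]

theorem eq_sum_coeff (x : TwoCycleAlgebra k) :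
    x = ∑ i, coeffE k i x • e k i + ∑ i, coeffα k i x • α k i := by
  have H : LinearMap.id = ∑ i, (coeffE k i).smulRight (e k i) +
      ∑ i, (coeffα k i).smulRight (α k i) := by
    refine (basisU k).ext fun s => ?_
    rcases s with i | i <;> simp [basisU]
  simpa using LinearMap.congr_fun H x

variable {k} in
theorem ext_coeff {x y : TwoCycleAlgebra k} (hE : ∀ i, coeffE k i x = coeffE k i y)
    (hα : ∀ i, coeffα k i x = coeffα k i y) : x = y := by
  rw [eq_sum_coeff k x, eq_sum_coeff k y]
  simp only [hE, hα]

/-- The span of the arrows is an ideal, so the coefficient of e_i is a character; these characters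
define the simple bimodules. -/
theorem coeffE_mul (i : TwoCycle) (x y : TwoCycleAlgebra k) :
    coeffE k i (x * y) = coeffE k i x * coeffE k i y := by
  have H : (LinearMap.mul k (TwoCycleAlgebra k)).compr₂ (coeffE k i) =
      (LinearMap.mul k k).compl₁₂ (coeffE k i) (coeffE k i) := by
    refine (basisU k).ext fun s => (basisU k).ext fun t => ?_
    rcases s with j | j <;> rcases t with l | l <;>
      simp only [basisU, Module.Basis.mk_apply, Sum.elim_inl, Sum.elim_inr, LinearMap.compr₂_apply,
        LinearMap.mul_apply', LinearMap.compl₁₂_apply, e_mul_e, e_mul_α, α_mul_e, α_mul_α] <;>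
      (try split_ifs) <;> simp_all <;> grind
  exact LinearMap.congr_fun₂ H x y

/-- The arrow α i absorbs e_i on the left and e_{i+1} on the right, so this coefficient is a
derivation between two characters. The two summands later separate simple coefficients from the
connecting map. -/
theorem coeffα_mul (i : TwoCycle) (x y : TwoCycleAlgebra k) :
    coeffα k i (x * y) = coeffE k i x * coeffα k i y + coeffα k i x * coeffE k (i + 1) y := by
  have H : (LinearMap.mul k (TwoCycleAlgebra k)).compr₂ (coeffα k i) =
      (LinearMap.mul k k).compl₁₂ (coeffE k i) (coeffα k i) +
        (LinearMap.mul k k).compl₁₂ (coeffα k i) (coeffE k (i + 1)) := by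
    refine (basisU k).ext fun s => (basisU k).ext fun t => ?_
    rcases s with j | j <;> rcases t with l | l <;>
      simp only [basisU, Module.Basis.mk_apply, Sum.elim_inl, Sum.elim_inr, LinearMap.compr₂_apply,
        LinearMap.mul_apply', LinearMap.compl₁₂_apply, e_mul_e, e_mul_α, α_mul_e, α_mul_α,
        LinearMap.add_apply] <;>
      (try split_ifs) <;> simp_all <;> grind
  exact LinearMap.congr_fun₂ H x y

theorem tr_eq (x : TwoCycleAlgebra k) : tr k x = ∑ i, coeffα k i x := by
  simp [tr, coeffα]

theorem frobenius_form (x y : TwoCycleAlgebra k) : (frobenius k).form x y = tr k (x * y) := rfl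

theorem form_α (x : TwoCycleAlgebra k) (i : TwoCycle) :
    (frobenius k).form x (α k i) = coeffE k i x := by
  simp [frobenius_form, tr_eq, coeffα_mul]

theorem form_e (x : TwoCycleAlgebra k) (i : TwoCycle) :
    (frobenius k).form x (e k i) = coeffα k (i + 1) x := by
  rw [frobenius_form, tr_eq, TwoCycle.sum_eq]
  rcases i.exhaust with rfl | rfl <;> simp [coeffα_mul, TwoCycle.one_add_one]

theorem e_form (x : TwoCycleAlgebra k) (i : TwoCycle) :
    (frobenius k).form (e k i) x = coeffα k i x := by
  simp [frobenius_form, tr_eq, coeffα_mul]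

theorem α_form (x : TwoCycleAlgebra k) (i : TwoCycle) :
    (frobenius k).form (α k i) x = coeffE k (i + 1) x := by
  simp [frobenius_form, tr_eq, coeffα_mul]

theorem frobenius_u_inl (i : TwoCycle) : (frobenius k).u (Sum.inl i) = e k i := by
  simp [frobenius, basisU]

theorem frobenius_u_inr (i : TwoCycle) : (frobenius k).u (Sum.inr i) = α k i := by
  simp [frobenius, basisU]

theorem frobenius_v_inl (i : TwoCycle) : (frobenius k).v (Sum.inl i) = α k (i + 1) := by
  simp [frobenius, basisV]

theorem frobenius_v_inr (i : TwoCycle) : (frobenius k).v (Sum.inr i) = e k i := by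
  simp [frobenius, basisV]

theorem nakayama_eq (x : TwoCycleAlgebra k) : (frobenius k).nakayama x =
    ∑ i, coeffE k (i + 1) x • e k i + ∑ i, coeffα k (i + 1) x • α k i := by
  rw [FrobeniusData.nakayama_apply, Fintype.sum_sum_type]
  simp only [frobenius_u_inl, frobenius_u_inr, frobenius_v_inl, frobenius_v_inr, form_α, form_e]

/-- Both shift every index by one, and shifting twice is the identity modulo 2. -/
theorem nakayamaInv_eq_nakayama (x : TwoCycleAlgebra k) :
    (frobenius k).nakayamaInv x = (frobenius k).nakayama x := by
  rw [FrobeniusData.nakayamaInv_apply, nakayama_eq, Fintype.sum_sum_type]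
  simp only [frobenius_u_inl, frobenius_u_inr, frobenius_v_inl, frobenius_v_inr, α_form, e_form,
    TwoCycle.sum_eq, TwoCycle.one_add_one, zero_add]
  abel

theorem coeffE_nakayama (i : TwoCycle) (x : TwoCycleAlgebra k) :
    coeffE k i ((frobenius k).nakayama x) = coeffE k (i + 1) x := by
  simp [nakayama_eq]

theorem coeffα_nakayama (i : TwoCycle) (x : TwoCycleAlgebra k) :
    coeffα k i ((frobenius k).nakayama x) = coeffα k (i + 1) x := by
  simp [nakayama_eq]

/-- Every summand has the form e_i a α_{i+1} or α_i a e_i. The idempotents leave only an arrow of a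
between the two vertices, and a product of two arrows is zero. This is μ = 0. -/
theorem sum_u_mul_v (a : TwoCycleAlgebra k) :
    ∑ s, (frobenius k).u s * a * (frobenius k).v s = 0 := by
  rw [Fintype.sum_sum_type]
  simp only [frobenius_u_inl, frobenius_u_inr, frobenius_v_inl, frobenius_v_inr, TwoCycle.sum_eq,
    TwoCycle.one_add_one, zero_add]
  refine ext_coeff (fun i => ?_) (fun i => ?_) <;>
    rcases i.exhaust with rfl | rfl <;>
    simp [coeffE_mul, coeffα_mul, TwoCycle.one_add_one]

end Coefficients

/-! ### Hochschild cohomology with simple coefficients -/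

section Scalar

variable {k}

/-- A multilinear form which vanishes as soon as one argument is `1`. -/
def Normalized {n : ℕ} {M : Type*} [AddCommGroup M] [Module k M]
    (f : MultilinearMap k (fun _ : Fin n => TwoCycleAlgebra k) M) : Prop :=
  ∀ l : List (TwoCycleAlgebra k), l.length = n → 1 ∈ l → onList f l = 0

/-- The multilinear form `(a₁, …, a_{n+1}) ↦ c(a₁) f(a₂, …, a_{n+1})`. -/
noncomputable def consForm (c : TwoCycleAlgebra k →ₗ[k] k) {n : ℕ}
    (f : MultilinearMap k (fun _ : Fin n => TwoCycleAlgebra k) k) :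
    MultilinearMap k (fun _ : Fin (n + 1) => TwoCycleAlgebra k) k :=
  LinearMap.uncurryLeft (M := fun _ : Fin (n + 1) => TwoCycleAlgebra k) (c.smulRight f)

theorem onList_consForm (c : TwoCycleAlgebra k →ₗ[k] k) {n : ℕ}
    (f : MultilinearMap k (fun _ : Fin n => TwoCycleAlgebra k) k) (x : TwoCycleAlgebra k)
    (l : List (TwoCycleAlgebra k)) : onList (consForm c f) (x :: l) = c x * onList f l := by
  rw [onList, entries_cons]; rfl

theorem Normalized.consForm {c : TwoCycleAlgebra k →ₗ[k] k} (hc : c 1 = 0) {n : ℕ}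
    {f : MultilinearMap k (fun _ : Fin n => TwoCycleAlgebra k) k} (hf : Normalized f) :
    Normalized (consForm c f) := by
  rintro (_ | ⟨x, l⟩) hl h
  · simp at h
  · rw [onList_consForm]
    rcases List.mem_cons.1 h with rfl | h
    · rw [hc, zero_mul]
    · rw [hf l (by simpa using hl) h, mul_zero]

theorem Normalized.curryLeft {n : ℕ}
    {f : MultilinearMap k (fun _ : Fin (n + 1) => TwoCycleAlgebra k) k} (hf : Normalized f)
    (x : TwoCycleAlgebra k) : Normalized (n := n) (f.curryLeft x) := fun l hl h => by
  rw [onList_curryLeft]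
  exact hf _ (by simp [hl]) (List.mem_cons_of_mem _ h)

/-- The Hochschild differential with coefficients in the simple bimodule with left action through
`e i` and right action through `e j`. -/
noncomputable def scalarDelta (i j : TwoCycle) (f : List (TwoCycleAlgebra k) → k) :
    List (TwoCycleAlgebra k) → k
  | [] => 0
  | x :: l => coeffE k i x * f l - contractSum f (fun t y => f t * coeffE k j y) (x :: l)

theorem scalarDelta_cons (i j : TwoCycle) (f : List (TwoCycleAlgebra k) → k)
    (x : TwoCycleAlgebra k) (l : List (TwoCycleAlgebra k)) : scalarDelta i j f (x :: l) =
      coeffE k i x * f l - contractSum f (fun t y => f t * coeffE k j y) (x :: l) := rfl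

theorem scalarDelta_congr (i j : TwoCycle) {f g : List (TwoCycleAlgebra k) → k}
    (l : List (TwoCycleAlgebra k)) (h : ∀ t, t.length + 1 = l.length → f t = g t) :
    scalarDelta i j f l = scalarDelta i j g l := by
  cases l with
  | nil => rfl
  | cons x l =>
    rw [scalarDelta_cons, scalarDelta_cons, h l rfl,
      contractSum_congr h (fun t y ht => by rw [h t ht])]

theorem scalarDelta_zero (i j : TwoCycle) (l : List (TwoCycleAlgebra k)) :
    scalarDelta i j (fun _ => 0) l = 0 := by
  cases l with
  | nil => rfl
  | cons x l =>
    rw [scalarDelta_cons]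
    have := map_contractSum (0 : k →+ k) (fun _ : List (TwoCycleAlgebra k) => (0 : k))
      (fun _ _ => 0) (x :: l)
    simpa using this.symm

theorem scalarDelta_sub (i j : TwoCycle) (f g : List (TwoCycleAlgebra k) → k)
    (l : List (TwoCycleAlgebra k)) :
    scalarDelta i j (fun t => f t - g t) l = scalarDelta i j f l - scalarDelta i j g l := by
  cases l with
  | nil => simp [scalarDelta]
  | cons x l =>
    simp only [scalarDelta_cons, sub_mul, contractSum_sub]
    ring

/-- The path of length `n` starting at `i`, as a list of arrows. -/
noncomputable def path (k : Type u) [Field k] : TwoCycle → ℕ → List (TwoCycleAlgebra k)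
  | _, 0 => []
  | i, n + 1 => α k i :: path k (i + 1) n

@[simp] theorem length_path (i : TwoCycle) (n : ℕ) : (path k i n).length = n := by
  induction n generalizing i with
  | zero => rfl
  | succ n ih => simp [path, ih]

theorem path_succ (i : TwoCycle) (n : ℕ) : path k i (n + 1) = α k i :: path k (i + 1) n := rfl

theorem path_snoc (i : TwoCycle) (n : ℕ) : path k i (n + 1) = path k i n ++ [α k (i + n)] := by
  induction n generalizing i with
  | zero => simp [path]
  | succ n ih =>
    rw [path_succ, ih, path_succ, List.cons_append, Nat.cast_succ, add_right_comm, add_assoc]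

theorem path_add (i : TwoCycle) (m n : ℕ) :
    path k i (m + n) = path k i m ++ path k (i + m) n := by
  induction m generalizing i with
  | zero => simp [path]
  | succ m ih =>
    rw [Nat.add_right_comm, path_succ, ih, path_succ, List.cons_append,
      Nat.cast_succ, add_assoc, add_comm (1 : TwoCycle), ← add_assoc]

theorem exists_eq_α_of_mem_path {i : TwoCycle} {n : ℕ} {x : TwoCycleAlgebra k}
    (h : x ∈ path k i n) : ∃ j, x = α k j := by
  induction n generalizing i with
  | zero => simp [path] at h
  | succ n ih =>
    rcases List.mem_cons.1 h with rfl | h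
    · exact ⟨_, rfl⟩
    · exact ih h

/-- For i ≠ j, evaluating the coboundary of a constant at e_i returns the constant itself. -/
theorem scalar_eq_zero {i j : TwoCycle}
    (f : MultilinearMap k (fun _ : Fin 0 => TwoCycleAlgebra k) k)
    (hd : ∀ x, scalarDelta i j (onList f) [x] = 0) (hp : i = j → onList f [] = 0) :
    onList f [] = 0 := by
  by_cases h : i = j
  · exact hp h
  · simpa [scalarDelta, Ne.symm h] using hd (e k i)

/-- Inserting e_i in front is almost a contracting homotopy: the defect is that e_i x has a
component along α i besides the one along e_i. -/
theorem onList_eq_scalarDelta_add {n : ℕ} {i j : TwoCycle}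
    (f : MultilinearMap k (fun _ : Fin (n + 1) => TwoCycleAlgebra k) k) (x : TwoCycleAlgebra k)
    (l : List (TwoCycleAlgebra k))
    (hd : scalarDelta i j (onList f) (e k i :: x :: l) = 0) :
    onList f (x :: l) = scalarDelta i j (onList (n := n) (f.curryLeft (e k i))) (x :: l) +
      coeffα k i x * onList f (α k i :: l) := by
  have h : e k i * x = coeffE k i x • e k i + coeffα k i x • α k i :=
    ext_coeff (fun j => by by_cases h : i = j <;> simp [coeffE_mul, h, eq_comm])
      (fun j => by by_cases h : i = j <;> simp [coeffα_mul, h, eq_comm])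
  obtain ⟨L, hL⟩ := exists_linear_onList_cons f l
  rw [scalarDelta_cons, contractSum_cons_cons, h, hL (_ + _), map_add, map_smul, map_smul, ← hL,
    ← hL] at hd
  simp only [coeffE_e, if_true, one_mul, smul_eq_mul] at hd
  rw [scalarDelta_cons, funext (onList_curryLeft f (e k i))]
  linear_combination hd

/-- Since α i kills the left action through e_i and α_i x is a multiple of α i by the coefficient of
e_{i+1} in x, fixing α i as first argument yields a cocycle with left action at the next vertex.
This drives the induction along a path. -/
theorem scalarDelta_curryLeft_α {n : ℕ} {i j : TwoCycle}
    (f : MultilinearMap k (fun _ : Fin (n + 1) => TwoCycleAlgebra k) k) (x : TwoCycleAlgebra k)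
    (l : List (TwoCycleAlgebra k))
    (hd : scalarDelta i j (onList f) (α k i :: x :: l) = 0) :
    scalarDelta (i + 1) j (onList (n := n) (f.curryLeft (α k i))) (x :: l) = 0 := by
  have h : α k i * x = coeffE k (i + 1) x • α k i :=
    ext_coeff (fun j => by simp [coeffE_mul])
      (fun j => by by_cases h : i = j <;> simp [coeffα_mul, h, eq_comm])
  obtain ⟨L, hL⟩ := exists_linear_onList_cons f l
  rw [scalarDelta_cons, contractSum_cons_cons, h, hL (_ • _), map_smul, ← hL] at hd
  simp only [coeffE_α, zero_mul, smul_eq_mul] at hd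
  rw [scalarDelta_cons, funext (onList_curryLeft f (α k i))]
  linear_combination -hd

/-- Prefixing the coefficient of α i moves the left vertex back from i + 1 to i and anticommutes
with the differential; it carries primitives back along the recursion. -/
theorem scalarDelta_consForm {n : ℕ} {i j : TwoCycle}
    (f : MultilinearMap k (fun _ : Fin n => TwoCycleAlgebra k) k) (x y : TwoCycleAlgebra k)
    (l : List (TwoCycleAlgebra k)) :
    scalarDelta i j (onList (consForm (coeffα k i) f)) (x :: y :: l) =
      -(coeffα k i x * scalarDelta (i + 1) j (onList f) (y :: l)) := by
  have h := map_contractSum (AddMonoidHom.mulLeft (coeffα k i x)) (onList f)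
    (fun t z => onList f t * coeffE k j z) (y :: l)
  simp only [AddMonoidHom.coe_mulLeft] at h
  rw [scalarDelta_cons, contractSum_cons_cons, scalarDelta_cons]
  simp only [onList_consForm, mul_assoc, ← h, coeffα_mul]
  ring

/-- Exactness of the Hochschild complex with simple coefficients, up to the value on paths. -/
theorem exists_scalar_primitive {n : ℕ} {i j : TwoCycle}
    (f : MultilinearMap k (fun _ : Fin (n + 1) => TwoCycleAlgebra k) k) (hf : Normalized f)
    (hd : ∀ l : List (TwoCycleAlgebra k), l.length = n + 2 → scalarDelta i j (onList f) l = 0)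
    (hp : i + ((n + 1 : ℕ) : TwoCycle) = j → onList f (path k i (n + 1)) = 0) :
    ∃ g : MultilinearMap k (fun _ : Fin n => TwoCycleAlgebra k) k, Normalized g ∧
      ∀ l : List (TwoCycleAlgebra k), l.length = n + 1 →
        onList f l = scalarDelta i j (onList g) l := by
  have hc : ∀ l : List (TwoCycleAlgebra k), l.length = n + 1 →
      scalarDelta (i + 1) j (onList (n := n) (f.curryLeft (α k i))) l = 0 := by
    rintro (_ | ⟨x, l⟩) hl
    · simp at hl
    · exact scalarDelta_curryLeft_α f x l (hd _ (by simpa using hl))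
  induction n generalizing i with
  | zero =>
    -- In degree one the defect f(α i) is a constant: it vanishes by the degree zero lemma unless i
    -- + 1 = j, where the hypothesis on the path of length one applies.
    have h0 := scalar_eq_zero (f.curryLeft (α k i)) (fun x => hc [x] rfl) (fun h => by
      rw [onList_curryLeft]
      exact hp (by simpa using h))
    refine ⟨f.curryLeft (e k i), hf.curryLeft _, ?_⟩
    rintro (_ | ⟨x, l⟩) hl
    · simp at hl
    · obtain rfl : l = [] := by simpa using hl
      rw [onList_curryLeft] at h0
      rw [onList_eq_scalarDelta_add f x [] (hd _ rfl), h0, mul_zero, add_zero]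
  | succ n ih =>
    obtain ⟨g, hg, hg'⟩ := ih (i := i + 1) (f.curryLeft (α k i)) (hf.curryLeft _) hc
      (fun h => by
        rw [onList_curryLeft]
        refine hp ?_
        rw [← h]
        push_cast
        ring)
      (by
        rintro (_ | ⟨x, l⟩) hl
        · simp at hl
        · exact scalarDelta_curryLeft_α _ x l (hc _ (by simpa using hl)))
    -- The homotopy term f(e_i, ·), corrected by a primitive g of f(α i, ·) from the induction. The
    -- minus sign compensates the anticommutation of prefixing with the differential.
    refine ⟨f.curryLeft (e k i) - consForm (coeffα k i) g, fun l hl h1 => ?_, ?_⟩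
    · have h2 := hf.curryLeft (e k i) l hl h1
      have h3 := Normalized.consForm (coeffα_one k i) hg l hl h1
      change onList (n := n + 1) (f.curryLeft (e k i)) l - onList (consForm (coeffα k i) g) l = 0
      rw [h2, h3, sub_zero]
    · rintro (_ | ⟨x, _ | ⟨y, l⟩⟩) hl
      · simp at hl
      · simp at hl
      · have h4 := hg' (y :: l) (by simpa using hl)
        rw [onList_curryLeft] at h4
        change _ = scalarDelta i j (fun t => onList (n := n + 1) (f.curryLeft (e k i)) t -
          onList (consForm (coeffα k i) g) t) (x :: y :: l)
        rw [scalarDelta_sub, scalarDelta_consForm, ← h4,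
          onList_eq_scalarDelta_add f x _ (hd _ (by simpa using hl))]
        ring

end Scalar

end TwoCycleAlgebra

/-! ### The Hochschild coboundary squares to zero -/

section DeltaDelta

variable {A : Type*} [Ring A]

/-- This is the part of δ² = 0 without the left action, by recursion on the first argument. -/
theorem contractSum_contractSum (F : List A → A) (l : List A) :
    contractSum (contractSum F fun t y => F t * y)
      (fun t y => contractSum F (fun t y => F t * y) t * y) l = 0 := by
  induction l generalizing F with
  | nil => rfl
  | cons x l ih =>
    cases l with
    | nil => simp
    | cons y l =>
      -- `G` multiplies x into the first remaining entry. When none remains, x becomes the right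
      -- factor of the value; this boundary case is what makes the recursion uniform.
      let G : List A → A := fun t => match t with
        | [] => F [] * x
        | z :: t => F (x * z :: t)
      have h1 : ∀ t, contractSum F (fun t y => F t * y) (x :: t) =
          G t - contractSum (fun t => F (x :: t)) (fun t y => F (x :: t) * y) t := by
        intro t
        cases t with
        | nil => simp [G]
        | cons z t => rfl
      have h2 : contractSum G (fun t y => G t * y) (y :: l) =
          contractSum F (fun t y => F t * y) (x * y :: l) := by
        cases l with
        | nil => simp [G, mul_assoc]
        | cons z l => simp [G, contractSum_cons_cons, mul_assoc]
      rw [contractSum_cons_cons]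
      simp only [h1, sub_mul, contractSum_sub]
      rw [h2, ih (fun t => F (x :: t)), sub_zero, sub_self]

variable {k : Type*} [Field k] [Algebra k A]

theorem delta_delta {n : ℕ} (f : Cochain k A n) : delta k A (n + 1) (delta k A n f) = 0 :=
  cochain_ext_list fun l hl => by
    match l, hl with
    | x :: y :: l, hl =>
      let F := onList f.1
      let G : List A → A := fun t => match t with
        | [] => 0
        | z :: t => z * F t
      have h1 : ∀ t : List A, t.length = n + 1 → onList (delta k A n f).1 t =
          G t - contractSum F (fun t y => F t * y) t := by
        rintro (_ | ⟨z, t⟩) ht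
        · simp at ht
        · exact onList_delta f z t (by simpa using ht)
      have h2 := map_contractSum (AddMonoidHom.mulLeft x) F (fun t y => F t * y) (y :: l)
      simp only [AddMonoidHom.coe_mulLeft, ← mul_assoc] at h2
      simp only [List.length_cons, add_left_inj] at hl
      rw [onList_delta _ _ _ (by simpa using hl), h1 _ (by simpa using hl),
        contractSum_congr (F' := fun t => G t - contractSum F (fun t y => F t * y) t)
          (T' := fun t y => G t * y - contractSum F (fun t y => F t * y) t * y)
          (fun t ht => h1 t (by simp at ht; omega))
          (fun t y ht => by rw [h1 t (by simp at ht; omega), sub_mul]),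
        contractSum_sub, contractSum_contractSum, contractSum_cons_cons]
      simp only [G]
      rw [← h2]
      simp [onList, mul_assoc, mul_sub]

end DeltaDelta

namespace TwoCycleAlgebra

universe u

variable {k : Type u} [Field k]

/-! ### From simple coefficients to coefficients in A -/

section Cochains

/-- The product of the coefficients of `α i, α (i + 1), …` in the arguments. -/
noncomputable def arrowForm (k : Type u) [Field k] : (n : ℕ) → TwoCycle →
    MultilinearMap k (fun _ : Fin n => TwoCycleAlgebra k) k
  | 0, _ => MultilinearMap.constOfIsEmpty k _ 1
  | n + 1, i => consForm (coeffα k i) (arrowForm k n (i + 1))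

@[simp] theorem onList_arrowForm_nil (i : TwoCycle) : onList (arrowForm k 0 i) [] = 1 := rfl

theorem onList_arrowForm_cons (n : ℕ) (i : TwoCycle) (x : TwoCycleAlgebra k)
    (l : List (TwoCycleAlgebra k)) :
    onList (arrowForm k (n + 1) i) (x :: l) = coeffα k i x * onList (arrowForm k n (i + 1)) l :=
  onList_consForm _ _ _ _

theorem onList_arrowForm_append {m n : ℕ} (i : TwoCycle) (l₁ l₂ : List (TwoCycleAlgebra k))
    (h : l₁.length = m) : onList (arrowForm k (m + n) i) (l₁ ++ l₂) =
      onList (arrowForm k m i) l₁ * onList (arrowForm k n (i + m)) l₂ := by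
  induction m generalizing i l₁ with
  | zero =>
    obtain rfl := List.length_eq_zero_iff.1 h
    simp
    rw [Nat.zero_add]
  | succ m ih =>
    match l₁, h with
    | x :: l₁, h =>
      have h3 : i + 1 + (m : TwoCycle) = i + ((m + 1 : ℕ) : TwoCycle) := by push_cast; ring
      have h2 : onList (arrowForm k (m + 1 + n) i) (x :: (l₁ ++ l₂)) =
          coeffα k i x * onList (arrowForm k (m + n) (i + 1)) (l₁ ++ l₂) := by
        rw [← onList_arrowForm_cons]
        have : m + 1 + n = m + n + 1 := by omega
        rw [this]
      rw [List.cons_append, h2, ih _ _ (by simpa using h), onList_arrowForm_cons, mul_assoc, h3]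

theorem onList_arrowForm_path (n : ℕ) (i : TwoCycle) :
    onList (arrowForm k n i) (path k i n) = 1 := by
  induction n generalizing i with
  | zero => rfl
  | succ n ih => simp [path_succ, onList_arrowForm_cons, ih]

theorem normalized_arrowForm (n : ℕ) (i : TwoCycle) : Normalized (arrowForm k n i) := by
  induction n generalizing i with
  | zero =>
    intro l hl h
    obtain rfl := List.length_eq_zero_iff.1 hl
    simp at h
  | succ n ih => exact Normalized.consForm (coeffα_one k i) (ih _)

theorem scalarDelta_arrowForm (n : ℕ) (i : TwoCycle) (x : TwoCycleAlgebra k)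
    (l : List (TwoCycleAlgebra k)) (h : l.length = n) :
    scalarDelta i (i + n) (onList (arrowForm k n i)) (x :: l) = 0 := by
  induction n generalizing i x l with
  | zero =>
    obtain rfl := List.length_eq_zero_iff.1 h
    simp [scalarDelta_cons]
  | succ n ih =>
    match l, h with
    | y :: l, h =>
      have h3 : i + 1 + (n : TwoCycle) = i + ((n + 1 : ℕ) : TwoCycle) := by push_cast; ring
      have := ih (i + 1) y l (by simpa using h)
      rw [arrowForm, scalarDelta_consForm, ← h3, this, mul_zero, neg_zero]

/-- The cochain `(a₁, …, a_n) ↦ f(a₁, …, a_n) z`. -/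
noncomputable def scalarCochain {n : ℕ}
    (f : MultilinearMap k (fun _ : Fin n => TwoCycleAlgebra k) k) (hf : Normalized f)
    (z : TwoCycleAlgebra k) : Cochain k (TwoCycleAlgebra k) n :=
  ⟨f.smulRight z, fun a i h => by
    have := hf (List.ofFn a) (by simp) (h ▸ List.mem_ofFn.2 ⟨i, rfl⟩)
    rw [onList_ofFn] at this
    rw [MultilinearMap.smulRight_apply, this, zero_smul]⟩

@[simp] theorem onList_scalarCochain {n : ℕ}
    (f : MultilinearMap k (fun _ : Fin n => TwoCycleAlgebra k) k) (hf : Normalized f)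
    (z : TwoCycleAlgebra k) (l : List (TwoCycleAlgebra k)) :
    onList (scalarCochain f hf z).1 l = onList f l • z := rfl

theorem onList_add_cochain {n : ℕ} (f g : Cochain k (TwoCycleAlgebra k) n)
    (l : List (TwoCycleAlgebra k)) : onList (f + g).1 l = onList f.1 l + onList g.1 l := rfl

theorem onList_smul_cochain {n : ℕ} (c : k) (f : Cochain k (TwoCycleAlgebra k) n)
    (l : List (TwoCycleAlgebra k)) : onList (c • f).1 l = c • onList f.1 l := rfl

theorem onList_sum_cochain {n : ℕ} (f : TwoCycle → Cochain k (TwoCycleAlgebra k) n)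
    (l : List (TwoCycleAlgebra k)) : onList (∑ i, f i).1 l = ∑ i, onList (f i).1 l := by
  simp only [TwoCycle.sum_eq, onList_add_cochain]

theorem normalized_comp (L : TwoCycleAlgebra k →ₗ[k] k) {n : ℕ}
    (f : Cochain k (TwoCycleAlgebra k) n) : Normalized (L.compMultilinearMap f.1) := by
  intro l hl h
  obtain ⟨i, hi⟩ := entries_eq_of_mem hl h
  rw [onList, LinearMap.compMultilinearMap_apply, f.2 _ i hi, map_zero]

theorem coeffE_delta {n : ℕ} (f : Cochain k (TwoCycleAlgebra k) n) (i : TwoCycle)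
    (x : TwoCycleAlgebra k) (l : List (TwoCycleAlgebra k)) (h : l.length = n) :
    coeffE k i (onList (delta k _ n f).1 (x :: l)) =
      scalarDelta i i (fun t => coeffE k i (onList f.1 t)) (x :: l) := by
  have := map_contractSum (coeffE k i).toAddMonoidHom (onList f.1) (fun t y => onList f.1 t * y)
    (x :: l)
  simp only [LinearMap.toAddMonoidHom_coe, coeffE_mul] at this
  rw [onList_delta f _ _ h, map_sub, this, coeffE_mul, scalarDelta_cons]

/-- The last bracket is the extension of A/rad A by rad A: coefficients on the idempotents feed into
those on the arrows, through the left action on one end and the right action on the other. -/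
theorem coeffα_delta {n : ℕ} (f : Cochain k (TwoCycleAlgebra k) n) (i : TwoCycle)
    (x y : TwoCycleAlgebra k) (l l' : List (TwoCycleAlgebra k)) (h : l.length = n)
    (h' : x :: l = l' ++ [y]) :
    coeffα k i (onList (delta k _ n f).1 (x :: l)) =
      scalarDelta i (i + 1) (fun t => coeffα k i (onList f.1 t)) (x :: l) +
        (coeffα k i x * coeffE k (i + 1) (onList f.1 l) -
          (-1 : ℤ) ^ n • (coeffE k i (onList f.1 l') * coeffα k i y)) := by
  have hl' : l'.length = n := by
    have := congrArg List.length h'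
    simp only [List.length_cons, List.length_append, List.length_nil] at this
    omega
  have := map_contractSum (coeffα k i).toAddMonoidHom (onList f.1) (fun t y => onList f.1 t * y)
    (x :: l)
  simp only [LinearMap.toAddMonoidHom_coe, coeffα_mul] at this
  rw [onList_delta f _ _ h, map_sub, this, coeffα_mul, scalarDelta_cons, h', contractSum_snoc,
    contractSum_snoc, hl', smul_add]
  ring

theorem coeffα_delta_of_coeffE {n : ℕ} (f : Cochain k (TwoCycleAlgebra k) n)
    (hf : ∀ (l : List (TwoCycleAlgebra k)) (i : TwoCycle), l.length = n →
      coeffE k i (onList f.1 l) = 0) (i : TwoCycle)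
    (x : TwoCycleAlgebra k) (l : List (TwoCycleAlgebra k)) (h : l.length = n) :
    coeffα k i (onList (delta k _ n f).1 (x :: l)) =
      scalarDelta i (i + 1) (fun t => coeffα k i (onList f.1 t)) (x :: l) := by
  obtain ⟨l', y, h'⟩ : ∃ l' y, x :: l = l' ++ [y] :=
    ⟨_, _, (List.dropLast_append_getLast (List.cons_ne_nil x l)).symm⟩
  have hl' : l'.length = n := by
    have := congrArg List.length h'
    simp only [List.length_cons, List.length_append, List.length_nil] at this
    omega
  rw [coeffα_delta f i x y l l' h h', hf l _ h, hf l' _ hl']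
  simp

/-- All inner contractions contain α α = 0, so only the outer actions of the two end arrows remain.
-/
theorem onList_delta_path {n : ℕ} (f : Cochain k (TwoCycleAlgebra k) n) (i : TwoCycle) :
    onList (delta k _ n f).1 (path k i (n + 1)) =
      α k i * onList f.1 (path k (i + 1) n) -
        (-1 : ℤ) ^ n • (onList f.1 (path k i n) * α k (i + n)) := by
  rw [path_succ, onList_delta f _ _ (length_path _ _), ← path_succ, path_snoc,
    contractSum_eq_of_contract_eq_zero _ _ _ _ fun l₁ x z l₂ h => ?_, length_path]
  have hx : x ∈ path k i (n + 1) := by rw [path_snoc, h]; simp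
  have hz : z ∈ path k i (n + 1) := by rw [path_snoc, h]; simp
  obtain ⟨a, rfl⟩ := exists_eq_α_of_mem_path hx
  obtain ⟨b, rfl⟩ := exists_eq_α_of_mem_path hz
  have hlen := congrArg List.length h
  simp at hlen
  exact onList_eq_zero_of_mem _ (by simp; omega) (by simp [α_mul_α])

theorem coeffE_delta_path {n : ℕ} (f : Cochain k (TwoCycleAlgebra k) n) (i j : TwoCycle) :
    coeffE k j (onList (delta k _ n f).1 (path k i (n + 1))) = 0 := by
  simp [onList_delta_path, coeffE_mul]

/-- The connecting map on path values. It forces the two idempotent coefficients of an even cocycle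
to agree, and lets an odd coboundary change only the difference of the two arrow coefficients. -/
theorem coeffα_delta_path {n : ℕ} (hn : Even n) (f : Cochain k (TwoCycleAlgebra k) n)
    (i : TwoCycle) : coeffα k i (onList (delta k _ n f).1 (path k i (n + 1))) =
      coeffE k (i + 1) (onList f.1 (path k (i + 1) n)) - coeffE k i (onList f.1 (path k i n)) := by
  simp [onList_delta_path, coeffα_mul, TwoCycle.cast_even hn, hn]

theorem coeffE_path_eq {n : ℕ} (hn : Even n) {f : Cochain k (TwoCycleAlgebra k) n}
    (hf : delta k _ n f = 0) (i : TwoCycle) :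
    coeffE k i (onList f.1 (path k i n)) = coeffE k 0 (onList f.1 (path k 0 n)) := by
  have := coeffα_delta_path hn f 0
  rw [hf] at this
  rcases i.exhaust with rfl | rfl
  · rfl
  · simpa [onList, sub_eq_zero] using this.symm

/-- Each idempotent coefficient is a cocycle with coefficients in the simple bimodule at (i, i). A
path of length n + 1 returns to i only for n + 1 even, and then the obstructions at the two vertices
coincide. -/
theorem exists_coeffE_primitive {n : ℕ} {f : Cochain k (TwoCycleAlgebra k) (n + 1)}
    (hf : delta k _ _ f = 0)
    (h : Even (n + 1) → coeffE k 0 (onList f.1 (path k 0 (n + 1))) = 0) :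
    ∃ g : Cochain k (TwoCycleAlgebra k) n, ∀ (l : List (TwoCycleAlgebra k)) (i : TwoCycle),
      l.length = n + 1 → coeffE k i (onList (f + delta k _ n g).1 l) = 0 := by
  have key : ∀ i : TwoCycle, _ := fun i =>
    exists_scalar_primitive (i := i) (j := i) ((coeffE k i).compMultilinearMap f.1)
      (normalized_comp (coeffE k i) f)
      (fun l hl => by
        match l, hl with
        | x :: l, hl =>
          have := coeffE_delta f i x l (by simpa using hl)
          rw [hf] at this
          exact this.symm.trans (map_zero _))
      (fun hi => by
        rcases Nat.even_or_odd (n + 1) with hn | hn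
        · exact (coeffE_path_eq hn hf i).trans (h hn)
        · rw [TwoCycle.cast_odd hn] at hi
          exact absurd hi (TwoCycle.add_one_ne i))
  choose g hg hg' using key
  refine ⟨(-1 : k) • ∑ i, scalarCochain (g i) (hg i) (e k i), fun l i hl => ?_⟩
  match l, hl with
  | x :: l, hl =>
    rw [onList_add_cochain, map_smul, onList_smul_cochain, map_add, map_smul,
      coeffE_delta _ _ _ _ (by simpa using hl), neg_one_smul, ← sub_eq_add_neg, sub_eq_zero]
    refine (hg' i _ hl).trans (scalarDelta_congr i i _ fun t _ => ?_)
    rw [onList_sum_cochain]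
    simp

/-- For a cocycle with values in the radical the arrow coefficients are cocycles with coefficients
at (i, i + 1), so the obstruction lives on paths of odd length. -/
theorem exists_primitive_of_coeffE {n : ℕ} {f : Cochain k (TwoCycleAlgebra k) (n + 1)}
    (hf : delta k _ _ f = 0)
    (hE : ∀ (l : List (TwoCycleAlgebra k)) (i : TwoCycle), l.length = n + 1 →
      coeffE k i (onList f.1 l) = 0)
    (h : Odd (n + 1) → ∀ i, coeffα k i (onList f.1 (path k i (n + 1))) = 0) :
    ∃ g : Cochain k (TwoCycleAlgebra k) n, delta k _ n g = f := by
  have key : ∀ i : TwoCycle, _ := fun i =>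
    exists_scalar_primitive (i := i) (j := i + 1) ((coeffα k i).compMultilinearMap f.1)
      (normalized_comp (coeffα k i) f)
      (fun l hl => by
        match l, hl with
        | x :: l, hl =>
          have := coeffα_delta_of_coeffE f hE i x l (by simpa using hl)
          rw [hf] at this
          exact this.symm.trans (map_zero _))
      (fun hi => by
        rcases Nat.even_or_odd (n + 1) with hn | hn
        · rw [TwoCycle.cast_even hn, add_zero] at hi
          exact absurd hi.symm (TwoCycle.add_one_ne i)
        · exact h hn i)
  choose g hg hg' using key
  have hz : ∀ (l : List (TwoCycleAlgebra k)) (i : TwoCycle), l.length = n →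
      coeffE k i (onList (∑ i, scalarCochain (g i) (hg i) (α k i)).1 l) = 0 := fun l i _ => by
    rw [onList_sum_cochain]
    simp
  refine ⟨∑ i, scalarCochain (g i) (hg i) (α k i), cochain_ext_list fun l hl => ?_⟩
  match l, hl with
  | x :: l, hl =>
    refine ext_coeff (fun i => ?_) (fun i => ?_)
    · rw [hE _ i hl, coeffE_delta _ _ _ _ (by simpa using hl),
        scalarDelta_congr i i _ fun t ht => hz t i (by simp at ht hl; omega), scalarDelta_zero]
    · rw [coeffα_delta_of_coeffE _ hz i x l (by simpa using hl)]
      refine ((hg' i _ hl).trans (scalarDelta_congr i (i + 1) _ fun t _ => ?_)).symm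
      rw [onList_sum_cochain]
      simp

/-- A cocycle of positive degree whose values on paths have no relevant coefficient is a
coboundary. -/
theorem exists_primitive {n : ℕ} {f : Cochain k (TwoCycleAlgebra k) (n + 1)}
    (hf : delta k _ _ f = 0)
    (hE : Even (n + 1) → coeffE k 0 (onList f.1 (path k 0 (n + 1))) = 0)
    (hα : Odd (n + 1) → ∑ i, coeffα k i (onList f.1 (path k i (n + 1))) = 0) :
    ∃ g : Cochain k (TwoCycleAlgebra k) n, delta k _ n g = f := by
  obtain ⟨g₁, hg₁⟩ := exists_coeffE_primitive hf hE
  rcases Nat.even_or_odd (n + 1) with hn | hn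
  · obtain ⟨g, hg⟩ := exists_primitive_of_coeffE (f := f + delta k _ n g₁)
      (by rw [map_add, hf, delta_delta, add_zero]) hg₁
      (fun h => absurd hn (Nat.not_even_iff_odd.2 h))
    exact ⟨g + (-1 : k) • g₁, by
      rw [map_add, hg, map_smul]
      refine cochain_ext_list fun l _ => ?_
      simp only [onList_add_cochain, onList_smul_cochain]
      module⟩
  · have hn' : Even n := by simpa [parity_simps] using hn
    -- The coboundary of this cochain has values in the radical, and its relevant coefficients on
    -- the paths starting at 0 and at 1 are -1 and +1. The two remaining obstructions of f + δg₁ are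
    -- t and -t, since their sum vanishes, so adding t • δg₂ removes both.
    let g₂ : Cochain k (TwoCycleAlgebra k) n :=
      scalarCochain (arrowForm k n 0) (normalized_arrowForm n 0) (e k 0)
    have hg₂ : ∀ (l : List (TwoCycleAlgebra k)) (i : TwoCycle), l.length = n + 1 →
        coeffE k i (onList (delta k _ n g₂).1 l) = 0 := by
      rintro (_ | ⟨x, l⟩) i hl
      · simp at hl
      · rw [coeffE_delta _ _ _ _ (by simpa using hl)]
        rcases i.exhaust with rfl | rfl
        · have := scalarDelta_arrowForm n 0 x l (by simpa using hl)
          rw [TwoCycle.cast_even hn', add_zero] at this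
          rw [← this]
          exact scalarDelta_congr _ _ _ fun t _ => by simp [g₂]
        · rw [← scalarDelta_zero 1 1 (x :: l)]
          exact scalarDelta_congr _ _ _ fun t _ => by simp [g₂]
    set t := coeffα k 0 (onList (f + delta k _ n g₁).1 (path k 0 (n + 1))) with ht
    obtain ⟨g, hg⟩ := exists_primitive_of_coeffE (f := f + delta k _ n g₁ + t • delta k _ n g₂)
      (by rw [map_add, map_smul, map_add, hf, delta_delta, delta_delta]; simp)
      (fun l i hl => by
        rw [onList_add_cochain, onList_smul_cochain, map_add, hg₁ l i hl, map_smul, hg₂ l i hl,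
          smul_zero, add_zero])
      (fun _ => by
        have h2 := hα hn
        rw [TwoCycle.sum_eq] at h2
        have h0 : coeffα k 0 (onList (f + delta k _ n g₁ + t • delta k _ n g₂).1
            (path k 0 (n + 1))) = 0 := by
          rw [onList_add_cochain, map_add, ← ht, onList_smul_cochain, map_smul,
            coeffα_delta_path hn']
          simp [g₂, onList_arrowForm_path]
        have h1 : coeffα k 1 (onList (f + delta k _ n g₁ + t • delta k _ n g₂).1
            (path k 1 (n + 1))) = 0 := by
          rw [onList_add_cochain, map_add, onList_smul_cochain, map_smul,
            coeffα_delta_path hn', ht, onList_add_cochain, onList_add_cochain, map_add, map_add,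
            coeffα_delta_path hn', coeffα_delta_path hn']
          simp only [TwoCycle.one_add_one, zero_add, g₂, onList_scalarCochain,
            onList_arrowForm_path, one_smul, coeffE_e, map_smul, smul_eq_mul, if_true,
            one_ne_zero, if_false, mul_zero, sub_zero, mul_one]
          linear_combination h2
        intro i
        rcases i.exhaust with rfl | rfl
        · exact h0
        · exact h1)
    exact ⟨g + (-1 : k) • g₁ + (-t) • g₂, by
      rw [map_add, map_add, hg, map_smul, map_smul]
      refine cochain_ext_list fun l _ => ?_
      simp only [onList_add_cochain, onList_smul_cochain]
      module⟩

/-- The analogue in degree zero of the existence of a primitive: there is no cochain below, so the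
cocycle itself must vanish. -/
theorem eq_zero_of_delta_eq_zero {f : Cochain k (TwoCycleAlgebra k) 0} (hf : delta k _ _ f = 0)
    (hE : coeffE k 0 (onList f.1 []) = 0) : f = 0 := by
  have hE' : ∀ i, coeffE k i (onList f.1 []) = 0 := fun i => by
    have := coeffE_path_eq (by simp) hf i
    exact this.trans hE
  refine cochain_ext_list fun l hl => ?_
  obtain rfl := List.length_eq_zero_iff.1 hl
  refine ext_coeff (fun i => ?_) (fun i => ?_)
  · rw [hE']; exact (map_zero _).symm
  · refine (scalar_eq_zero (i := i) (j := i + 1) ((coeffα k i).compMultilinearMap f.1)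
      (fun x => ?_) (fun h => absurd h.symm (TwoCycle.add_one_ne i))).trans (map_zero _).symm
    have := coeffα_delta_of_coeffE f (fun l i hl => by
      obtain rfl := List.length_eq_zero_iff.1 hl
      exact hE' i) i x [] rfl
    rw [hf] at this
    exact this.symm.trans (map_zero _)

end Cochains

end TwoCycleAlgebra

namespace TwoCycleAlgebra

universe u

variable {k : Type u} [Field k]

/-! ### Dual representatives in each degree -/

section Representatives

/-- The cochain `(a₁, …, a_n) ↦ (∏ t, coefficient of α (i + t) in a_{t+1}) e_i`. -/
noncomputable def evenPart (k : Type u) [Field k] (n : ℕ) (i : TwoCycle) :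
    Cochain k (TwoCycleAlgebra k) n :=
  scalarCochain (arrowForm k n i) (normalized_arrowForm n i) (e k i)

/-- The cochain sending the path of length `n` starting at `i` to `e i`, for both `i`. -/
noncomputable def evenCochain (k : Type u) [Field k] (n : ℕ) : Cochain k (TwoCycleAlgebra k) n :=
  ∑ i, evenPart k n i

/-- The cochain sending the path of length `n` starting at `i` to `α i`. -/
noncomputable def oddCochain (k : Type u) [Field k] (n : ℕ) (i : TwoCycle) :
    Cochain k (TwoCycleAlgebra k) n :=
  scalarCochain (arrowForm k n i) (normalized_arrowForm n i) (α k i)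

theorem onList_evenCochain (n : ℕ) (l : List (TwoCycleAlgebra k)) :
    onList (evenCochain k n).1 l = ∑ i, onList (arrowForm k n i) l • e k i :=
  onList_sum_cochain _ _

theorem onList_oddCochain (n : ℕ) (i : TwoCycle) (l : List (TwoCycleAlgebra k)) :
    onList (oddCochain k n i).1 l = onList (arrowForm k n i) l • α k i := rfl

theorem onList_evenPart (n : ℕ) (i : TwoCycle) (l : List (TwoCycleAlgebra k)) :
    onList (evenPart k n i).1 l = onList (arrowForm k n i) l • e k i := rfl

theorem coeffE_evenCochain (n : ℕ) (i : TwoCycle) (l : List (TwoCycleAlgebra k)) :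
    coeffE k i (onList (evenCochain k n).1 l) = onList (arrowForm k n i) l := by
  simp [onList_evenCochain]

theorem coeffα_evenCochain (n : ℕ) (i : TwoCycle) (l : List (TwoCycleAlgebra k)) :
    coeffα k i (onList (evenCochain k n).1 l) = 0 := by
  simp [onList_evenCochain]

theorem coeffE_oddCochain (n : ℕ) (i j : TwoCycle) (l : List (TwoCycleAlgebra k)) :
    coeffE k j (onList (oddCochain k n i).1 l) = 0 := by
  simp [onList_oddCochain]

theorem coeffα_oddCochain (n : ℕ) (i j : TwoCycle) (l : List (TwoCycleAlgebra k)) :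
    coeffα k j (onList (oddCochain k n i).1 l) =
      if j = i then onList (arrowForm k n i) l else 0 := by
  simp [onList_oddCochain]

theorem delta_oddCochain {n : ℕ} (hn : Odd n) (i : TwoCycle) :
    delta k _ n (oddCochain k n i) = 0 :=
  cochain_ext_list fun l hl => by
    match l, hl with
    | x :: l, hl =>
      have hl' : l.length = n := by simpa using hl
      refine ext_coeff (fun j => ?_) (fun j => ?_)
      · rw [coeffE_delta _ _ _ _ hl']
        simp only [coeffE_oddCochain]
        exact (scalarDelta_zero _ _ _).trans (map_zero _).symm
      · rw [coeffα_delta_of_coeffE _ (fun l j _ => coeffE_oddCochain n i j l) _ _ _ hl']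
        simp only [coeffα_oddCochain]
        refine Eq.trans ?_ (map_zero _).symm
        split_ifs with h
        · subst h
          rw [← TwoCycle.cast_odd hn]
          exact scalarDelta_arrowForm n j x l hl'
        · exact scalarDelta_zero _ _ _

theorem delta_evenCochain {n : ℕ} (hn : Even n) : delta k _ n (evenCochain k n) = 0 :=
  cochain_ext_list fun l hl => by
    match l, hl with
    | x :: l, hl =>
      have hl' : l.length = n := by simpa using hl
      refine ext_coeff (fun j => ?_) (fun j => ?_)
      · rw [coeffE_delta _ _ _ _ hl']
        simp only [coeffE_evenCochain]
        refine Eq.trans ?_ (map_zero _).symm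
        have := scalarDelta_arrowForm n j x l hl'
        rwa [TwoCycle.cast_even hn, add_zero] at this
      · obtain ⟨l', y, h'⟩ : ∃ l' y, x :: l = l' ++ [y] :=
          ⟨_, _, (List.dropLast_append_getLast (List.cons_ne_nil x l)).symm⟩
        have hl'' : l'.length = n := by
          have := congrArg List.length h'
          simp only [List.length_cons, List.length_append, List.length_nil] at this
          omega
        rw [coeffα_delta _ j x y l l' hl' h']
        simp only [coeffα_evenCochain, coeffE_evenCochain, scalarDelta_zero]
        refine Eq.trans ?_ (map_zero _).symm
        -- Peeling off the first or the last argument gives two factorizations of the same product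
        -- of n + 1 arrow coefficients; for n even the last arrow is again α j, so the two extension
        -- terms cancel.
        have h1 := onList_arrowForm_append (n := 1) j l' [y] hl''
        rw [← h', onList_arrowForm_cons, onList_arrowForm_cons, onList_arrowForm_nil, mul_one,
          TwoCycle.cast_even hn, add_zero] at h1
        rw [h1, hn.neg_one_pow, one_smul, sub_self, add_zero]

open Classical in
/-- The cocycle whose class spans the cohomology in degree `n ≥ 0`. -/
noncomputable def cochainRep (k : Type u) [Field k] (n : ℕ) : Cochain k (TwoCycleAlgebra k) n :=
  if Even n then evenCochain k n else oddCochain k n 0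

open Classical in
/-- The cycle whose class spans the cohomology in degree `-p-1`. -/
noncomputable def chainRep (k : Type u) [Field k] (p : ℕ) : Chain k (TwoCycleAlgebra k) p :=
  if Even p then chainOfList k p (α k 0 :: path k 0 p)
  else ∑ i, chainOfList k p (e k (i + 1) :: path k i p)

theorem cochainRep_even {n : ℕ} (hn : Even n) : cochainRep k n = evenCochain k n := if_pos hn

theorem cochainRep_odd {n : ℕ} (hn : Odd n) : cochainRep k n = oddCochain k n 0 :=
  if_neg (Nat.not_even_iff_odd.2 hn)

theorem delta_cochainRep (n : ℕ) : delta k _ n (cochainRep k n) = 0 := by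
  rcases Nat.even_or_odd n with hn | hn
  · rw [cochainRep_even hn, delta_evenCochain hn]
  · rw [cochainRep_odd hn, delta_oddCochain hn]

theorem pairing_chainRep_even {m p : ℕ} (h : m = p) (hp : Even p)
    (f : Cochain k (TwoCycleAlgebra k) m) :
    pairing (frobenius k) h f (chainRep k p) = coeffE k 0 (onList f.1 (path k 0 p)) := by
  rw [chainRep, if_pos hp, pairing_chainOfList, form_α]

theorem pairing_chainRep_odd {m p : ℕ} (h : m = p) (hp : Odd p)
    (f : Cochain k (TwoCycleAlgebra k) m) :
    pairing (frobenius k) h f (chainRep k p) = ∑ i, coeffα k i (onList f.1 (path k i p)) := by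
  rw [chainRep, if_neg (Nat.not_even_iff_odd.2 hp), map_sum]
  simp only [pairing_chainOfList, form_e, TwoCycle.add_one_add_one]

theorem isCycle_chainRep (p : ℕ) : IsCycle (frobenius k) (chainRep k p) := by
  rintro r rfl f
  rcases Nat.even_or_odd (r + 1) with hp | hp
  · rw [pairing_chainRep_even _ hp, coeffE_delta_path]
  · have hr : Even r := by simpa [parity_simps] using hp
    rw [pairing_chainRep_odd _ hp]
    simp only [coeffα_delta_path hr, TwoCycle.sum_eq, TwoCycle.one_add_one, zero_add]
    ring

theorem pairing_oddCochain_chainRep {n : ℕ} (hn : Odd n) (i : TwoCycle) :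
    pairing (frobenius k) rfl (oddCochain k n i) (chainRep k n) = 1 := by
  rw [pairing_chainRep_odd _ hn]
  simp [coeffα_oddCochain, onList_arrowForm_path]

theorem pairing_cochainRep_chainRep (n : ℕ) :
    pairing (frobenius k) rfl (cochainRep k n) (chainRep k n) = 1 := by
  rcases Nat.even_or_odd n with hn | hn
  · rw [cochainRep_even hn, pairing_chainRep_even _ hn, coeffE_evenCochain, onList_arrowForm_path]
  · rw [cochainRep_odd hn, pairing_oddCochain_chainRep hn]

theorem exists_primitive_of_pairing {n : ℕ} {f : Cochain k (TwoCycleAlgebra k) (n + 1)}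
    (hf : delta k _ _ f = 0) (h : pairing (frobenius k) rfl f (chainRep k (n + 1)) = 0) :
    ∃ g : Cochain k (TwoCycleAlgebra k) n, delta k _ n g = f :=
  exists_primitive hf (fun hn => by rwa [pairing_chainRep_even _ hn] at h)
    (fun hn => by rwa [pairing_chainRep_odd _ hn] at h)

theorem eq_zero_of_pairing {f : Cochain k (TwoCycleAlgebra k) 0}
    (hf : delta k _ _ f = 0) (h : pairing (frobenius k) rfl f (chainRep k 0) = 0) : f = 0 :=
  eq_zero_of_delta_eq_zero hf (by rwa [pairing_chainRep_even _ (by simp)] at h)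

/-- The pairing of a cocycle and a cycle depends on the cocycle only through its class. -/
theorem pairing_eq_mul {m p : ℕ} (h : m = p) {f : Cochain k (TwoCycleAlgebra k) m}
    (hf : delta k _ _ f = 0) {x : Chain k (TwoCycleAlgebra k) p} (hx : IsCycle (frobenius k) x) :
    pairing (frobenius k) h f x = pairing (frobenius k) rfl f (chainRep k m) *
      pairing (frobenius k) rfl (cochainRep k p) x := by
  subst h
  -- Subtracting c times the representative gives a cocycle with zero pairing against `chainRep`: in
  -- positive degree a coboundary, which a cycle annihilates, and in degree zero the zero cochain.
  set c := pairing (frobenius k) rfl f (chainRep k m) with hc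
  have h1 : delta k _ _ (f + (-c) • cochainRep k m) = 0 := by
    rw [map_add, map_smul, hf, delta_cochainRep, smul_zero, add_zero]
  have h2 : pairing (frobenius k) rfl (f + (-c) • cochainRep k m) (chainRep k m) = 0 := by
    rw [map_add, map_smul, LinearMap.add_apply, LinearMap.smul_apply, ← hc,
      pairing_cochainRep_chainRep, smul_eq_mul, mul_one, add_neg_cancel]
  have h3 : pairing (frobenius k) rfl (f + (-c) • cochainRep k m) x = 0 := by
    cases m with
    | zero => rw [eq_zero_of_pairing h1 h2, map_zero, LinearMap.zero_apply]
    | succ m =>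
      obtain ⟨g, hg⟩ := exists_primitive_of_pairing h1 h2
      rw [← hg, hx m rfl g]
  rw [map_add, map_smul, LinearMap.add_apply, LinearMap.smul_apply, smul_eq_mul] at h3
  linear_combination h3

/-- The odd cochains at the two vertices pair alike with `chainRep`, hence represent the same class.
This is what lets the sums over vertices in the products of chains factor. -/
theorem pairing_oddCochain {p : ℕ} (hp : Odd p) (i : TwoCycle) {x : Chain k (TwoCycleAlgebra k) p}
    (hx : IsCycle (frobenius k) x) :
    pairing (frobenius k) rfl (oddCochain k p i) x =
      pairing (frobenius k) rfl (cochainRep k p) x := by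
  rw [pairing_eq_mul rfl (delta_oddCochain hp i) hx, pairing_oddCochain_chainRep hp, one_mul]

end Representatives

/-! ### Structure constants of the products -/

section Products

/-- On a path of length m + n the cup product multiplies the values on its two segments. Two odd
factors give a product of elements of the radical, which has no idempotent coefficient. -/
theorem pairing_cup_cochainRep (m n : ℕ) :
    pairing (frobenius k) rfl (cup (cochainRep k m) (cochainRep k n)) (chainRep k (m + n)) =
      if Odd m ∧ Odd n then 0 else 1 := by
  have h := fun i : TwoCycle => onList_cup (cochainRep k m) (cochainRep k n) (path k i m)
    (path k (i + m) n) (length_path i m)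
  simp only [← path_add] at h
  rcases Nat.even_or_odd m with hm | hm <;> rcases Nat.even_or_odd n with hn | hn
  · rw [if_neg (fun H => Nat.not_even_iff_odd.2 H.1 hm), pairing_chainRep_even _ (hm.add hn), h,
      coeffE_mul, cochainRep_even hm, cochainRep_even hn, coeffE_evenCochain, coeffE_evenCochain,
      TwoCycle.cast_even hm, add_zero, onList_arrowForm_path, onList_arrowForm_path, mul_one]
  · rw [if_neg (fun H => Nat.not_even_iff_odd.2 H.1 hm), pairing_chainRep_odd _ (hm.add_odd hn)]
    rw [cochainRep_even hm, cochainRep_odd hn] at h ⊢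
    simp only [h, coeffα_mul, coeffE_evenCochain, coeffα_evenCochain, coeffα_oddCochain,
      TwoCycle.cast_even hm, TwoCycle.sum_eq]
    simp [onList_arrowForm_path]
  · rw [if_neg (fun H => Nat.not_even_iff_odd.2 H.2 hn), pairing_chainRep_odd _ (hm.add_even hn)]
    rw [cochainRep_odd hm, cochainRep_even hn] at h ⊢
    simp only [h, coeffα_mul, coeffE_evenCochain, coeffα_evenCochain, coeffα_oddCochain,
      coeffE_oddCochain, TwoCycle.cast_odd hm, TwoCycle.sum_eq]
    simp [onList_arrowForm_path]
  · rw [if_pos ⟨hm, hn⟩, pairing_chainRep_even _ (hm.add_odd hn), h, coeffE_mul,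
      cochainRep_odd hm, coeffE_oddCochain, zero_mul]

/-- Adjunction views the cup product as a cocycle paired with a cycle, first with f isolated and
then with g, so `pairing_eq_mul` replaces each factor by its representative. -/
theorem pairing_cup {m n : ℕ} {f : Cochain k (TwoCycleAlgebra k) m}
    {g : Cochain k (TwoCycleAlgebra k) n} (hf : delta k _ _ f = 0) (hg : delta k _ _ g = 0) :
    pairing (frobenius k) rfl (cup f g) (chainRep k (m + n)) =
      (if Odd m ∧ Odd n then 0 else 1) * (pairing (frobenius k) rfl f (chainRep k m) *
        pairing (frobenius k) rfl g (chainRep k n)) := by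
  have hν := nakayamaInv_eq_nakayama k
  rw [← pairing_starCochainChain, pairing_eq_mul rfl hf ((isCycle_chainRep _).starCochainChain _ hg),
    pairing_starCochainChain, ← pairing_starChainCochain _ hν,
    pairing_eq_mul rfl hg ((isCycle_chainRep _).starChainCochain _ hν (delta_cochainRep _)),
    pairing_starChainCochain _ hν, pairing_cup_cochainRep]
  ring

theorem pairing_cochainRep_starCochainChain {m q : ℕ} {f : Cochain k (TwoCycleAlgebra k) m}
    (hf : delta k _ _ f = 0) {x : Chain k (TwoCycleAlgebra k) (q + m)}
    (hx : IsCycle (frobenius k) x) :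
    pairing (frobenius k) rfl (cochainRep k q) (starCochainChain f x) =
      (if Odd q ∧ Odd m then 0 else 1) * (pairing (frobenius k) rfl f (chainRep k m) *
        pairing (frobenius k) rfl (cochainRep k _) x) := by
  rw [pairing_starCochainChain, pairing_eq_mul rfl (delta_cup (delta_cochainRep _) hf) hx,
    pairing_cup (delta_cochainRep _) hf, pairing_cochainRep_chainRep]
  ring

theorem pairing_cochainRep_starChainCochain {m q : ℕ} {f : Cochain k (TwoCycleAlgebra k) m}
    (hf : delta k _ _ f = 0) {x : Chain k (TwoCycleAlgebra k) (m + q)}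
    (hx : IsCycle (frobenius k) x) :
    pairing (frobenius k) rfl (cochainRep k q) (starChainCochain (frobenius k) f x) =
      (if Odd m ∧ Odd q then 0 else 1) * (pairing (frobenius k) rfl f (chainRep k m) *
        pairing (frobenius k) rfl (cochainRep k _) x) := by
  rw [pairing_starChainCochain _ (nakayamaInv_eq_nakayama k),
    pairing_eq_mul rfl (delta_cup hf (delta_cochainRep _)) hx,
    pairing_cup hf (delta_cochainRep _), pairing_cochainRep_chainRep]
  ring

theorem onList_arrowForm_middle {m p q : ℕ} (h : m = p + q + 1) (i : TwoCycle)
    (w : TwoCycleAlgebra k) (l l' : List (TwoCycleAlgebra k)) (hl' : l'.length = q) :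
    onList (arrowForm k m i) (l' ++ w :: l) =
      onList (arrowForm k q i) l' * (coeffα k (i + q) w * onList (arrowForm k p (i + q + 1)) l) := by
  obtain rfl : m = q + (p + 1) := by omega
  rw [onList_arrowForm_append _ _ _ hl', onList_arrowForm_cons]

/-- Of the four dual pairs (uᵢ, vᵢ) only (α 1, e 1) contributes: the arguments select α 1 at
position q, and pairing the value α 0 with vᵢ b reads off the coefficient of e 1. -/
theorem pairing_oddCochain_starChainChain {p q : ℕ} (hq : Odd q)
    (x : Chain k (TwoCycleAlgebra k) p) (y : Chain k (TwoCycleAlgebra k) q) :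
    pairing (frobenius k) rfl (oddCochain k (p + q + 1) 0) (starChainChain (frobenius k) p q x y) =
      pairing (frobenius k) rfl (oddCochain k p 0) x *
        pairing (frobenius k) rfl (oddCochain k q 0) y := by
  induction x using chain_induction with
  | mk a l hl =>
    induction y using chain_induction with
    | mk b l' hl' =>
      rw [pairing_starChainChain_chainOfList _ _ _ _ _ _ _ hl', pairing_chainOfList,
        pairing_chainOfList, Fintype.sum_sum_type]
      simp only [frobenius_u_inl, frobenius_u_inr, frobenius_v_inl, frobenius_v_inr,
        onList_oddCochain, onList_arrowForm_middle (p := p) rfl _ _ _ _ hl', map_smul, smul_eq_mul,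
        LinearMap.smul_apply, α_form, TwoCycle.sum_eq, coeffα_mul, coeffE_mul,
        TwoCycle.cast_odd hq, coeffE_nakayama, coeffα_nakayama]
      simp [TwoCycle.one_add_one]
      ring
    | add x y hx hy => simp only [map_add, hx, hy, mul_add]
  | add x y hx hy => simp only [map_add, LinearMap.add_apply, hx, hy, add_mul]

/-- For q even the arguments select α 0 as uᵢ, paired with e 0, whereas the value α 0 detects only
the coefficient of e 1; no dual pair satisfies both. -/
theorem pairing_oddCochain_starChainChain_even {p q : ℕ} (hq : Even q)
    (x : Chain k (TwoCycleAlgebra k) p) (y : Chain k (TwoCycleAlgebra k) q) :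
    pairing (frobenius k) rfl (oddCochain k (p + q + 1) 0) (starChainChain (frobenius k) p q x y) =
      0 := by
  induction x using chain_induction with
  | mk a l hl =>
    induction y using chain_induction with
    | mk b l' hl' =>
      rw [pairing_starChainChain_chainOfList _ _ _ _ _ _ _ hl', Fintype.sum_sum_type]
      simp only [frobenius_u_inl, frobenius_u_inr, frobenius_v_inl, frobenius_v_inr,
        onList_oddCochain, onList_arrowForm_middle (p := p) rfl _ _ _ _ hl', map_smul, smul_eq_mul,
        LinearMap.smul_apply, α_form, TwoCycle.sum_eq, coeffα_mul, coeffE_mul,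
        TwoCycle.cast_even hq, coeffE_nakayama, coeffα_nakayama]
      simp [TwoCycle.one_add_one]
    | add x y hx hy => simp only [map_add, hx, hy, add_zero]
  | add x y hx hy => simp only [map_add, LinearMap.add_apply, hx, hy, add_zero]

/-- For the component at e i only the dual pair (α i, e i) survives, and ν shifts the index of the
idempotent coefficient read off from a; hence the i + 1 in the first factor. -/
theorem pairing_evenCochain_starChainChain_of_even {p q : ℕ} (hq : Even q)
    (x : Chain k (TwoCycleAlgebra k) p) (y : Chain k (TwoCycleAlgebra k) q) :
    pairing (frobenius k) rfl (evenCochain k (p + q + 1)) (starChainChain (frobenius k) p q x y) =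
      ∑ i, pairing (frobenius k) rfl (oddCochain k p (i + 1)) x *
        pairing (frobenius k) rfl (evenPart k q i) y := by
  induction x using chain_induction with
  | mk a l hl =>
    induction y using chain_induction with
    | mk b l' hl' =>
      rw [pairing_starChainChain_chainOfList _ _ _ _ _ _ _ hl', Fintype.sum_sum_type]
      simp only [pairing_chainOfList, frobenius_u_inl, frobenius_u_inr, frobenius_v_inl,
        frobenius_v_inr, onList_evenCochain, onList_oddCochain, onList_evenPart,
        onList_arrowForm_middle (p := p) rfl _ _ _ _ hl', map_smul, smul_eq_mul, map_add,
        LinearMap.add_apply, LinearMap.smul_apply, α_form, e_form, TwoCycle.sum_eq, coeffα_mul,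
        TwoCycle.cast_even hq, coeffE_nakayama, coeffα_nakayama]
      simp [TwoCycle.one_add_one]
      ring
    | add x y hx hy => simp only [map_add, hx, hy, mul_add, Finset.sum_add_distrib]
  | add x y hx hy =>
    simp only [map_add, LinearMap.add_apply, hx, hy, add_mul, Finset.sum_add_distrib]

/-- Here the surviving dual pair for the component at e i is (e (i + 1), α i). -/
theorem pairing_evenCochain_starChainChain_of_odd {p q : ℕ} (hq : Odd q)
    (x : Chain k (TwoCycleAlgebra k) p) (y : Chain k (TwoCycleAlgebra k) q) :
    pairing (frobenius k) rfl (evenCochain k (p + q + 1)) (starChainChain (frobenius k) p q x y) =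
      ∑ i, pairing (frobenius k) rfl (evenPart k p i) x *
        pairing (frobenius k) rfl (oddCochain k q i) y := by
  induction x using chain_induction with
  | mk a l hl =>
    induction y using chain_induction with
    | mk b l' hl' =>
      rw [pairing_starChainChain_chainOfList _ _ _ _ _ _ _ hl', Fintype.sum_sum_type]
      simp only [pairing_chainOfList, frobenius_u_inl, frobenius_u_inr, frobenius_v_inl,
        frobenius_v_inr, onList_evenCochain, onList_oddCochain, onList_evenPart,
        onList_arrowForm_middle (p := p) rfl _ _ _ _ hl', map_smul, smul_eq_mul, map_add,
        LinearMap.add_apply, LinearMap.smul_apply, α_form, e_form, TwoCycle.sum_eq, coeffα_mul,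
        TwoCycle.cast_odd hq, coeffE_nakayama, coeffα_nakayama]
      simp [TwoCycle.one_add_one]
      ring
    | add x y hx hy => simp only [map_add, hx, hy, mul_add, Finset.sum_add_distrib]
  | add x y hx hy =>
    simp only [map_add, LinearMap.add_apply, hx, hy, add_mul, Finset.sum_add_distrib]

theorem sum_pairing_evenPart {n : ℕ} (x : Chain k (TwoCycleAlgebra k) n) :
    ∑ i, pairing (frobenius k) rfl (evenPart k n i) x =
      pairing (frobenius k) rfl (evenCochain k n) x := by
  rw [evenCochain, map_sum, LinearMap.sum_apply]

theorem pairing_cochainRep_starChainChain {p q : ℕ}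
    {x : Chain k (TwoCycleAlgebra k) p} {y : Chain k (TwoCycleAlgebra k) q}
    (hx : IsCycle (frobenius k) x) (hy : IsCycle (frobenius k) y) :
    pairing (frobenius k) rfl (cochainRep k (p + q + 1)) (starChainChain (frobenius k) p q x y) =
      (if Even p ∧ Even q then 0 else 1) * (pairing (frobenius k) rfl (cochainRep k p) x *
        pairing (frobenius k) rfl (cochainRep k q) y) := by
  rcases Nat.even_or_odd p with hp | hp <;> rcases Nat.even_or_odd q with hq | hq
  · rw [if_pos ⟨hp, hq⟩, cochainRep_odd (hp.add hq).add_one,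
      pairing_oddCochain_starChainChain_even hq, zero_mul]
  · rw [if_neg (fun H => Nat.not_even_iff_odd.2 hq H.2), cochainRep_even (hp.add_odd hq).add_one,
      pairing_evenCochain_starChainChain_of_odd hq, one_mul]
    -- Since y is a cycle its pairing with the odd cochain is independent of the vertex and comes
    -- out of the sum, leaving the full even cochain on x.
    simp only [pairing_oddCochain hq _ hy]
    rw [← Finset.sum_mul, sum_pairing_evenPart, cochainRep_even hp]
  · rw [if_neg (fun H => Nat.not_even_iff_odd.2 hp H.1), cochainRep_even (hp.add_even hq).add_one,
      pairing_evenCochain_starChainChain_of_even hq, one_mul]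
    simp only [pairing_oddCochain hp _ hx]
    rw [← Finset.mul_sum, sum_pairing_evenPart, cochainRep_even hq]
  · rw [if_neg (fun H => Nat.not_even_iff_odd.2 hp H.1), cochainRep_odd (hp.add_odd hq).add_one,
      pairing_oddCochain_starChainChain hq, one_mul, cochainRep_odd hp, cochainRep_odd hq]

theorem pairing_starCochainChain'_chainRep {n p : ℕ}
    {f : Cochain k (TwoCycleAlgebra k) (n + (p + 1))} (hf : delta k _ _ f = 0)
    {x : Chain k (TwoCycleAlgebra k) p} (hx : IsCycle (frobenius k) x) :
    pairing (frobenius k) rfl (starCochainChain' (frobenius k) f x) (chainRep k n) =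
      (if Even p ∧ Even n then 0 else 1) * (pairing (frobenius k) rfl f (chainRep k _) *
        pairing (frobenius k) rfl (cochainRep k p) x) := by
  rw [pairing_starCochainChain' _ f (by omega), pairing_eq_mul _ hf (IsCycle.starChainChain _
    (nakayamaInv_eq_nakayama k) (sum_u_mul_v k) hx (isCycle_chainRep n)),
    pairing_cochainRep_starChainChain hx (isCycle_chainRep n), pairing_cochainRep_chainRep]
  ring

theorem pairing_starChainCochain'_chainRep {n p : ℕ}
    {f : Cochain k (TwoCycleAlgebra k) (p + 1 + n)} (hf : delta k _ _ f = 0)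
    {x : Chain k (TwoCycleAlgebra k) p} (hx : IsCycle (frobenius k) x) :
    pairing (frobenius k) rfl (starChainCochain' (frobenius k) f x) (chainRep k n) =
      (if Even p ∧ Even n then 0 else 1) * (pairing (frobenius k) rfl f (chainRep k _) *
        pairing (frobenius k) rfl (cochainRep k p) x) := by
  rw [pairing_starChainCochain' _ (nakayamaInv_eq_nakayama k) f (by omega),
    pairing_eq_mul _ hf (IsCycle.starChainChain _
    (nakayamaInv_eq_nakayama k) (sum_u_mul_v k) (isCycle_chainRep n) hx),
    pairing_cochainRep_starChainChain (isCycle_chainRep n) hx, pairing_cochainRep_chainRep]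
  simp only [and_comm (a := Even n)]
  ring

end Products

end TwoCycleAlgebra

universe u

/-! ### Cohomology classes as scalars -/

section Cast

variable {k A : Type u} [Field k] [Ring A] [Algebra k A] {ι : Type*} [Fintype ι] [DecidableEq ι]
  (F : FrobeniusData k A ι)

theorem D.cast_mem_cocycles {m n : ℤ} (h : m = n) {x : D k A m} (hx : x ∈ cocycles F m) :
    D.cast h x ∈ cocycles F n := by
  subst h; exact hx

theorem mu_eq_zero (hμ : ∀ a, ∑ i, F.u i * a * F.v i = 0) : mu F = 0 := by
  refine chain_hom_ext fun a => cochain_ext_list (k := k) (A := A) fun l hl => ?_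
  obtain rfl := List.length_eq_zero_iff.1 hl
  rw [mu, chainLift_chainMk]
  exact hμ (a 0)

/-- In degree -1 the differential is μ = 0, so every chain qualifies, in agreement with the
convention for cycles of degree zero. -/
theorem mem_cocycles_negSucc (hν : ∀ x, F.nakayamaInv x = F.nakayama x)
    (hμ : ∀ a, ∑ i, F.u i * a * F.v i = 0) {p : ℕ} {x : Chain k A p} :
    (show D k A (.negSucc p) from x) ∈ cocycles F (.negSucc p) ↔ IsCycle F x := by
  cases p with
  | zero =>
    refine iff_of_true (show mu F x = 0 from ?_) (isCycle_zero F x)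
    rw [mu_eq_zero F hμ, LinearMap.zero_apply]
  | succ p => exact (isCycle_succ_iff F hν x).symm

end Cast

namespace TwoCycleAlgebra

variable (k : Type u) [Field k]

/-- The functional on the terms of the complete Hochschild complex which takes the value `1` on the
standard representative in each degree, and which vanishes on the coboundaries. -/
noncomputable def classCoeff : (n : ℤ) → D k (TwoCycleAlgebra k) n →ₗ[k] k
  | .ofNat r => ((pairing (frobenius k) rfl).flip (chainRep k r) :
      Cochain k (TwoCycleAlgebra k) r →ₗ[k] k)
  | .negSucc p => (pairing (frobenius k) rfl (cochainRep k p) :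
      Chain k (TwoCycleAlgebra k) p →ₗ[k] k)

theorem classCoeff_cast {m n : ℤ} (h : m = n) (x : D k (TwoCycleAlgebra k) m) :
    classCoeff k n (D.cast h x) = classCoeff k m x := by
  subst h; rfl

variable {k}

theorem pairing_cochainRep_boundary {p : ℕ} (x : Chain k (TwoCycleAlgebra k) (p + 1)) :
    pairing (frobenius k) rfl (cochainRep k p) (boundary (frobenius k) p x) = 0 := by
  rw [← pairing_delta _ (nakayamaInv_eq_nakayama k), delta_cochainRep, map_zero,
    LinearMap.zero_apply]

theorem exists_dual_of_notMem {V : Type*} [AddCommGroup V] [Module k V] {W : Submodule k V} {x : V}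
    (hx : x ∉ W) : ∃ lam : V →ₗ[k] k, lam x ≠ 0 ∧ ∀ w ∈ W, lam w = 0 := by
  obtain ⟨lam, h1, h2⟩ := Submodule.exists_dual_map_eq_bot_of_notMem hx inferInstance
  exact ⟨lam, h1, fun w hw => (Submodule.mem_bot k).1 (h2 ▸ Submodule.mem_map_of_mem hw)⟩

/-- If x were not a boundary, a functional vanishing on boundaries would separate it. That
functional is the pairing with some cochain f, which is then a cocycle, so `pairing_eq_mul` makes
its value at x zero. -/
theorem mem_range_boundary {p : ℕ} {x : Chain k (TwoCycleAlgebra k) p}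
    (hx : IsCycle (frobenius k) x) (h : pairing (frobenius k) rfl (cochainRep k p) x = 0) :
    x ∈ LinearMap.range (boundary (frobenius k) p) := by
  by_contra H
  obtain ⟨lam, h1, h2⟩ := exists_dual_of_notMem H
  obtain ⟨f, rfl⟩ := exists_pairing_eq (frobenius k) lam
  have hf : delta k _ _ f = 0 := delta_eq_zero_of_pairing _ (nakayamaInv_eq_nakayama k) f fun y =>
    h2 _ (LinearMap.mem_range_self _ y)
  exact h1 (by rw [pairing_eq_mul rfl hf hx, h, mul_zero])

theorem mem_coboundaries_iff {n : ℤ} {x : D k (TwoCycleAlgebra k) n}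
    (hx : x ∈ cocycles (frobenius k) n) :
    x ∈ coboundaries (frobenius k) n ↔ classCoeff k n x = 0 := by
  have hμ := sum_u_mul_v (k := k)
  match n, x, hx with
  | .ofNat 0, x, hx =>
    -- The coboundaries of degree zero form the image of μ, which is zero, so the cocycle itself has
    -- to vanish.
    refine ⟨?_, fun h => ⟨0, (map_zero _).trans (eq_zero_of_pairing hx h).symm⟩⟩
    rintro ⟨a, rfl⟩
    rw [mu_eq_zero _ hμ]
    exact map_zero (classCoeff k _)
  | .ofNat (r + 1), x, hx =>
    refine ⟨?_, fun h => exists_primitive_of_pairing hx h⟩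
    rintro ⟨g, rfl⟩
    exact isCycle_chainRep (r + 1) r rfl g
  | .negSucc p, x, hx =>
    refine ⟨?_, fun h => mem_range_boundary
      ((mem_cocycles_negSucc _ (nakayamaInv_eq_nakayama k) hμ).1 hx) h⟩
    rintro ⟨y, rfl⟩
    exact pairing_cochainRep_boundary y

theorem exists_cocycle (n : ℤ) : ∃ x ∈ cocycles (frobenius k) n, classCoeff k n x = 1 := by
  match n with
  | .ofNat r => exact ⟨cochainRep k r, delta_cochainRep r, pairing_cochainRep_chainRep r⟩
  | .negSucc p => exact ⟨chainRep k p, (mem_cocycles_negSucc _ (nakayamaInv_eq_nakayama k)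
      (sum_u_mul_v (k := k))).2 (isCycle_chainRep p), pairing_cochainRep_chainRep p⟩

theorem submoduleOf_coboundaries (n : ℤ) :
    (coboundaries (frobenius k) n).submoduleOf (cocycles (frobenius k) n) =
      LinearMap.ker (classCoeff k n ∘ₗ (cocycles (frobenius k) n).subtype) :=
  Submodule.ext fun x => mem_coboundaries_iff x.2

/-- Every complete cohomology group of `A` is one-dimensional. -/
noncomputable def classEquiv (n : ℤ) : HH (frobenius k) n ≃ₗ[k] k :=
  (Submodule.quotEquivOfEq _ _ (submoduleOf_coboundaries n)).trans
    (LinearMap.quotKerEquivOfSurjective _ (by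
      obtain ⟨x, hx, h⟩ := exists_cocycle (k := k) n
      refine fun c => ⟨c • ⟨x, hx⟩, ?_⟩
      simp [h]))

theorem classEquiv_cls {n : ℤ} (x : cocycles (frobenius k) n) :
    classEquiv n (cls (frobenius k) x) = classCoeff k n x := rfl

theorem finrank_HH (n : ℤ) : Module.finrank k (HH (frobenius k) n) = 1 := by
  rw [(classEquiv n).finrank_eq, Module.finrank_self]

/-! ### The induced product on cohomology -/

section Star

/-- The structure constants of the product: the product of two classes of odd degree vanishes. -/
noncomputable def structureConst (k : Type u) [Field k] (m n : ℤ) : k :=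
  if Odd m ∧ Odd n then 0 else 1

/-- Stated for a free index with an equation p = m + q, so that the transport between degrees in
`starProduct` disappears by substitution. The three lemmas that follow do the same for the other
mixed products. -/
theorem starChainCochain_cast {m p q : ℕ} (hp : p = m + q)
    (h : Int.negSucc p = Int.negSucc (m + q)) {f : Cochain k (TwoCycleAlgebra k) m}
    (hf : delta k _ _ f = 0) {x : Chain k (TwoCycleAlgebra k) p} (hx : IsCycle (frobenius k) x) :
    IsCycle (frobenius k) (starChainCochain (q := q) (frobenius k) f
        (D.cast (m := Int.negSucc p) (n := Int.negSucc (m + q)) h x)) ∧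
      pairing (frobenius k) rfl (cochainRep k q) (starChainCochain (q := q) (frobenius k) f
        (D.cast (m := Int.negSucc p) (n := Int.negSucc (m + q)) h x)) =
      (if Odd m ∧ Odd q then 0 else 1) * (pairing (frobenius k) rfl (cochainRep k p) x *
        pairing (frobenius k) rfl f (chainRep k m)) := by
  subst hp
  rw [mul_comm (pairing (frobenius k) rfl (cochainRep k _) x)]
  exact ⟨hx.starChainCochain _ (nakayamaInv_eq_nakayama k) hf,
    pairing_cochainRep_starChainCochain hf hx⟩

theorem starCochainChain_cast {m p q : ℕ} (hp : p = q + m)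
    (h : Int.negSucc p = Int.negSucc (q + m)) {f : Cochain k (TwoCycleAlgebra k) m}
    (hf : delta k _ _ f = 0) {x : Chain k (TwoCycleAlgebra k) p} (hx : IsCycle (frobenius k) x) :
    IsCycle (frobenius k) (starCochainChain (q := q) f
        (D.cast (m := Int.negSucc p) (n := Int.negSucc (q + m)) h x)) ∧
      pairing (frobenius k) rfl (cochainRep k q) (starCochainChain (q := q) f
        (D.cast (m := Int.negSucc p) (n := Int.negSucc (q + m)) h x)) =
      (if Odd q ∧ Odd m then 0 else 1) * (pairing (frobenius k) rfl f (chainRep k m) *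
        pairing (frobenius k) rfl (cochainRep k p) x) := by
  subst hp
  exact ⟨hx.starCochainChain _ hf, pairing_cochainRep_starCochainChain hf hx⟩

theorem starChainCochain'_cast {m n p : ℕ} (hm : m = p + 1 + n)
    (h : Int.ofNat m = Int.ofNat (p + 1 + n)) {f : Cochain k (TwoCycleAlgebra k) m}
    (hf : delta k _ _ f = 0) {x : Chain k (TwoCycleAlgebra k) p} (hx : IsCycle (frobenius k) x) :
    delta k _ _ (starChainCochain' (n := n) (frobenius k)
        (D.cast (m := Int.ofNat m) (n := Int.ofNat (p + 1 + n)) h f) x) = 0 ∧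
      pairing (frobenius k) rfl (starChainCochain' (n := n) (frobenius k)
        (D.cast (m := Int.ofNat m) (n := Int.ofNat (p + 1 + n)) h f) x) (chainRep k n) =
      (if Even p ∧ Even n then 0 else 1) * (pairing (frobenius k) rfl (cochainRep k p) x *
        pairing (frobenius k) rfl f (chainRep k m)) := by
  subst hm
  rw [mul_comm (pairing (frobenius k) rfl (cochainRep k _) x)]
  exact ⟨delta_starChainCochain' _ (nakayamaInv_eq_nakayama k) (sum_u_mul_v (k := k)) f hf x hx,
    pairing_starChainCochain'_chainRep hf hx⟩

theorem starCochainChain'_cast {m n p : ℕ} (hm : m = n + (p + 1))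
    (h : Int.ofNat m = Int.ofNat (n + (p + 1))) {f : Cochain k (TwoCycleAlgebra k) m}
    (hf : delta k _ _ f = 0) {x : Chain k (TwoCycleAlgebra k) p} (hx : IsCycle (frobenius k) x) :
    delta k _ _ (starCochainChain' (n := n) (frobenius k)
        (D.cast (m := Int.ofNat m) (n := Int.ofNat (n + (p + 1))) h f) x) = 0 ∧
      pairing (frobenius k) rfl (starCochainChain' (n := n) (frobenius k)
        (D.cast (m := Int.ofNat m) (n := Int.ofNat (n + (p + 1))) h f) x) (chainRep k n) =
      (if Even p ∧ Even n then 0 else 1) * (pairing (frobenius k) rfl f (chainRep k m) *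
        pairing (frobenius k) rfl (cochainRep k p) x) := by
  subst hm
  exact ⟨delta_starCochainChain' _ (nakayamaInv_eq_nakayama k) (sum_u_mul_v (k := k)) f hf x hx,
    pairing_starCochainChain'_chainRep hf hx⟩

/-- Collects the products by the signs of the two degrees. A chain of C_p has degree -p - 1, which
is odd exactly when p is even; this reconciles the parity conditions on chains with those of
`structureConst`. -/
theorem starProduct_cocycle {m n : ℤ} {x : D k (TwoCycleAlgebra k) m}
    {y : D k (TwoCycleAlgebra k) n} (hx : x ∈ cocycles (frobenius k) m)
    (hy : y ∈ cocycles (frobenius k) n) :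
    starProduct (frobenius k) x y ∈ cocycles (frobenius k) (m + n) ∧
      classCoeff k (m + n) (starProduct (frobenius k) x y) =
        structureConst k m n * (classCoeff k m x * classCoeff k n y) := by
  have hν := nakayamaInv_eq_nakayama k
  have hμ := sum_u_mul_v (k := k)
  match m, n, x, y, hx, hy with
  | .ofNat m, .ofNat n, f, g, hf, hg =>
    refine ⟨D.cast_mem_cocycles _ _ (delta_cup hf hg), ?_⟩
    rw [starProduct]
    refine (classCoeff_cast k _ _).trans ((pairing_cup hf hg).trans
      (congrArg (· * _) (if_congr ?_ rfl rfl)))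
    simp
  | .negSucc p, .ofNat m, x, f, hx, hf =>
    have hx' := (mem_cocycles_negSucc _ hν hμ).1 hx
    rw [starProduct]
    split_ifs with h
    · obtain ⟨h1, h2⟩ := starChainCochain_cast (q := p - m) (by omega)
        (by congr 1; omega) hf hx'
      refine ⟨D.cast_mem_cocycles _ _ ((mem_cocycles_negSucc _ hν hμ).2 h1), ?_⟩
      refine (classCoeff_cast k _ _).trans (h2.trans (congrArg (· * _) (if_congr ?_ rfl rfl)))
      grind
    · obtain ⟨h1, h2⟩ := starChainCochain'_cast (n := m - (p + 1)) (by omega)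
        (by congr 1; omega) hf hx'
      refine ⟨D.cast_mem_cocycles _ _ h1, ?_⟩
      refine (classCoeff_cast k _ _).trans (h2.trans (congrArg (· * _) (if_congr ?_ rfl rfl)))
      grind
  | .ofNat m, .negSucc p, f, x, hf, hx =>
    have hx' := (mem_cocycles_negSucc _ hν hμ).1 hx
    rw [starProduct]
    split_ifs with h
    · obtain ⟨h1, h2⟩ := starCochainChain_cast (q := p - m) (by omega)
        (by congr 1; omega) hf hx'
      refine ⟨D.cast_mem_cocycles _ _ ((mem_cocycles_negSucc _ hν hμ).2 h1), ?_⟩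
      refine (classCoeff_cast k _ _).trans (h2.trans (congrArg (· * _) (if_congr ?_ rfl rfl)))
      grind
    · obtain ⟨h1, h2⟩ := starCochainChain'_cast (n := m - (p + 1)) (by omega)
        (by congr 1; omega) hf hx'
      refine ⟨D.cast_mem_cocycles _ _ h1, ?_⟩
      refine (classCoeff_cast k _ _).trans (h2.trans (congrArg (· * _) (if_congr ?_ rfl rfl)))
      grind
  | .negSucc p, .negSucc q, x, y, hx, hy =>
    have hx' := (mem_cocycles_negSucc _ hν hμ).1 hx
    have hy' := (mem_cocycles_negSucc _ hν hμ).1 hy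
    rw [starProduct]
    refine ⟨D.cast_mem_cocycles _ _ ((mem_cocycles_negSucc _ hν hμ).2
      (IsCycle.starChainChain _ hν hμ hx' hy')), ?_⟩
    refine (classCoeff_cast k _ _).trans ((pairing_cochainRep_starChainChain hx' hy').trans
      (congrArg (· * _) (if_congr ?_ rfl rfl)))
    grind

/-- The product on cohomology. -/
noncomputable def mulHH (m n : ℤ) :
    HH (frobenius k) m →ₗ[k] HH (frobenius k) n →ₗ[k] HH (frobenius k) (m + n) :=
  ((LinearMap.mul k k).compl₁₂ (classEquiv m).toLinearMap (classEquiv n).toLinearMap).compr₂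
    (structureConst k m n • (classEquiv (m + n)).symm.toLinearMap)

theorem classEquiv_mulHH (m n : ℤ) (x : HH (frobenius k) m) (y : HH (frobenius k) n) :
    classEquiv (m + n) (mulHH m n x y) =
      structureConst k m n * (classEquiv m x * classEquiv n y) := by
  simp [mulHH]

/-- The product was defined by its structure constants; it is the induced one because a class is
determined by its scalar and the scalar of x ⋆ y has been computed for all cocycles. -/
theorem isInducedByStar_mulHH : IsInducedByStar (frobenius k) mulHH := by
  intro m n x y
  obtain ⟨h1, h2⟩ := starProduct_cocycle x.2 y.2
  refine ⟨h1, (classEquiv (m + n)).injective ?_⟩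
  rw [classEquiv_mulHH, classEquiv_cls, classEquiv_cls, classEquiv_cls, h2]

end Star

/-! ### The prescribed generators are the standard representatives -/

section Generators

theorem unitCochain_eq : unitCochain k (TwoCycleAlgebra k) = cochainRep k 0 := by
  rw [cochainRep_even (by simp)]
  refine cochain_ext_list fun l hl => ?_
  obtain rfl := List.length_eq_zero_iff.1 hl
  rw [onList_evenCochain]
  simp only [onList_arrowForm_nil, one_smul]
  exact one_eq k

theorem alphaCochain_eq : alphaCochain k = cochainRep k 2 := by
  rw [cochainRep_even (by simp)]
  refine cochain_ext_list fun l hl => ?_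
  obtain ⟨a, b, rfl⟩ := List.length_eq_two.1 hl
  rw [onList_evenCochain]
  simp only [onList_arrowForm_cons, onList_arrowForm_nil, mul_one]
  rfl

theorem betaCochain_eq : betaCochain k = cochainRep k 1 := by
  rw [cochainRep_odd (by simp)]
  refine cochain_ext_list fun l hl => ?_
  obtain ⟨a, rfl⟩ := List.length_eq_one_iff.1 hl
  rw [onList_oddCochain, onList_arrowForm_cons, onList_arrowForm_nil, mul_one]
  rfl

theorem chainOfList_cons_path_one (z : TwoCycleAlgebra k) (i : TwoCycle) :
    chainOfList k 1 (z :: path k i 1) = chainMk k (TwoCycleAlgebra k) 1 ![z, α k i] :=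
  congrArg (chainMk k (TwoCycleAlgebra k) 1) (funext fun j : Fin 2 => by fin_cases j <;> rfl)

theorem gammaChain_eq : gammaChain k = chainRep k 1 := by
  rw [chainRep, if_neg (by simp), TwoCycle.sum_eq, add_comm, TwoCycle.one_add_one, zero_add,
    chainOfList_cons_path_one, chainOfList_cons_path_one]
  rfl

theorem cochainRep_mem_cocycles (r : ℕ) :
    (show D k (TwoCycleAlgebra k) (.ofNat r) from cochainRep k r) ∈
      cocycles (frobenius k) (.ofNat r) := delta_cochainRep r

theorem chainRep_mem_cocycles (p : ℕ) :
    (show D k (TwoCycleAlgebra k) (.negSucc p) from chainRep k p) ∈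
      cocycles (frobenius k) (.negSucc p) :=
  (mem_cocycles_negSucc _ (nakayamaInv_eq_nakayama k) (sum_u_mul_v (k := k))).2
    (isCycle_chainRep p)

theorem exists_classEquiv_unitCochain :
    ∃ h : unitCochain k (TwoCycleAlgebra k) ∈ cocycles (frobenius k) 0,
      classEquiv 0 (cls _ ⟨_, h⟩) = 1 := by
  rw [unitCochain_eq]
  exact ⟨cochainRep_mem_cocycles 0, pairing_cochainRep_chainRep 0⟩

theorem exists_classEquiv_alphaCochain :
    ∃ h : alphaCochain k ∈ cocycles (frobenius k) 2, classEquiv 2 (cls _ ⟨_, h⟩) = 1 := by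
  rw [alphaCochain_eq]
  exact ⟨cochainRep_mem_cocycles 2, pairing_cochainRep_chainRep 2⟩

theorem exists_classEquiv_betaCochain :
    ∃ h : betaCochain k ∈ cocycles (frobenius k) 1, classEquiv 1 (cls _ ⟨_, h⟩) = 1 := by
  rw [betaCochain_eq]
  exact ⟨cochainRep_mem_cocycles 1, pairing_cochainRep_chainRep 1⟩

theorem exists_classEquiv_gammaChain :
    ∃ h : gammaChain k ∈ cocycles (frobenius k) (-2), classEquiv (-2) (cls _ ⟨_, h⟩) = 1 := by
  rw [gammaChain_eq]
  exact ⟨chainRep_mem_cocycles 1, pairing_cochainRep_chainRep 1⟩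

end Generators

end TwoCycleAlgebra

namespace TwoCycleAlgebra

/-! ### A homogeneous basis of the target ring -/

section Target

variable (k : Type u) [Field k]

theorem gen_zero_mul_gen_two : gen k 0 * gen k 2 = 1 := by
  rw [gen, gen, ← map_mul, ← map_one (Ideal.Quotient.mk (relations k)), Ideal.Quotient.eq]
  exact Ideal.subset_span (by simp)

theorem gen_one_mul_gen_one : gen k 1 * gen k 1 = 0 := by
  rw [gen, ← map_mul, ← pow_two, Ideal.Quotient.eq_zero_iff_mem]
  exact Ideal.subset_span (by simp)

/-- The generator of degree two, as a unit. -/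
noncomputable def genUnit : (TargetRing k)ˣ :=
  Units.mkOfMulEqOne (gen k 0) (gen k 2) (gen_zero_mul_gen_two k)

/-- The basis element of degree `n` of `k[α, β, γ] / ⟨αγ - 1, β²⟩`. -/
noncomputable def targetBasis (n : ℤ) : TargetRing k :=
  ↑(genUnit k ^ (n / 2)) * if Odd n then gen k 1 else 1

theorem targetBasis_two_mul (n : ℤ) : targetBasis k (2 * n) = ↑(genUnit k ^ n) := by
  rw [targetBasis, if_neg (by simp), mul_one, Int.mul_ediv_cancel_left _ two_ne_zero]

/-- Integer division rounds down, so for negative odd degrees as well the exponent is n and the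
factor β raises the degree by one. -/
theorem targetBasis_two_mul_add_one (n : ℤ) :
    targetBasis k (2 * n + 1) = ↑(genUnit k ^ n) * gen k 1 := by
  rw [targetBasis, if_pos ⟨n, rfl⟩]
  congr 3
  omega

theorem targetBasis_mul (m n : ℤ) :
    targetBasis k m * targetBasis k n = structureConst k m n • targetBasis k (m + n) := by
  rcases Int.even_or_odd' m with ⟨a, rfl | rfl⟩ <;> rcases Int.even_or_odd' n with ⟨b, rfl | rfl⟩
  · rw [← mul_add, structureConst, if_neg (by simp), one_smul]
    simp only [targetBasis_two_mul, zpow_add, Units.val_mul]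
  · rw [← add_assoc, ← mul_add, structureConst, if_neg (by simp), one_smul]
    simp only [targetBasis_two_mul, targetBasis_two_mul_add_one, zpow_add, Units.val_mul, mul_assoc]
  · rw [add_right_comm, ← mul_add, structureConst, if_neg (by simp), one_smul]
    simp only [targetBasis_two_mul, targetBasis_two_mul_add_one, zpow_add, Units.val_mul]
    ring
  · rw [structureConst, if_pos (by simp), zero_smul, targetBasis_two_mul_add_one,
      targetBasis_two_mul_add_one, mul_mul_mul_comm, gen_one_mul_gen_one, mul_zero]

theorem targetBasis_zero : targetBasis k 0 = 1 := by
  simpa using targetBasis_two_mul k 0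

theorem targetBasis_one : targetBasis k 1 = gen k 1 := by
  simpa using targetBasis_two_mul_add_one k 0

theorem targetBasis_weight (i : Fin 3) :
    targetBasis k ((![2, 1, -2] : Fin 3 → ℤ) i) = gen k i := by
  fin_cases i
  · exact (targetBasis_two_mul k 1).trans (by rw [zpow_one]; rfl)
  · exact targetBasis_one k
  · exact (targetBasis_two_mul k (-1)).trans (by rw [zpow_neg_one])

open LaurentPolynomial in
/-- The algebra homomorphism from `k[α, β, γ] / ⟨αγ - 1, β²⟩` to the dual numbers over the Laurent
polynomials, with `α ↦ T`, `β ↦ ε` and `γ ↦ T⁻¹`. -/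
noncomputable def toDualNumber : TargetRing k →ₐ[k] DualNumber (LaurentPolynomial k) :=
  Ideal.Quotient.liftₐ (relations k)
    (MvPolynomial.aeval ![TrivSqZeroExt.inl (T 1), DualNumber.eps, TrivSqZeroExt.inl (T (-1))])
    (by
      intro a ha
      refine (Ideal.span_le (I := RingHom.ker (MvPolynomial.aeval
        ![TrivSqZeroExt.inl (T 1), DualNumber.eps, TrivSqZeroExt.inl (T (-1))] :
          MvPolynomial (Fin 3) k →ₐ[k] DualNumber (LaurentPolynomial k)))).2 ?_ ha
      rintro x (rfl | rfl)
      · simp only [SetLike.mem_coe, RingHom.mem_ker, map_sub, map_mul, map_one,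
          MvPolynomial.aeval_X]
        change TrivSqZeroExt.inl (T 1) * TrivSqZeroExt.inl (T (-1)) - 1 = 0
        rw [← TrivSqZeroExt.inl_mul, ← T_add, add_neg_cancel, T_zero, TrivSqZeroExt.inl_one, sub_self]
      · simp [RingHom.mem_ker, pow_two])

open LaurentPolynomial in
theorem toDualNumber_gen (i : Fin 3) : toDualNumber k (gen k i) =
    ![TrivSqZeroExt.inl (T 1), DualNumber.eps, TrivSqZeroExt.inl (T (-1))] i :=
  MvPolynomial.aeval_X _ i

open LaurentPolynomial in
theorem toDualNumber_genUnit_zpow (n : ℤ) :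
    toDualNumber k ↑(genUnit k ^ n) = TrivSqZeroExt.inl (T n) := by
  induction n with
  | zero => simp
  | succ n ih =>
    rw [zpow_add_one, Units.val_mul, map_mul, ih, T_add, TrivSqZeroExt.inl_mul]
    exact congrArg _ (toDualNumber_gen k 0)
  | pred n ih =>
    rw [zpow_sub_one, Units.val_mul, map_mul, ih, sub_eq_add_neg, T_add, TrivSqZeroExt.inl_mul]
    exact congrArg _ (toDualNumber_gen k 2)

/-- The coefficient of the basis element of degree `n`. -/
noncomputable def targetCoeff (n : ℤ) : TargetRing k →ₗ[k] k :=
  Finsupp.lapply (n / 2) ∘ₗ (AddMonoidAlgebra.coeffLinearEquiv k).toLinearMap ∘ₗ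
    (if Odd n then (TrivSqZeroExt.sndHom (LaurentPolynomial k) (LaurentPolynomial k)).restrictScalars k
      else (TrivSqZeroExt.fstHom k (LaurentPolynomial k) (LaurentPolynomial k)).toLinearMap) ∘ₗ
    (toDualNumber k).toLinearMap

theorem targetCoeff_two_mul (n : ℤ) (x : TargetRing k) :
    targetCoeff k (2 * n) x = (toDualNumber k x).fst.coeff n := by
  rw [targetCoeff, if_neg (by simp), Int.mul_ediv_cancel_left _ two_ne_zero]
  rfl

theorem targetCoeff_two_mul_add_one (n : ℤ) (x : TargetRing k) :
    targetCoeff k (2 * n + 1) x = (toDualNumber k x).snd.coeff n := by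
  rw [targetCoeff, if_pos ⟨n, rfl⟩, show (2 * n + 1) / 2 = n by omega]
  rfl

/-- In the dual numbers over the Laurent polynomials the basis elements become T^n and T^n ε, whose
coefficients can be read off; this is linear independence. -/
theorem targetCoeff_targetBasis (m n : ℤ) :
    targetCoeff k n (targetBasis k m) = if m = n then 1 else 0 := by
  have h1 : toDualNumber k (gen k 1) = DualNumber.eps := toDualNumber_gen k 1
  rcases Int.even_or_odd' m with ⟨a, rfl | rfl⟩ <;> rcases Int.even_or_odd' n with ⟨b, rfl | rfl⟩
  · simp [targetCoeff_two_mul, targetBasis_two_mul, toDualNumber_genUnit_zpow]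
  · rw [if_neg (by omega)]
    simp [targetCoeff_two_mul_add_one, targetBasis_two_mul, toDualNumber_genUnit_zpow]
  · rw [if_neg (by omega)]
    simp [targetCoeff_two_mul, targetBasis_two_mul_add_one, toDualNumber_genUnit_zpow, h1]
  · simp [targetCoeff_two_mul_add_one, targetBasis_two_mul_add_one, toDualNumber_genUnit_zpow, h1]

theorem mul_mem_span_targetBasis {m n : ℤ} {x y : TargetRing k} (hx : x ∈ k ∙ targetBasis k m)
    (hy : y ∈ k ∙ targetBasis k n) : x * y ∈ k ∙ targetBasis k (m + n) := by
  obtain ⟨a, rfl⟩ := Submodule.mem_span_singleton.1 hx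
  obtain ⟨b, rfl⟩ := Submodule.mem_span_singleton.1 hy
  rw [smul_mul_smul_comm, targetBasis_mul]
  exact Submodule.smul_mem _ _ (Submodule.smul_mem _ _ (Submodule.mem_span_singleton_self _))

theorem gen_pow_mem_span_targetBasis (i : Fin 3) (e : ℕ) :
    gen k i ^ e ∈ k ∙ targetBasis k (e • (![2, 1, -2] : Fin 3 → ℤ) i) := by
  induction e with
  | zero =>
    rw [zero_smul, pow_zero, targetBasis_zero]
    exact Submodule.mem_span_singleton_self _
  | succ e ih =>
    rw [succ_nsmul, pow_succ]
    refine mul_mem_span_targetBasis k ih ?_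
    rw [targetBasis_weight]
    exact Submodule.mem_span_singleton_self _

/-- A product of basis elements is a multiple of the basis element of the total degree, so a
monomial lands on the line of its weight. Both spanning and the description of the graded pieces
follow. -/
theorem mk_monomial_mem_span_targetBasis (s : Fin 3 →₀ ℕ) (c : k) :
    Ideal.Quotient.mk (relations k) (MvPolynomial.monomial s c) ∈
      k ∙ targetBasis k (Finsupp.weight (![2, 1, -2] : Fin 3 → ℤ) s) := by
  have h : Ideal.Quotient.mk (relations k) (MvPolynomial.monomial s c) =
      c • (gen k 0 ^ s 0 * gen k 1 ^ s 1 * gen k 2 ^ s 2) := by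
    rw [MvPolynomial.monomial_eq, Finsupp.prod_fintype _ _ (by simp), Fin.prod_univ_three,
      ← MvPolynomial.smul_eq_C_mul]
    simp only [gen, ← map_pow, ← map_mul]
    rfl
  rw [h, Finsupp.weight_apply, Finsupp.sum_fintype _ _ (by simp), Fin.sum_univ_three]
  exact Submodule.smul_mem _ _ (mul_mem_span_targetBasis k (mul_mem_span_targetBasis k
    (gen_pow_mem_span_targetBasis k 0 _) (gen_pow_mem_span_targetBasis k 1 _))
    (gen_pow_mem_span_targetBasis k 2 _))

theorem mul_mem_targetDegree {m n : ℤ} {x y : TargetRing k} (hx : x ∈ targetDegree k m)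
    (hy : y ∈ targetDegree k n) : x * y ∈ targetDegree k (m + n) := by
  obtain ⟨a, ha, rfl⟩ := hx
  obtain ⟨b, hb, rfl⟩ := hy
  exact ⟨a * b, MvPolynomial.IsWeightedHomogeneous.mul ha hb, map_mul (Ideal.Quotient.mk (relations k)) a b⟩

theorem one_mem_targetDegree : 1 ∈ targetDegree k 0 :=
  ⟨1, MvPolynomial.isWeightedHomogeneous_one k _, map_one (Ideal.Quotient.mk (relations k))⟩

theorem gen_mem_targetDegree (i : Fin 3) :
    gen k i ∈ targetDegree k ((![2, 1, -2] : Fin 3 → ℤ) i) :=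
  ⟨MvPolynomial.X i, MvPolynomial.isWeightedHomogeneous_X k _ i, rfl⟩

theorem genUnit_zpow_mem_targetDegree (n : ℤ) : ↑(genUnit k ^ n) ∈ targetDegree k (2 * n) := by
  induction n with
  | zero => simpa using one_mem_targetDegree k
  | succ n ih =>
    rw [zpow_add_one, Units.val_mul, mul_add]
    exact mul_mem_targetDegree k ih (gen_mem_targetDegree k 0)
  | pred n ih =>
    rw [zpow_sub_one, Units.val_mul, mul_sub, sub_eq_add_neg]
    exact mul_mem_targetDegree k ih (gen_mem_targetDegree k 2)

theorem targetBasis_mem_targetDegree (n : ℤ) : targetBasis k n ∈ targetDegree k n := by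
  rcases Int.even_or_odd' n with ⟨a, rfl | rfl⟩
  · rw [targetBasis_two_mul]
    exact genUnit_zpow_mem_targetDegree k a
  · rw [targetBasis_two_mul_add_one]
    exact mul_mem_targetDegree k (genUnit_zpow_mem_targetDegree k a) (gen_mem_targetDegree k 1)

theorem targetDegree_eq_span (n : ℤ) : targetDegree k n = k ∙ targetBasis k n := by
  refine le_antisymm ?_ ((Submodule.span_singleton_le_iff_mem _ _).2
    (targetBasis_mem_targetDegree k n))
  rintro _ ⟨p, hp, rfl⟩
  rw [p.as_sum, map_sum]
  refine Submodule.sum_mem _ fun s hs => ?_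
  rw [← hp (MvPolynomial.mem_support_iff.1 hs)]
  exact mk_monomial_mem_span_targetBasis k s _

end Target

/-! ### The graded isomorphism -/

section Comparison

variable {k : Type u} [Field k]

/-- The linear map from the complete cohomology of `A` to `k[α, β, γ] / ⟨αγ - 1, β²⟩` which sends the
standard class of degree `n` to the basis element of degree `n`. -/
noncomputable def toTarget (k : Type u) [Field k] :
    DirectSum ℤ (fun n => HH (frobenius k) n) →ₗ[k] TargetRing k :=
  DirectSum.toModule k ℤ _ fun n => (classEquiv n).toLinearMap.smulRight (targetBasis k n)

theorem toTarget_lof (n : ℤ) (x : HH (frobenius k) n) :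
    toTarget k (DirectSum.lof k ℤ _ n x) = classEquiv n x • targetBasis k n := by
  simp [toTarget]

/-- Each homogeneous component is recovered from the image, which gives injectivity. -/
theorem targetCoeff_toTarget (n : ℤ) (x : DirectSum ℤ (fun n => HH (frobenius k) n)) :
    targetCoeff k n (toTarget k x) = classEquiv n (x n) := by
  have H : targetCoeff k n ∘ₗ toTarget k =
      (classEquiv n).toLinearMap ∘ₗ DirectSum.component k ℤ _ n := by
    refine DirectSum.linearMap_ext k fun m => LinearMap.ext fun y => ?_
    simp only [LinearMap.comp_apply, toTarget_lof, map_smul, targetCoeff_targetBasis]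
    by_cases h : m = n
    · subst h
      simp [DirectSum.component.lof_self]
    · simp [DirectSum.component.of, h]
  exact LinearMap.congr_fun H x

theorem toTarget_injective : Function.Injective (toTarget k) := by
  refine (injective_iff_map_eq_zero _).2 fun x hx => DFinsupp.ext fun n => ?_
  have := targetCoeff_toTarget n x
  rw [hx, map_zero] at this
  exact (classEquiv n).map_eq_zero_iff.1 this.symm

theorem toTarget_surjective : Function.Surjective (toTarget k) := by
  refine LinearMap.range_eq_top.1 (eq_top_iff.2 fun x _ => ?_)
  obtain ⟨p, rfl⟩ := Ideal.Quotient.mk_surjective x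
  rw [p.as_sum, map_sum]
  refine Submodule.sum_mem _ fun s _ => ?_
  obtain ⟨c, hc⟩ := Submodule.mem_span_singleton.1
    (mk_monomial_mem_span_targetBasis k s (p.coeff s))
  refine ⟨DirectSum.lof k ℤ _ (Finsupp.weight (![2, 1, -2] : Fin 3 → ℤ) s) ((classEquiv _).symm c), ?_⟩
  rw [toTarget_lof, LinearEquiv.apply_symm_apply, hc]

/-- The complete cohomology of `A` is `k[α, β, γ] / ⟨αγ - 1, β²⟩`. -/
noncomputable def targetEquiv (k : Type u) [Field k] :
    DirectSum ℤ (fun n => HH (frobenius k) n) ≃ₗ[k] TargetRing k :=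
  LinearEquiv.ofBijective (toTarget k) ⟨toTarget_injective, toTarget_surjective⟩

theorem targetEquiv_lof (n : ℤ) (x : HH (frobenius k) n) :
    targetEquiv k (DirectSum.lof k ℤ _ n x) = classEquiv n x • targetBasis k n :=
  toTarget_lof n x

theorem targetEquiv_mulHH (m n : ℤ) (x : HH (frobenius k) m) (y : HH (frobenius k) n) :
    targetEquiv k (DirectSum.lof k ℤ _ (m + n) (mulHH m n x y)) =
      targetEquiv k (DirectSum.lof k ℤ _ m x) * targetEquiv k (DirectSum.lof k ℤ _ n y) := by
  rw [targetEquiv_lof, targetEquiv_lof, targetEquiv_lof, classEquiv_mulHH, smul_mul_smul_comm,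
    targetBasis_mul, smul_smul, mul_comm]

theorem range_targetEquiv_lof (n : ℤ) :
    LinearMap.range ((targetEquiv k).toLinearMap ∘ₗ DirectSum.lof k ℤ _ n) = targetDegree k n := by
  rw [targetDegree_eq_span]
  refine le_antisymm ?_ ((Submodule.span_singleton_le_iff_mem _ _).2
    ⟨(classEquiv n).symm 1, ?_⟩)
  · rintro _ ⟨x, rfl⟩
    exact Submodule.mem_span_singleton.2 ⟨_, (targetEquiv_lof n x).symm⟩
  · exact (targetEquiv_lof n _).trans (by rw [LinearEquiv.apply_symm_apply, one_smul])

end Comparison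

end TwoCycleAlgebra

end CompleteHochschild

/-! ### The main theorem -/

open CompleteHochschild

theorem mainTheorem9 {k : Type*} [Field k] (hk : ringChar k ≠ 2) :
    (∀ n : ℤ, Module.finrank k (HH (TwoCycleAlgebra.frobenius k) n) = 1) ∧
    ∃ mul : ∀ m n : ℤ, HH (TwoCycleAlgebra.frobenius k) m →ₗ[k]
        HH (TwoCycleAlgebra.frobenius k) n →ₗ[k] HH (TwoCycleAlgebra.frobenius k) (m + n),
      IsInducedByStar (TwoCycleAlgebra.frobenius k) mul ∧
      ∃ Φ : DirectSum ℤ (fun n => HH (TwoCycleAlgebra.frobenius k) n) ≃ₗ[k]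
          TwoCycleAlgebra.TargetRing k,
        (∀ (m n : ℤ) (x : HH (TwoCycleAlgebra.frobenius k) m)
          (y : HH (TwoCycleAlgebra.frobenius k) n),
          Φ (DirectSum.lof k ℤ _ (m + n) (mul m n x y)) =
            Φ (DirectSum.lof k ℤ _ m x) * Φ (DirectSum.lof k ℤ _ n y)) ∧
        (∀ n : ℤ, LinearMap.range (Φ.toLinearMap ∘ₗ DirectSum.lof k ℤ _ n) =
          TwoCycleAlgebra.targetDegree k n) ∧
        (∃ h : unitCochain k (TwoCycleAlgebra k) ∈ cocycles (TwoCycleAlgebra.frobenius k) 0,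
          Φ (DirectSum.lof k ℤ _ 0 (cls _ ⟨_, h⟩)) = 1) ∧
        (∃ h : TwoCycleAlgebra.alphaCochain k ∈ cocycles (TwoCycleAlgebra.frobenius k) 2,
          Φ (DirectSum.lof k ℤ _ 2 (cls _ ⟨_, h⟩)) = TwoCycleAlgebra.gen k 0) ∧
        (∃ h : TwoCycleAlgebra.betaCochain k ∈ cocycles (TwoCycleAlgebra.frobenius k) 1,
          Φ (DirectSum.lof k ℤ _ 1 (cls _ ⟨_, h⟩)) = TwoCycleAlgebra.gen k 1) ∧
        (∃ h : TwoCycleAlgebra.gammaChain k ∈ cocycles (TwoCycleAlgebra.frobenius k) (-2),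
          Φ (DirectSum.lof k ℤ _ (-2) (cls _ ⟨_, h⟩)) = TwoCycleAlgebra.gen k 2) := by
  refine ⟨TwoCycleAlgebra.finrank_HH, TwoCycleAlgebra.mulHH, TwoCycleAlgebra.isInducedByStar_mulHH,
    TwoCycleAlgebra.targetEquiv k, TwoCycleAlgebra.targetEquiv_mulHH,
    TwoCycleAlgebra.range_targetEquiv_lof, ?_, ?_, ?_, ?_⟩
  · obtain ⟨h, h'⟩ := TwoCycleAlgebra.exists_classEquiv_unitCochain (k := k)
    exact ⟨h, by rw [TwoCycleAlgebra.targetEquiv_lof, h', one_smul, TwoCycleAlgebra.targetBasis_zero]⟩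
  · obtain ⟨h, h'⟩ := TwoCycleAlgebra.exists_classEquiv_alphaCochain (k := k)
    exact ⟨h, by
      rw [TwoCycleAlgebra.targetEquiv_lof, h', one_smul]
      exact TwoCycleAlgebra.targetBasis_weight k 0⟩
  · obtain ⟨h, h'⟩ := TwoCycleAlgebra.exists_classEquiv_betaCochain (k := k)
    exact ⟨h, by rw [TwoCycleAlgebra.targetEquiv_lof, h', one_smul, TwoCycleAlgebra.targetBasis_one]⟩
  · obtain ⟨h, h'⟩ := TwoCycleAlgebra.exists_classEquiv_gammaChain (k := k)
    exact ⟨h, by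
      rw [TwoCycleAlgebra.targetEquiv_lof, h', one_smul]
      exact TwoCycleAlgebra.targetBasis_weight k 2⟩
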